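/- Let $\mathbb H^3=\{(z,t): z\in\mathbb C,\ t>0\}$ be the upper half-space model, with ideal boundary $\mathbb C\cup\{\infty\}$, let $\omega=\tfrac12(1+i\sqrt3)$, and let $\mathrm{Isom}(\mathbb H^3)$ be its full isometry group. The regular ideal tetrahedron with ideal vertices $0,1,\omega,\infty$ and the regular ideal octahedron with ideal vertices $0,1,1+i,i,\tfrac12(1+i),\infty$ are said to be in standard position. A tiling of $\mathbb H^3$ means a locally finite, face-to-face tiling. A complete finite-volume hyperbolic $3$-manifold $M=\mathbb H^3/\Gamma$ (orientable or not) is *mixed-platonic* if there is a $\Gamma$-invariant tiling of $\mathbb H^3$ by regular ideal tetrahedra and regular ideal octahedra, with $n_1$ $\Gamma$-orbits of tetrahedra and $n_2$ $\Gamma$-orbits of octahedra, where $1\le n_1,n_2<\infty$. A tiling $\mathcal T$ of $\mathbb C$ is a *peripheral tiling* of $M$ if, after replacing $\Gamma$ by a conjugate in $\mathrm{Isom}(\mathbb H^3)$, there is such a $\Gamma$-invariant tiling $\mathcal P$ having a tile in standard position, with $\mathcal T=\mathcal P\cap\partial B_\infty$, the set of non-empty intersections of tiles of $\mathcal P$ with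 the horosphere $\partial B_\infty=\{(z,1): z\in\mathbb C\}\cong\mathbb C$ that bounds the horoball $B_\infty=\{(z,t): t\ge 1\}$. Let $\mathcal R$ be the "ace" tiling of $\mathbb C$ by unit squares and unit equilateral triangles (also named $[3^6;\,3^3.4^2;\,3^2.4.3.4]$), in which each square is surrounded by three triangles and one other square and which has rotational symmetries of order $3$. Explicitly, its tiles are the translates, by the elements of the lattice $(2+\sqrt3)\,i\,\mathbb Z[\omega]$, of the convex hulls of the following sets, $0\le k\le 5$: - $\{0,\ \omega^k,\ \omega^{k+1}\}$; - $\{\omega^{k+1},\ \omega^{k+2},\ \omega^{k+2}+i\omega^k,\ \omega^{k+1}+i\omega^k\}$; - $\{\omega^{k+2},\ \omega^{k+2}+i\omega^k,\ \omega^{k+2}+i\omega^{k+1}\}$; - $\{\omega^{k+2}+i\omega^k,\ \omega^{k+2}+i\omega^{k+1},\ \omega^{k+2}+i\omega^k+i\omega^{k+1}\}$. **Proposition.** If $M$ is a mixed-platonic hyperbolic $3$-manifold with exactly one cusp, then no image of $\mathcal R$ under an isometry of $\mathbb C$ is a peripheral tiling of $M$. -/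

import Mathlib

open Set Filter Topology MeasureTheory

namespace MixedPlatonic

noncomputable section

/-! ### Hyperbolic 3-space -/

/-- Hyperbolic 3-space in the upper half-space model: pairs `(z, t)` with `z : ℂ` and `t > 0`.
Its topology and its Borel structure are those of a subset of `ℂ × ℝ`. -/
abbrev HypSpace : Type := {p : ℂ × ℝ // 0 < p.2}

/-- The hyperbolic distance:
`cosh d((z,t),(w,s)) = 1 + (|z - w|² + (t - s)²) / (2 t s)`. -/
def hdist (p q : HypSpace) : ℝ :=
  Real.arcosh (1 + (‖p.1.1 - q.1.1‖ ^ 2 + (p.1.2 - q.1.2) ^ 2) / (2 * p.1.2 * q.1.2))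

/-- The full isometry group of hyperbolic 3-space (orientation-reversing isometries included). -/
def isom : Subgroup (Equiv.Perm HypSpace) where
  carrier := {φ | ∀ p q, hdist (φ p) (φ q) = hdist p q}
  mul_mem' hφ hψ p q := (hφ _ _).trans (hψ p q)
  one_mem' _ _ := rfl
  inv_mem' {φ} hφ p q := by
    have h := hφ (φ.symm p) (φ.symm q)
    rw [φ.apply_symm_apply, φ.apply_symm_apply] at h
    exact h.symm

/-- The hyperbolic volume `dx dy dt / t³`. -/
def hypVolume : Measure HypSpace :=
  (Measure.comap Subtype.val (volume : Measure (ℂ × ℝ))).withDensity fun p : HypSpace =>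
    ENNReal.ofReal (1 / p.1.2 ^ 3)

/-! ### Ideal points, cusps, hyperbolic manifolds -/

/-- The trace on hyperbolic space of the neighbourhoods of an ideal point `ξ ∈ ℂ ∪ {∞}` in the
compactification of `ℂ × ℝ` by one point `∞`. -/
def idealNhds (ξ : OnePoint ℂ) : Filter HypSpace :=
  comap (fun p : HypSpace => ((p.1 : ℂ × ℝ) : OnePoint (ℂ × ℝ)))
    (𝓝 (OnePoint.map (fun z : ℂ => (z, (0 : ℝ))) ξ))

/-- The continuous extension of `γ` to the sphere at infinity takes `ξ` to `η`. -/
def MapsIdeal (γ : Equiv.Perm HypSpace) (ξ η : OnePoint ℂ) : Prop :=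
  Tendsto γ (idealNhds ξ) (idealNhds η)

/-- A parabolic isometry: it has no fixed point in hyperbolic space and exactly one fixed point at
infinity. -/
def IsParabolic (γ : Equiv.Perm HypSpace) : Prop :=
  γ ∈ isom ∧ (∀ p, γ p ≠ p) ∧ ∃! ξ, MapsIdeal γ ξ ξ

/-- The parabolic fixed points of `Γ`. -/
def parabolicPoints (Γ : Subgroup (Equiv.Perm HypSpace)) : Set (OnePoint ℂ) :=
  {ξ | ∃ γ ∈ Γ, IsParabolic γ ∧ MapsIdeal γ ξ ξ}

/-- The quotient by `Γ` has exactly one cusp: the parabolic fixed points of `Γ` form one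
`Γ`-orbit. -/
def IsOneCusped (Γ : Subgroup (Equiv.Perm HypSpace)) : Prop :=
  (parabolicPoints Γ).Nonempty ∧
    ∀ ξ ∈ parabolicPoints Γ, ∀ η ∈ parabolicPoints Γ, ∃ γ ∈ Γ, MapsIdeal γ ξ η

/-- `Γ` is a group of isometries, acting properly discontinuously and freely, with a quotient of
finite volume: the quotient is a connected complete hyperbolic 3-manifold of finite volume, and
each such manifold arises in this way. -/
structure IsFiniteVolumeManifoldGroup (Γ : Subgroup (Equiv.Perm HypSpace)) : Prop where
  le_isom : Γ ≤ isom
  properlyDiscontinuous : ProperlyDiscontinuousSMul Γ HypSpace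
  free : ∀ γ ∈ Γ, ∀ p, γ p = p → γ = 1
  finite_volume : ∃ F : Set HypSpace, IsFundamentalDomain Γ F hypVolume ∧ hypVolume F < ⊤

/-! ### Regular ideal polyhedra and tilings of hyperbolic space -/

/-- The sixth root of unity `(1 + i√3) / 2`. -/
def omega : ℂ := ⟨1 / 2, Real.sqrt 3 / 2⟩

/-- The regular ideal tetrahedron with ideal vertices `0, 1, omega, ∞`: it lies over the triangle
`0, 1, omega`, on or above the hemisphere through these three points. -/
def stdTetrahedron : Set HypSpace :=
  {p | p.1.1 ∈ convexHull ℝ {0, 1, omega} ∧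
    1 / 3 ≤ ‖p.1.1 - (1 + omega) / 3‖ ^ 2 + p.1.2 ^ 2}

/-- The regular ideal octahedron with ideal vertices `0, 1, 1 + i, i, (1 + i) / 2, ∞`: it lies over
the square `0, 1, 1 + i, i`, on or above the four hemispheres that pass through the centre
`(1 + i) / 2` and the two endpoints of a side, and are centred at the midpoint of that side. -/
def stdOctahedron : Set HypSpace :=
  {p | p.1.1 ∈ convexHull ℝ {0, 1, 1 + Complex.I, Complex.I} ∧
    ∀ m ∈ ({1 / 2, 1 + Complex.I / 2, 1 / 2 + Complex.I, Complex.I / 2} : Set ℂ),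
      1 / 4 ≤ ‖p.1.1 - m‖ ^ 2 + p.1.2 ^ 2}

/-- A regular ideal tetrahedron is an isometric image of the standard one. -/
def IsTetrahedron (P : Set HypSpace) : Prop :=
  ∃ φ ∈ isom, P = φ '' stdTetrahedron

/-- A regular ideal octahedron is an isometric image of the standard one. -/
def IsOctahedron (P : Set HypSpace) : Prop :=
  ∃ φ ∈ isom, P = φ '' stdOctahedron

/-- `F` is a proper (possibly empty) face of the convex set `C`: the intersection of `C` with the
boundary plane of a closed half-space that contains `C`. A closed half-space is the set of the points
that are at least as close to a point `u` as to another point `v`. -/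
def IsFace (C F : Set HypSpace) : Prop :=
  ∃ u v : HypSpace, u ≠ v ∧ (∀ p ∈ C, hdist p u ≤ hdist p v) ∧
    F = {p ∈ C | hdist p u = hdist p v}

/-- A tiling of hyperbolic space by regular ideal tetrahedra and/or octahedra: a locally finite,
face-to-face cover. -/
structure IsTiling (𝒟 : Set (Set HypSpace)) : Prop where
  tiles : ∀ P ∈ 𝒟, IsTetrahedron P ∨ IsOctahedron P
  covers : ⋃₀ 𝒟 = univ
  locallyFinite : LocallyFinite (fun P : 𝒟 => (P : Set HypSpace))
  faceToFace : ∀ P ∈ 𝒟, ∀ Q ∈ 𝒟, P ≠ Q → IsFace P (P ∩ Q) ∧ IsFace Q (P ∩ Q)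

/-- The set of the `Γ`-orbits of the members of `S`. -/
def tileOrbits (Γ : Subgroup (Equiv.Perm HypSpace)) (S : Set (Set HypSpace)) :
    Set (Set (Set HypSpace)) :=
  (fun P => {Q | ∃ γ ∈ Γ, Q = γ '' P}) '' S

/-- A `Γ`-invariant tiling with `n₁` orbits of regular ideal tetrahedra and `n₂` orbits of regular
ideal octahedra, for some natural numbers `n₁, n₂ ≥ 1`. -/
structure IsMixedPlatonicTiling (Γ : Subgroup (Equiv.Perm HypSpace))
    (𝒟 : Set (Set HypSpace)) : Prop where
  isTiling : IsTiling 𝒟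
  invariant : ∀ γ ∈ Γ, ∀ P ∈ 𝒟, γ '' P ∈ 𝒟
  finite_tetrahedra : (tileOrbits Γ {P ∈ 𝒟 | IsTetrahedron P}).Finite
  exists_tetrahedron : (tileOrbits Γ {P ∈ 𝒟 | IsTetrahedron P}).Nonempty
  finite_octahedra : (tileOrbits Γ {P ∈ 𝒟 | IsOctahedron P}).Finite
  exists_octahedron : (tileOrbits Γ {P ∈ 𝒟 | IsOctahedron P}).Nonempty

/-- The quotient by `Γ` is a mixed-platonic manifold. -/
def IsMixedPlatonicManifold (Γ : Subgroup (Equiv.Perm HypSpace)) : Prop :=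
  IsFiniteVolumeManifoldGroup Γ ∧ ∃ 𝒟, IsMixedPlatonicTiling Γ 𝒟

/-! ### Peripheral tilings -/

/-- A tiling of hyperbolic space is in standard position if the standard tetrahedron or the standard
octahedron is one of its tiles. -/
def InStandardPosition (𝒟 : Set (Set HypSpace)) : Prop :=
  stdTetrahedron ∈ 𝒟 ∨ stdOctahedron ∈ 𝒟

/-- The horosphere `∂B_∞ = {(z, 1) | z ∈ ℂ}`, the boundary of the horoball
`B_∞ = {(z, t) | t ≥ 1}` centred at `∞`, parametrized by `ℂ`. -/
def horosphere (z : ℂ) : HypSpace := ⟨(z, 1), one_pos⟩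

/-- The tiling that `𝒟` induces on the horosphere `∂B_∞`, transported to `ℂ`: its tiles are the
non-empty intersections of the tiles of `𝒟` with `∂B_∞`. -/
def horosphericalSection (𝒟 : Set (Set HypSpace)) : Set (Set ℂ) :=
  {X | X.Nonempty ∧ ∃ P ∈ 𝒟, X = horosphere ⁻¹' P}

/-- `𝒯` is a peripheral tiling of the quotient by `Γ`: for some conjugate of `Γ` in the isometry
group and some tiling `𝒟` in standard position invariant under it (as in the definition of a
mixed-platonic manifold), `𝒯 = 𝒟 ∩ ∂B_∞`. -/
def IsPeripheralTiling (Γ : Subgroup (Equiv.Perm HypSpace)) (𝒯 : Set (Set ℂ)) : Prop :=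
  ∃ φ ∈ isom, ∃ 𝒟 : Set (Set HypSpace),
    IsMixedPlatonicTiling (Γ.map (MulAut.conj φ).toMonoidHom) 𝒟 ∧
    InStandardPosition 𝒟 ∧ 𝒯 = horosphericalSection 𝒟

/-! ### The ace tiling -/

/-- The translation lattice of the ace tiling, generated by `(2 + √3) i` and `(2 + √3) i omega`. -/
def acePoint (m n : ℤ) : ℂ :=
  ((2 + Real.sqrt 3 : ℝ) : ℂ) * Complex.I * ((m : ℂ) + (n : ℂ) * omega)

/-- Vertex sets of the tiles of the ace tiling near the hexagon centre `0`, in the direction `k`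
(taken modulo `6`): a triangle of the unit hexagon around `0`; the square erected on a side of that
hexagon; the triangle that fits between two consecutive such squares; the triangle adjacent to the
latter along the side opposite to the hexagon's vertex. -/
def aceVertexSets (k : ℕ) : Set (Set ℂ) :=
  { {0, omega ^ k, omega ^ (k + 1)},
    {omega ^ (k + 1), omega ^ (k + 2),
      omega ^ (k + 2) + Complex.I * omega ^ k, omega ^ (k + 1) + Complex.I * omega ^ k},
    {omega ^ (k + 2), omega ^ (k + 2) + Complex.I * omega ^ k,
      omega ^ (k + 2) + Complex.I * omega ^ (k + 1)},
    {omega ^ (k + 2) + Complex.I * omega ^ k, omega ^ (k + 2) + Complex.I * omega ^ (k + 1),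
      omega ^ (k + 2) + Complex.I * omega ^ k + Complex.I * omega ^ (k + 1)} }

/-- The ace tiling, the `3`-uniform tiling `[3⁶; 3³.4²; 3².4.3.4]` of the plane by unit squares and
unit equilateral triangles. -/
def aceTiling : Set (Set ℂ) :=
  {X | ∃ (m n : ℤ) (k : ℕ), ∃ V ∈ aceVertexSets k,
    X = convexHull ℝ ((fun v => acePoint m n + v) '' V)}

end

end MixedPlatonic

namespace MixedPlatonic

noncomputable section

/-! Suppose that the section of `𝒟` at `∞` is congruent to the ace tiling. A geometric and a
combinatorial argument then collide.

Geometry: with one cusp, the link of every ideal vertex of `𝒟` is an ace tiling. When an ideal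
vertex is moved to `∞` and a tile to standard position, the vertical tiles of side one cover the
horosphere (`IsTiling.cover`), so there are infinitely many of them. There are finitely many orbits
of tiles, so by pigeonhole some group element fixes `∞` and moves a vertical tile to another one. It
has no fixed point in hyperbolic space and preserves the common size of the vertical tiles, hence it
is parabolic (`infty_mem_parabolicPoints`). Since the parabolic points form one orbit, any ideal
vertex can be carried to any other one by the group, and this induces a Euclidean isometry of the
links (`section_push_congruent`).

Combinatorics: in a link, vertices stand for edges of `𝒟`, triangles for tetrahedra and squares for
octahedra. Identify the hexagon centre `0` and its neighbours `1`, `ω`, `ω⁵` with ideal vertices of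
`𝒟`. No octahedron contains both `∞` and `0` (`not_spans_origin`). So in the link of `0` the vertex
`∞` lies in no square and must be a hexagon centre. The outer side of each triangle around a hexagon
centre belongs to a square, so some octahedron contains `0, 1, ω` (`IsAceEverywhere.spans`). In the
link of `1`, the triangles `∞ 0 ω` and `∞ 0 ω⁵` share the side `∞ 0`, and the sides `∞ ω` and `∞ ω⁵`
belong to squares. If `0 ω` belonged to a square too, the first triangle would be of the kind with
two sides on squares. Across the third side of such a triangle lies a triangle with no side on a
square, which contradicts the square on `∞ ω⁵`. So no octahedron contains `0, 1, ω`
(`IsAceEverywhere.not_spans`).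

The incidences of the ace tiling are read off an additive invariant `shadow` of its vertices.
Isometries are handled in the hyperboloid model, where they are linear and so extend to the light
cone, that is, to the ideal points. -/

/-! ### The Minkowski model -/

/-- The ambient space of the hyperboloid model. -/
abbrev Mink : Type := ℝ × ℂ × ℝ

/-- The Minkowski form, normalized to be `cosh d` on pairs of points of hyperbolic space. -/
def form (x y : Mink) : ℝ :=
  (x.1 * y.2.2 + x.2.2 * y.1) / 2 - (x.2.1.re * y.2.1.re + x.2.1.im * y.2.1.im)

/-- The embedding of hyperbolic space as a hyperboloid. -/
def emb (p : HypSpace) : Mink :=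
  (1 / p.1.2, ((1 / p.1.2 : ℝ) : ℂ) * p.1.1, (‖p.1.1‖ ^ 2 + p.1.2 ^ 2) / p.1.2)

theorem sq_norm_eq (z : ℂ) : ‖z‖ ^ 2 = z.re ^ 2 + z.im ^ 2 := by
  rw [Complex.sq_norm, Complex.normSq_apply]; ring

theorem form_add_left (x y z : Mink) : form (x + y) z = form x z + form y z := by
  simp [form]; ring

theorem form_smul_left (a : ℝ) (x z : Mink) : form (a • x) z = a * form x z := by
  simp [form]; ring

theorem form_comm (x y : Mink) : form x y = form y x := by
  simp [form]; ring

theorem form_emb (p q : HypSpace) :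
    form (emb p) (emb q) =
      1 + (‖p.1.1 - q.1.1‖ ^ 2 + (p.1.2 - q.1.2) ^ 2) / (2 * p.1.2 * q.1.2) := by
  have hp := p.2
  have hq := q.2
  simp only [form, emb, sq_norm_eq, Complex.sub_re, Complex.sub_im, Complex.re_ofReal_mul,
    Complex.im_ofReal_mul]
  field_simp
  ring

theorem one_le_form (p q : HypSpace) : 1 ≤ form (emb p) (emb q) := by
  have hp := p.2
  have hq := q.2
  rw [form_emb]
  have : 0 ≤ (‖p.1.1 - q.1.1‖ ^ 2 + (p.1.2 - q.1.2) ^ 2) / (2 * p.1.2 * q.1.2) := by positivity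
  linarith

theorem hdist_eq (p q : HypSpace) : hdist p q = Real.arcosh (form (emb p) (emb q)) := by
  rw [hdist, form_emb]

theorem hdist_eq_iff (p q r s : HypSpace) :
    hdist p q = hdist r s ↔ form (emb p) (emb q) = form (emb r) (emb s) := by
  rw [hdist_eq, hdist_eq]
  exact Real.arcosh_injOn.eq_iff (one_le_form p q) (one_le_form r s)

theorem hdist_le_iff (p q r s : HypSpace) :
    hdist p q ≤ hdist r s ↔ form (emb p) (emb q) ≤ form (emb r) (emb s) := by
  rw [hdist_eq, hdist_eq]
  exact Real.arcosh_le_arcosh (by linarith [one_le_form p q]) (by linarith [one_le_form r s])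

theorem mem_isom_iff (φ : Equiv.Perm HypSpace) :
    φ ∈ isom ↔ ∀ p q, form (emb (φ p)) (emb (φ q)) = form (emb p) (emb q) :=
  forall₂_congr fun _ _ => hdist_eq_iff _ _ _ _

/-- The point `(z, t)` of hyperbolic space. -/
def pt (z : ℂ) (t : ℝ) (ht : 0 < t) : HypSpace := ⟨(z, t), ht⟩

/-- Nondegeneracy of the form: four points of the hyperboloid already span the ambient space, so
pairing with them detects zero. -/
theorem eq_zero_of_form_emb {x : Mink} (h : ∀ p, form x (emb p) = 0) : x = 0 := by
  obtain ⟨a, w, b⟩ := x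
  have h0 := h (pt 0 1 one_pos)
  have h1 := h (pt 0 2 two_pos)
  have h2 := h (pt 1 1 one_pos)
  have h3 := h (pt Complex.I 1 one_pos)
  simp [form, emb, pt] at h0 h1 h2 h3
  have ha : a = 0 := by linarith
  have hb : b = 0 := by linarith
  subst ha hb
  have hw : w = 0 := Complex.ext (by simpa using h2) (by simpa using h3)
  rw [hw]; rfl

theorem exists_linear_coords : ∃ (c : Fin 4 → Mink →ₗ[ℝ] ℝ) (e : Fin 4 → HypSpace),
    ∀ x, x = ∑ i, c i x • emb (e i) := by
  let x0 : Mink →ₗ[ℝ] ℝ := LinearMap.fst ℝ ℝ (ℂ × ℝ)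
  let x2 : Mink →ₗ[ℝ] ℝ := (LinearMap.snd ℝ ℂ ℝ).comp (LinearMap.snd ℝ ℝ (ℂ × ℝ))
  let w : Mink →ₗ[ℝ] ℂ := (LinearMap.fst ℝ ℂ ℝ).comp (LinearMap.snd ℝ ℝ (ℂ × ℝ))
  let r : Mink →ₗ[ℝ] ℝ := Complex.reLm.comp w
  let s : Mink →ₗ[ℝ] ℝ := Complex.imLm.comp w
  -- The four points embed as `(1, 0, 1)`, `(1/2, 0, 2)`, `(1, 1, 2)`, `(1, i, 2)`, so the
  -- difference of the two outer coordinates of a combination is `(3/2) c1 + r + s`.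
  let c1 : Mink →ₗ[ℝ] ℝ := (2 / 3 : ℝ) • (x2 - x0 - r - s)
  refine ⟨![x0 - (1 / 2 : ℝ) • c1 - r - s, c1, r, s],
    ![pt 0 1 one_pos, pt 0 2 two_pos, pt 1 1 one_pos, pt Complex.I 1 one_pos], fun x => ?_⟩
  obtain ⟨a, z, b⟩ := x
  simp only [Fin.sum_univ_four]
  refine Prod.ext ?_ (Prod.ext (Complex.ext ?_ ?_) ?_)
  all_goals
    simp [c1, x0, x2, w, r, s, emb, pt]
    try ring

/-- An isometry of hyperbolic space is linear in the hyperboloid model. -/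
theorem exists_linear {φ : Equiv.Perm HypSpace} (hφ : φ ∈ isom) :
    ∃ Φ : Mink →ₗ[ℝ] Mink, (∀ p, emb (φ p) = Φ (emb p)) ∧
      ∀ x p, form (Φ x) (emb (φ p)) = form x (emb p) := by
  rw [mem_isom_iff] at hφ
  obtain ⟨c, e, hc⟩ := exists_linear_coords
  -- `Φ` is prescribed on a basis of points of the hyperboloid. Since `φ` is onto, nondegeneracy
  -- turns preservation of the form into `Φ ∘ emb = emb ∘ φ`.
  let Φ : Mink →ₗ[ℝ] Mink := ∑ i, (c i).smulRight (emb (φ (e i)))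
  have key : ∀ x p, form (Φ x) (emb (φ p)) = form x (emb p) := by
    intro x p
    conv_rhs => rw [hc x]
    simp [Φ, Fin.sum_univ_four, form_add_left, form_smul_left, hφ]
  refine ⟨Φ, fun p => ?_, key⟩
  rw [← sub_eq_zero]
  refine eq_zero_of_form_emb fun r => ?_
  obtain ⟨q, rfl⟩ := φ.surjective r
  rw [sub_eq_add_neg, form_add_left, ← neg_one_smul ℝ (Φ _), form_smul_left, key, hφ]
  ring

theorem continuous_emb : Continuous emb := by
  have h1 : Continuous fun p : HypSpace => p.1.2 := by fun_prop
  have h2 : Continuous fun p : HypSpace => 1 / p.1.2 :=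
    continuous_const.div h1 fun p => p.2.ne'
  have h3 : Continuous fun p : HypSpace => p.1.1 := by fun_prop
  refine h2.prodMk ((Complex.continuous_ofReal.comp h2 |>.mul h3).prodMk ?_)
  exact ((h3.norm.pow 2).add (h1.pow 2)).div h1 fun p => p.2.ne'

theorem emb_fst_pos (p : HypSpace) : 0 < (emb p).1 := one_div_pos.2 p.2

/-- The topology is the Euclidean one and not by definition that of `hdist`. Continuity comes from
the linear model: `t` and `z` are recovered from the first two coordinates `1 / t` and `z / t` of
`emb`. -/
theorem isometry_continuous {φ : Equiv.Perm HypSpace} (hφ : φ ∈ isom) : Continuous φ := by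
  obtain ⟨Φ, hΦ, -⟩ := exists_linear hφ
  have hc : Continuous fun p => emb (φ p) := by
    simp_rw [hΦ]
    exact (LinearMap.continuous_of_finiteDimensional Φ).comp continuous_emb
  have h0 : Continuous fun p => (emb (φ p)).1 := continuous_fst.comp hc
  have h1 : Continuous fun p => (emb (φ p)).2.1 := (continuous_fst.comp continuous_snd).comp hc
  have ht : (fun p => (φ p).1.2) = fun p => ((emb (φ p)).1)⁻¹ := by
    funext p; simp [emb]
  have hz : (fun p => (φ p).1.1) = fun p => (((emb (φ p)).1)⁻¹ : ℝ) * (emb (φ p)).2.1 := by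
    funext p
    have : ((φ p).1.2 : ℂ) ≠ 0 := Complex.ofReal_ne_zero.2 (φ p).2.ne'
    simp [emb]
    field_simp
  have ht' := h0.inv₀ fun p => (emb_fst_pos (φ p)).ne'
  refine Continuous.subtype_mk (Continuous.prodMk ?_ ?_) _
  · change Continuous fun p => (φ p).1.1
    rw [hz]; exact (Complex.continuous_ofReal.comp ht').mul h1
  · change Continuous fun p => (φ p).1.2
    rw [ht]; exact ht'

/-- An isometry as a homeomorphism. -/
def isometryHomeo {φ : Equiv.Perm HypSpace} (hφ : φ ∈ isom) : HypSpace ≃ₜ HypSpace where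
  toEquiv := φ
  continuous_toFun := isometry_continuous hφ
  continuous_invFun := isometry_continuous (isom.inv_mem hφ)

/-! ### The action on the sphere at infinity -/

/-- A null vector spanning the ray of an ideal point. -/
def nullVec (ξ : OnePoint ℂ) : Mink :=
  ξ.elim (0, 0, 1) fun v => (1, v, ‖v‖ ^ 2)

/-- A linear functional that is positive on the closed positive light cone. -/
def height (x : Mink) : ℝ := x.1 + x.2.2

/-- The embedding of hyperbolic space as a ball. -/
def ballEmb (p : HypSpace) : Mink := (height (emb p))⁻¹ • emb p

theorem nullVec_coe (v : ℂ) : nullVec (v : OnePoint ℂ) = (1, v, ‖v‖ ^ 2) := rfl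

theorem nullVec_infty : nullVec OnePoint.infty = (0, 0, 1) := rfl

theorem height_nullVec_pos (ξ : OnePoint ℂ) : 0 < height (nullVec ξ) := by
  induction ξ using OnePoint.rec with
  | infty => simp [height, nullVec_infty]
  | coe v => simp only [height, nullVec_coe]; positivity

theorem height_emb (p : HypSpace) : height (emb p) = (1 + (‖p.1.1‖ ^ 2 + p.1.2 ^ 2)) / p.1.2 := by
  simp [height, emb]; ring

theorem ballEmb_eq (p : HypSpace) : ballEmb p =
    ((1 + (‖p.1.1‖ ^ 2 + p.1.2 ^ 2))⁻¹, ((1 + (‖p.1.1‖ ^ 2 + p.1.2 ^ 2))⁻¹ : ℝ) * p.1.1,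
      (‖p.1.1‖ ^ 2 + p.1.2 ^ 2) * (1 + (‖p.1.1‖ ^ 2 + p.1.2 ^ 2))⁻¹) := by
  have hp := p.2
  have h : 1 + (‖p.1.1‖ ^ 2 + p.1.2 ^ 2) ≠ 0 := by positivity
  rw [ballEmb, height_emb]
  refine Prod.ext ?_ (Prod.ext ?_ ?_)
  · simp [emb]; field_simp
  · have h' : ((1 + (‖p.1.1‖ ^ 2 + p.1.2 ^ 2) : ℝ) : ℂ) ≠ 0 := Complex.ofReal_ne_zero.2 h
    have h2 : (p.1.2 : ℂ) ≠ 0 := Complex.ofReal_ne_zero.2 hp.ne'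
    simp only [emb, Prod.smul_snd, Prod.smul_fst, Complex.real_smul]
    rw [← mul_assoc, ← Complex.ofReal_mul]
    congr 2
    field_simp
  · simp [emb]; field_simp


theorem idealNhds_coe (v : ℂ) :
    idealNhds (v : OnePoint ℂ) = comap (fun p : HypSpace => p.1) (𝓝 (v, 0)) := by
  rw [idealNhds, OnePoint.map_some, OnePoint.nhds_coe_eq,
    ← comap_map (OnePoint.coe_injective (X := ℂ × ℝ)) (f := 𝓝 (v, 0)), comap_comap]
  simp [comap_map (OnePoint.coe_injective (X := ℂ × ℝ))]
  rfl

/-- The norm on `ℂ × ℝ` is the maximum norm `m`, and `m ^ 2 ≤ |z| ^ 2 + t ^ 2 ≤ 2 * m ^ 2`. -/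
theorem idealNhds_infty :
    idealNhds OnePoint.infty =
      comap (fun p : HypSpace => ‖p.1.1‖ ^ 2 + p.1.2 ^ 2) atTop := by
  have h0 : idealNhds OnePoint.infty = comap (fun p : HypSpace => ‖p.1‖) atTop := by
    have : (fun p : HypSpace => ‖p.1‖) = norm ∘ Subtype.val := rfl
    rw [this, ← comap_comap, comap_norm_atTop, Metric.cobounded_eq_cocompact,
      ← coclosedCompact_eq_cocompact, ← OnePoint.comap_coe_nhds_infty, comap_comap]
    rfl
  rw [h0]
  have hnn : ∀ p : HypSpace, 0 ≤ ‖p.1.1‖ := fun p => norm_nonneg _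
  have hn : ∀ p : HypSpace, ‖p.1‖ = max ‖p.1.1‖ p.1.2 := fun p => by
    rw [Prod.norm_def, Real.norm_of_nonneg p.2.le]
  refine le_antisymm (tendsto_iff_comap.1 ?_) (tendsto_iff_comap.1 ?_)
  · have h1 : Tendsto (fun p : HypSpace => ‖p.1‖ ^ 2) (comap (fun p : HypSpace => ‖p.1‖) atTop)
        atTop := (tendsto_pow_atTop two_ne_zero).comp tendsto_comap
    refine tendsto_atTop_mono (fun p => ?_) h1
    rw [hn]
    rcases max_cases ‖p.1.1‖ p.1.2 with h | h <;> rw [h.1] <;> nlinarith [sq_nonneg p.1.2, hnn p]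
  · have h1 := (Real.tendsto_sqrt_atTop).comp ((tendsto_comap (f := fun p : HypSpace =>
      ‖p.1.1‖ ^ 2 + p.1.2 ^ 2) (x := atTop)).atTop_div_const (two_pos (α := ℝ)))
    refine tendsto_atTop_mono (fun p => ?_) h1
    rw [hn]
    refine Real.sqrt_le_iff.2 ⟨le_max_of_le_left (hnn p), ?_⟩
    rcases max_cases ‖p.1.1‖ p.1.2 with h | h <;> rw [h.1] <;> nlinarith [p.2, hnn p]

/-- In the ball model `∞` and the finite ideal points are on the same footing, and linear maps act
continuously up to the boundary. This is the bridge from `exists_linear` to `MapsIdeal`. -/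
theorem idealNhds_eq_comap (ξ : OnePoint ℂ) :
    idealNhds ξ = comap ballEmb (𝓝 ((height (nullVec ξ))⁻¹ • nullVec ξ)) := by
  induction ξ using OnePoint.rec with
  | infty =>
    rw [idealNhds_infty]
    have e : (height (nullVec OnePoint.infty))⁻¹ • nullVec OnePoint.infty = (0, 0, 1) := by
      simp [nullVec_infty, height]
    rw [e]
    set r : HypSpace → ℝ := fun p => ‖p.1.1‖ ^ 2 + p.1.2 ^ 2 with hr
    have hr0 : ∀ p, 0 ≤ r p := fun p => by positivity
    refine le_antisymm (tendsto_iff_comap.1 ?_) (tendsto_iff_comap.1 ?_)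
    · have h1 : Tendsto (fun p => 1 + r p) (comap r atTop) atTop :=
        tendsto_atTop_add_const_left _ _ tendsto_comap
      have h2 : Tendsto (fun p => (1 + r p)⁻¹) (comap r atTop) (𝓝 0) := tendsto_inv_atTop_zero.comp h1
      have h3 : Tendsto (fun p => r p * (1 + r p)⁻¹) (comap r atTop) (𝓝 1) := by
        have : (fun p => r p * (1 + r p)⁻¹) = fun p => 1 - (1 + r p)⁻¹ := by
          funext p
          have := hr0 p
          field_simp
          ring
        rw [this]
        simpa using h2.const_sub 1
      have h4 : Tendsto (fun p : HypSpace => (((1 + r p)⁻¹ : ℝ) : ℂ) * p.1.1) (comap r atTop)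
          (𝓝 0) := by
        -- The middle coordinate has modulus at most `√(1 / (1 + r))`, because `|z| ^ 2 ≤ 1 + r`.
        have hs : Tendsto (fun p => √((1 + r p)⁻¹)) (comap r atTop) (𝓝 0) := by
          have := (Real.continuous_sqrt.tendsto 0).comp h2
          rwa [Real.sqrt_zero] at this
        refine squeeze_zero_norm (fun p => Real.le_sqrt_of_sq_le ?_) hs
        have h := hr0 p
        rw [norm_mul, Complex.norm_real, Real.norm_of_nonneg (by positivity), mul_pow]
        have h5 : ‖p.1.1‖ ^ 2 ≤ 1 + r p := by
          simp only [hr]; nlinarith [sq_nonneg p.1.2]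
        calc (1 + r p)⁻¹ ^ 2 * ‖p.1.1‖ ^ 2 ≤ (1 + r p)⁻¹ ^ 2 * (1 + r p) := by gcongr
          _ = (1 + r p)⁻¹ := by field_simp
      have h5 := h2.prodMk_nhds (h4.prodMk_nhds h3)
      refine h5.congr fun p => (ballEmb_eq p).symm
    · have h1 : Tendsto (fun p => (ballEmb p).1) (comap ballEmb (𝓝 (0, 0, 1))) (𝓝[>] 0) := by
        refine tendsto_nhdsWithin_iff.2 ⟨?_, .of_forall fun p => ?_⟩
        · exact (continuous_fst.tendsto _).comp tendsto_comap
        · rw [ballEmb_eq]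
          have := hr0 p
          simp only [mem_Ioi]
          positivity
      have h2 := tendsto_inv_nhdsGT_zero.comp h1
      have h3 := tendsto_atTop_add_const_right _ (-1) h2
      refine h3.congr fun p => ?_
      simp [ballEmb_eq, hr]
  | coe v =>
    rw [idealNhds_coe]
    refine le_antisymm (tendsto_iff_comap.1 ?_) (tendsto_iff_comap.1 ?_)
    · let G : ℂ × ℝ → Mink := fun x => ((1 + (‖x.1‖ ^ 2 + x.2 ^ 2))⁻¹,
        ((1 + (‖x.1‖ ^ 2 + x.2 ^ 2))⁻¹ : ℝ) * x.1,
        (‖x.1‖ ^ 2 + x.2 ^ 2) * (1 + (‖x.1‖ ^ 2 + x.2 ^ 2))⁻¹)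
      have hG : Continuous G := by
        have h1 : Continuous fun x : ℂ × ℝ => ‖x.1‖ ^ 2 + x.2 ^ 2 := by fun_prop
        have h2 : Continuous fun x : ℂ × ℝ => (1 + (‖x.1‖ ^ 2 + x.2 ^ 2))⁻¹ :=
          (continuous_const.add h1).inv₀ fun x =>
            ne_of_gt (by positivity : 0 < 1 + (‖x.1‖ ^ 2 + x.2 ^ 2))
        exact h2.prodMk (((Complex.continuous_ofReal.comp h2).mul continuous_fst).prodMk
          (h1.mul h2))
      have e : (height (nullVec (v : OnePoint ℂ)))⁻¹ • nullVec (v : OnePoint ℂ) = G (v, 0) := by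
        simp [nullVec_coe, height, G, mul_comm]
      rw [e]
      refine ((hG.tendsto _).comp tendsto_comap).congr fun p => (ballEmb_eq p).symm
    -- The inverse chart: a vector `(a, w, b)` on the ray of `emb (z, t)` gives `z = w / a` and `t ^
    -- 2 = b / a - |z| ^ 2`.
    · let H : Mink → ℂ × ℝ := fun k => ((k.1⁻¹ : ℝ) * k.2.1, √(k.2.2 * k.1⁻¹ - (‖k.2.1‖ * k.1⁻¹) ^ 2))
      set n := (height (nullVec (v : OnePoint ℂ)))⁻¹ • nullVec (v : OnePoint ℂ) with hn
      have hpos : 0 < 1 + ‖v‖ ^ 2 := by positivity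
      have e1 : n = ((1 + ‖v‖ ^ 2)⁻¹, ((1 + ‖v‖ ^ 2)⁻¹ : ℝ) * v, ‖v‖ ^ 2 * (1 + ‖v‖ ^ 2)⁻¹) := by
        simp [hn, nullVec_coe, height, mul_comm]
      have hn0 : n.1 ≠ 0 := by rw [e1]; positivity
      have hH : ContinuousAt H n := by
        have h1 : ContinuousAt (fun k : Mink => k.1⁻¹) n := continuousAt_fst.inv₀ hn0
        have h2 : ContinuousAt (fun k : Mink => k.2.1) n := by fun_prop
        have h3 : ContinuousAt (fun k : Mink => k.2.2) n := by fun_prop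
        exact ((Complex.continuous_ofReal.continuousAt.comp h1).mul h2).prodMk
          (Real.continuous_sqrt.continuousAt.comp ((h3.mul h1).sub ((h2.norm.mul h1).pow 2)))
      have hval : ∀ (z : ℂ) (t : ℝ), 0 ≤ t → H ((1 + (‖z‖ ^ 2 + t ^ 2))⁻¹,
          ((1 + (‖z‖ ^ 2 + t ^ 2))⁻¹ : ℝ) * z,
          (‖z‖ ^ 2 + t ^ 2) * (1 + (‖z‖ ^ 2 + t ^ 2))⁻¹) = (z, t) := by
        intro z t ht
        have h : 0 < 1 + (‖z‖ ^ 2 + t ^ 2) := by positivity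
        have h' : ((1 + (‖z‖ ^ 2 + t ^ 2) : ℝ) : ℂ) ≠ 0 := Complex.ofReal_ne_zero.2 h.ne'
        refine Prod.ext ?_ ?_
        · simp only [H, inv_inv]
          rw [← mul_assoc, ← Complex.ofReal_mul, mul_inv_cancel₀ h.ne']
          simp
        · simp only [H, inv_inv]
          rw [norm_mul, Complex.norm_real, Real.norm_of_nonneg (by positivity)]
          rw [show (‖z‖ ^ 2 + t ^ 2) * (1 + (‖z‖ ^ 2 + t ^ 2))⁻¹ * (1 + (‖z‖ ^ 2 + t ^ 2)) -
            ((1 + (‖z‖ ^ 2 + t ^ 2))⁻¹ * ‖z‖ * (1 + (‖z‖ ^ 2 + t ^ 2))) ^ 2 = t ^ 2 by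
              field_simp; ring]
          exact Real.sqrt_sq ht
      have e2 : H n = (v, 0) := by
        have := hval v 0 le_rfl
        simp only [ne_eq, OfNat.ofNat_ne_zero, not_false_eq_true, zero_pow, add_zero] at this
        rw [e1]; exact this
      rw [← e2]
      refine (hH.tendsto.comp tendsto_comap).congr fun p => ?_
      rw [Function.comp_apply, ballEmb_eq]
      exact hval _ _ p.2.le

theorem form_nullVec_pos (ξ : OnePoint ℂ) (p : HypSpace) : 0 < form (nullVec ξ) (emb p) := by
  have hp := p.2
  induction ξ using OnePoint.rec with
  | infty => simpa [form, nullVec_infty, emb] using hp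
  | coe v =>
    have : form (nullVec v) (emb p) =
        ((v.re - p.1.1.re) ^ 2 + (v.im - p.1.1.im) ^ 2 + p.1.2 ^ 2) / (2 * p.1.2) := by
      simp only [form, emb, nullVec_coe, sq_norm_eq, Complex.re_ofReal_mul, Complex.im_ofReal_mul]
      field_simp
      ring
    rw [this]
    positivity

theorem form_nullVec_self (ξ : OnePoint ℂ) : form (nullVec ξ) (nullVec ξ) = 0 := by
  induction ξ using OnePoint.rec with
  | infty => simp [form, nullVec_infty]
  | coe v => simp only [form, nullVec_coe, sq_norm_eq]; ring

theorem exists_nullVec {x : Mink} (h1 : 0 ≤ x.1) (h2 : 0 ≤ x.2.2) (h : form x x = 0) (h0 : x ≠ 0) :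
    ∃ (η : OnePoint ℂ) (c : ℝ), 0 < c ∧ x = c • nullVec η := by
  obtain ⟨a, w, b⟩ := x
  have hw : a * b = ‖w‖ ^ 2 := by
    simp only [form] at h
    rw [sq_norm_eq]
    linarith
  simp only at h1 h2
  rcases h1.eq_or_lt with rfl | ha
  · have hw0 : w = 0 := by simpa using hw.symm
    subst hw0
    have hb : b ≠ 0 := by rintro rfl; exact h0 rfl
    exact ⟨OnePoint.infty, b, h2.lt_of_ne' hb, by simp [nullVec_infty]⟩
  · refine ⟨((a⁻¹ : ℝ) * w : ℂ), a, ha, ?_⟩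
    have hac : (a : ℂ) ≠ 0 := Complex.ofReal_ne_zero.2 ha.ne'
    rw [nullVec_coe]
    refine Prod.ext (by simp) (Prod.ext ?_ ?_)
    · simp [hac]
    · simp only [norm_mul, Complex.norm_real, norm_inv, Real.norm_of_nonneg ha.le, mul_pow, ← hw,
        Prod.smul_snd, smul_eq_mul]
      field_simp

theorem smul_nullVec_injective {ξ η : OnePoint ℂ} {a b : ℝ} (ha : a ≠ 0) (hb : b ≠ 0)
    (h : a • nullVec ξ = b • nullVec η) : ξ = η := by
  induction ξ using OnePoint.rec <;> induction η using OnePoint.rec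
  · rfl
  · simp [nullVec_infty, nullVec_coe, Ne.symm hb] at h
  · simp [nullVec_infty, nullVec_coe, ha] at h
  · rename_i v w
    simp only [nullVec_coe, Prod.smul_mk, Prod.mk.injEq, smul_eq_mul, mul_one] at h
    obtain ⟨rfl, h, -⟩ := h
    have := smul_right_injective ℂ ha h
    rw [this]

/-- A sequence of points converging to an ideal point. -/
def approach (ξ : OnePoint ℂ) (n : ℕ) : HypSpace :=
  ξ.elim (pt 0 (n + 1) (by positivity)) fun v => pt v (1 / ((n : ℝ) + 1)) (by positivity)

theorem tendsto_idealNhds_coe_iff {α : Type*} {f : α → HypSpace} {l : Filter α} {v : ℂ} :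
    Tendsto f l (idealNhds (v : OnePoint ℂ)) ↔
      Tendsto (fun a => (f a).1.1) l (𝓝 v) ∧ Tendsto (fun a => (f a).1.2) l (𝓝 0) := by
  rw [idealNhds_coe, tendsto_comap_iff]
  exact Prod.tendsto_iff _ _

theorem tendsto_idealNhds_infty_of_height {α : Type*} {f : α → HypSpace} {l : Filter α}
    (h : Tendsto (fun a => (f a).1.2) l atTop) : Tendsto f l (idealNhds OnePoint.infty) := by
  rw [idealNhds_infty, tendsto_comap_iff]
  refine tendsto_atTop_mono (fun a => ?_) ((tendsto_pow_atTop two_ne_zero).comp h)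
  simp only [Function.comp_apply]
  nlinarith [sq_nonneg ‖(f a).1.1‖]

theorem tendsto_vertical (z : ℂ) :
    Tendsto (fun n : ℕ => pt z (1 / ((n : ℝ) + 1)) (by positivity)) atTop
      (idealNhds (z : OnePoint ℂ)) :=
  tendsto_idealNhds_coe_iff.2 ⟨tendsto_const_nhds, tendsto_one_div_add_atTop_nhds_zero_nat⟩

theorem tendsto_upward (z : ℂ) (c : ℝ) (hc : 0 < c) :
    Tendsto (fun n : ℕ => pt z (n + c) (by positivity)) atTop
      (idealNhds OnePoint.infty) :=
  tendsto_idealNhds_infty_of_height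
    (tendsto_atTop_add_const_right _ _ tendsto_natCast_atTop_atTop)

theorem tendsto_approach (ξ : OnePoint ℂ) : Tendsto (approach ξ) atTop (idealNhds ξ) := by
  induction ξ using OnePoint.rec with
  | infty => exact tendsto_upward 0 1 one_pos
  | coe v => exact tendsto_vertical v

instance (ξ : OnePoint ℂ) : (idealNhds ξ).NeBot := (tendsto_approach ξ).neBot

theorem tendsto_ballEmb (ξ : OnePoint ℂ) :
    Tendsto ballEmb (idealNhds ξ) (𝓝 ((height (nullVec ξ))⁻¹ • nullVec ξ)) := by
  rw [idealNhds_eq_comap]; exact tendsto_comap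

theorem idealNhds_unique {α : Type*} {f : α → HypSpace} {l : Filter α} [l.NeBot]
    {ξ η : OnePoint ℂ} (h1 : Tendsto f l (idealNhds ξ)) (h2 : Tendsto f l (idealNhds η)) :
    ξ = η := by
  have := tendsto_nhds_unique ((tendsto_ballEmb ξ).comp h1) ((tendsto_ballEmb η).comp h2)
  exact smul_nullVec_injective (inv_ne_zero (height_nullVec_pos ξ).ne')
    (inv_ne_zero (height_nullVec_pos η).ne') this

theorem MapsIdeal.unique {φ : Equiv.Perm HypSpace} {ξ η η' : OnePoint ℂ}
    (h : MapsIdeal φ ξ η) (h' : MapsIdeal φ ξ η') : η = η' :=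
  idealNhds_unique h h'

theorem MapsIdeal.comp {φ ψ : Equiv.Perm HypSpace} {ξ η ζ : OnePoint ℂ}
    (h : MapsIdeal φ η ζ) (h' : MapsIdeal ψ ξ η) : MapsIdeal (φ * ψ) ξ ζ :=
  show Tendsto (φ ∘ ψ) _ _ from Tendsto.comp h h'

theorem mapsIdeal_one (ξ : OnePoint ℂ) : MapsIdeal 1 ξ ξ := tendsto_id

theorem form_smul_right (a : ℝ) (x y : Mink) : form x (a • y) = a * form x y := by
  rw [form_comm, form_smul_left, form_comm]

theorem continuous_form_left (x : Mink) : Continuous (form x) := by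
  unfold form; fun_prop

theorem height_smul (a : ℝ) (x : Mink) : height (a • x) = a * height x := by
  simp [height]; ring

/-- The linear extension of an isometry determines its action on ideal points. -/
theorem mapsIdeal_of_linear {φ : Equiv.Perm HypSpace} {Φ : Mink →ₗ[ℝ] Mink}
    (hΦ : ∀ p, emb (φ p) = Φ (emb p)) {ξ η : OnePoint ℂ} {c : ℝ} (hc : 0 < c)
    (h : Φ (nullVec ξ) = c • nullVec η) : MapsIdeal φ ξ η := by
  have hcont := LinearMap.continuous_of_finiteDimensional Φ
  have hh : Continuous height := by unfold height; fun_prop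
  set n := (height (nullVec ξ))⁻¹ • nullVec ξ with hn
  have hξ := height_nullVec_pos ξ
  have hη := height_nullVec_pos η
  have hpos : 0 < height (Φ n) := by
    rw [hn, map_smul, h, height_smul, height_smul]; positivity
  have e : (height (Φ n))⁻¹ • Φ n = (height (nullVec η))⁻¹ • nullVec η := by
    rw [hn, map_smul, h, height_smul, height_smul, smul_smul, smul_smul]
    congr 1
    field_simp
  rw [MapsIdeal, idealNhds_eq_comap η, tendsto_comap_iff, ← e]
  have h1 : Tendsto (fun p => Φ (ballEmb p)) (idealNhds ξ) (𝓝 (Φ n)) :=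
    (hcont.tendsto n).comp (tendsto_ballEmb ξ)
  have h2 := (((hh.tendsto _).comp h1).inv₀ hpos.ne').smul h1
  refine h2.congr fun p => ?_
  have hp : 0 < height (emb p) := by
    rw [height_emb]; have := p.2; positivity
  simp only [Function.comp_apply, ballEmb, map_smul, height_smul, ← hΦ, smul_smul]
  congr 1
  field_simp

/-- The image of a null vector is a limit of positive multiples of hyperboloid points, so its outer
coordinates are nonnegative. It is null because preservation of the form passes to the limit along
the approaching sequence, and nonzero because its pairing with hyperboloid points is positive. -/
theorem exists_linear_nullVec {φ : Equiv.Perm HypSpace} {Φ : Mink →ₗ[ℝ] Mink}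
    (hΦ : ∀ p, emb (φ p) = Φ (emb p)) (hf : ∀ x p, form (Φ x) (emb (φ p)) = form x (emb p))
    (ξ : OnePoint ℂ) :
    ∃ (η : OnePoint ℂ) (c : ℝ), 0 < c ∧ Φ (nullVec ξ) = c • nullVec η := by
  have hcont := LinearMap.continuous_of_finiteDimensional Φ
  have hlim : Tendsto (fun n => Φ (ballEmb (approach ξ n))) atTop
      (𝓝 (Φ ((height (nullVec ξ))⁻¹ • nullVec ξ))) :=
    (hcont.tendsto _).comp ((tendsto_ballEmb ξ).comp (tendsto_approach ξ))
  have hscale : ∀ p, ∃ a : ℝ, 0 < a ∧ ballEmb p = a • emb p := fun p => by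
    refine ⟨(height (emb p))⁻¹, ?_, rfl⟩
    rw [height_emb]; have := p.2; positivity
  set n := (height (nullVec ξ))⁻¹ • nullVec ξ with hn
  have hξ := height_nullVec_pos ξ
  have h1 : 0 ≤ (Φ n).1 := by
    refine ge_of_tendsto' ((continuous_fst.tendsto _).comp hlim) fun k => ?_
    obtain ⟨a, ha, e⟩ := hscale (approach ξ k)
    simp only [Function.comp_apply, e, map_smul, ← hΦ, Prod.smul_fst, smul_eq_mul]
    have := emb_fst_pos (φ (approach ξ k))
    positivity
  have h2 : 0 ≤ (Φ n).2.2 := by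
    refine ge_of_tendsto' (((continuous_snd.comp continuous_snd).tendsto _).comp hlim) fun k => ?_
    obtain ⟨a, ha, e⟩ := hscale (approach ξ k)
    simp only [Function.comp_apply, e, map_smul, ← hΦ, Prod.smul_snd, smul_eq_mul]
    have : 0 < (emb (φ (approach ξ k))).2.2 := by
      have := (φ (approach ξ k)).2
      simp only [emb]; positivity
    positivity
  have h3 : form (Φ n) (Φ n) = 0 := by
    have l1 := ((continuous_form_left (Φ n)).tendsto _).comp hlim
    have l2 := ((continuous_form_left n).tendsto _).comp
      ((tendsto_ballEmb ξ).comp (tendsto_approach ξ))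
    have e : form n n = 0 := by
      rw [hn, form_smul_left, form_smul_right, form_nullVec_self]; ring
    rw [← hn, e] at l2
    refine tendsto_nhds_unique l1 (l2.congr fun k => ?_)
    obtain ⟨a, ha, e⟩ := hscale (approach ξ k)
    simp only [Function.comp_apply, e, map_smul, ← hΦ, form_smul_right, hf]
  have h4 : Φ n ≠ 0 := by
    intro h
    have := hf n (approach ξ 0)
    rw [h, hn, form_smul_left] at this
    have hp := form_nullVec_pos ξ (approach ξ 0)
    have h0 : form 0 (emb (φ (approach ξ 0))) = 0 := by simp [form]
    rw [h0] at this
    have : 0 < (height (nullVec ξ))⁻¹ * form (nullVec ξ) (emb (approach ξ 0)) := by positivity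
    linarith
  obtain ⟨η, c, hc, e⟩ := exists_nullVec h1 h2 h3 h4
  refine ⟨η, height (nullVec ξ) * c, by positivity, ?_⟩
  rw [mul_smul, ← e, hn, map_smul, smul_smul, mul_inv_cancel₀ hξ.ne', one_smul]

theorem exists_mapsIdeal {φ : Equiv.Perm HypSpace} (hφ : φ ∈ isom) (ξ : OnePoint ℂ) :
    ∃ η, MapsIdeal φ ξ η := by
  obtain ⟨Φ, hΦ, hf⟩ := exists_linear hφ
  obtain ⟨η, c, hc, h⟩ := exists_linear_nullVec hΦ hf ξ
  exact ⟨η, mapsIdeal_of_linear hΦ hc h⟩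

theorem MapsIdeal.inv {φ : Equiv.Perm HypSpace} (hφ : φ ∈ isom) {ξ η : OnePoint ℂ}
    (h : MapsIdeal φ ξ η) : MapsIdeal φ⁻¹ η ξ := by
  obtain ⟨ζ, hζ⟩ := exists_mapsIdeal (isom.inv_mem hφ) η
  have h1 := hζ.comp h
  rw [inv_mul_cancel] at h1
  rwa [(mapsIdeal_one ξ).unique h1]

theorem MapsIdeal.injective {φ : Equiv.Perm HypSpace} (hφ : φ ∈ isom) {ξ ξ' η : OnePoint ℂ}
    (h : MapsIdeal φ ξ η) (h' : MapsIdeal φ ξ' η) : ξ = ξ' :=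
  (h.inv hφ).unique (h'.inv hφ)

/-! ### Isometries fixing the ideal point at infinity -/

theorem exists_isometryEquiv_form (g : ℂ ≃ᵢ ℂ) : ∃ a b : ℂ, ‖a‖ = 1 ∧
    ((∀ z, g z = a * z + b) ∨ ∀ z, g z = a * (starRingEnd ℂ) z + b) := by
  let g' : ℂ ≃ᵢ ℂ := g.trans (IsometryEquiv.subRight (g 0))
  have h0 : g' 0 = 0 := by simp [g']
  obtain ⟨a, ha⟩ := linear_isometry_complex (IsometryEquiv.toRealLinearIsometryEquivOfMapZero g' h0)
  have hg : ∀ z, g z = IsometryEquiv.toRealLinearIsometryEquivOfMapZero g' h0 z + g 0 := by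
    intro z
    simp [g']
  refine ⟨a, g 0, Circle.norm_coe a, ?_⟩
  rcases ha with ha | ha
  · left; intro z; rw [hg, ha]; simp [rotation_apply]
  · right; intro z; rw [hg, ha]; simp [rotation_apply]

/-- An isometry fixing `∞` is a similarity. -/
theorem isometry_fixing_infty {φ : Equiv.Perm HypSpace} (hφ : φ ∈ isom)
    (h : MapsIdeal φ OnePoint.infty OnePoint.infty) :
    ∃ μ ν : ℂ, μ ≠ 0 ∧ (∀ p, (φ p).1.2 = ‖μ‖ * p.1.2) ∧
      ((∀ p, (φ p).1.1 = μ * p.1.1 + ν) ∨ ∀ p, (φ p).1.1 = μ * (starRingEnd ℂ) p.1.1 + ν) := by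
  obtain ⟨Φ, hΦ, hf⟩ := exists_linear hφ
  obtain ⟨η, c, hc, e⟩ := exists_linear_nullVec hΦ hf OnePoint.infty
  obtain rfl := h.unique (mapsIdeal_of_linear hΦ hc e)
  -- The null vector of `∞` pairs with `emb p` to `1 / (2 t)`, so scaling that vector by `c` scales
  -- all heights by `c`.
  have ht : ∀ p, (φ p).1.2 = c * p.1.2 := by
    intro p
    have := hf (nullVec OnePoint.infty) p
    rw [e, form_smul_left] at this
    simp only [form, nullVec_infty, emb] at this
    have h1 := p.2
    have h2 := (φ p).2
    field_simp at this
    simp at this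
    linarith
  have hz : ∀ p q, ‖(φ p).1.1 - (φ q).1.1‖ = c * ‖p.1.1 - q.1.1‖ := by
    intro p q
    have := (mem_isom_iff φ).1 hφ p q
    have h1 := p.2
    have h2 := q.2
    rw [form_emb, form_emb, ht, ht] at this
    field_simp at this
    have h3 : ‖(φ p).1.1 - (φ q).1.1‖ ^ 2 = (c * ‖p.1.1 - q.1.1‖) ^ 2 := by
      linarith
    exact (sq_eq_sq₀ (norm_nonneg _) (by positivity)).1 h3
  have hcc : (c : ℂ) ≠ 0 := Complex.ofReal_ne_zero.2 hc.ne'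
  -- By `hz` the horizontal part does not depend on the height; divided by `c` it is an isometry of
  -- the plane.
  let f : ℂ → ℂ := fun z => (c : ℂ)⁻¹ * (φ (pt z 1 one_pos)).1.1
  have hfp : ∀ p, (φ p).1.1 = c * f p.1.1 := by
    intro p
    have : ‖(φ p).1.1 - (φ (pt p.1.1 1 one_pos)).1.1‖ = 0 := by
      rw [hz]; simp [pt]
    rw [norm_eq_zero, sub_eq_zero] at this
    simp only [f]
    rw [mul_inv_cancel_left₀ hcc, this]
  have hiso : Isometry f := Isometry.of_dist_eq fun z w => by
    simp only [f]
    rw [Complex.dist_eq, Complex.dist_eq, ← mul_sub, norm_mul, hz, norm_inv, Complex.norm_real,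
      Real.norm_of_nonneg hc.le]
    simp only [pt]
    field_simp
  have hsurj : Function.Surjective f := by
    intro w
    obtain ⟨p, hp⟩ := φ.surjective (pt (c * w) 1 one_pos)
    refine ⟨p.1.1, ?_⟩
    have := hfp p
    rw [hp] at this
    exact (mul_left_cancel₀ hcc this).symm
  obtain ⟨a, b, ha, hab⟩ := exists_isometryEquiv_form (IsometryEquiv.mk (Equiv.ofBijective f ⟨hiso.injective, hsurj⟩) hiso)
  have ha0 : a ≠ 0 := by rintro rfl; simp at ha
  refine ⟨c * a, c * b, mul_ne_zero hcc ha0, fun p => ?_, ?_⟩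
  · rw [ht, norm_mul, ha, Complex.norm_real, Real.norm_of_nonneg hc.le, mul_one]
  · rcases hab with hab | hab
    · left; intro p
      have : f p.1.1 = a * p.1.1 + b := hab _
      rw [hfp, this]; ring
    · right; intro p
      have : f p.1.1 = a * (starRingEnd ℂ) p.1.1 + b := hab _
      rw [hfp, this]; ring

/-! ### Explicit isometries -/

/-- The similarity `(z, t) ↦ (μ z + ν, |μ| t)`. -/
def sim (μ : ℂˣ) (ν : ℂ) : Equiv.Perm HypSpace where
  toFun p := ⟨(μ * p.1.1 + ν, ‖(μ : ℂ)‖ * p.1.2),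
    mul_pos (norm_pos_iff.2 μ.ne_zero) p.2⟩
  invFun p := ⟨((μ : ℂ)⁻¹ * (p.1.1 - ν), ‖(μ : ℂ)‖⁻¹ * p.1.2),
    mul_pos (inv_pos.2 (norm_pos_iff.2 μ.ne_zero)) p.2⟩
  left_inv p := by
    have := μ.ne_zero
    refine Subtype.ext (Prod.ext ?_ ?_) <;> simp
  right_inv p := by
    have := μ.ne_zero
    refine Subtype.ext (Prod.ext ?_ ?_) <;> simp

@[simp] theorem sim_fst (μ : ℂˣ) (ν : ℂ) (p : HypSpace) : (sim μ ν p).1.1 = μ * p.1.1 + ν := rfl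

@[simp] theorem sim_snd (μ : ℂˣ) (ν : ℂ) (p : HypSpace) :
    (sim μ ν p).1.2 = ‖(μ : ℂ)‖ * p.1.2 := rfl

theorem sim_mem_isom (μ : ℂˣ) (ν : ℂ) : sim μ ν ∈ isom := by
  intro p q
  have hp := p.2
  have hq := q.2
  have hμ : 0 < ‖(μ : ℂ)‖ := norm_pos_iff.2 μ.ne_zero
  simp only [hdist, sim_fst, sim_snd]
  congr 2
  have : (μ : ℂ) * p.1.1 + ν - (μ * q.1.1 + ν) = μ * (p.1.1 - q.1.1) := by ring
  rw [this, norm_mul]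
  field_simp

/-- The reflection `(z, t) ↦ (conj z, t)`. -/
def refl : Equiv.Perm HypSpace where
  toFun p := ⟨((starRingEnd ℂ) p.1.1, p.1.2), p.2⟩
  invFun p := ⟨((starRingEnd ℂ) p.1.1, p.1.2), p.2⟩
  left_inv p := by refine Subtype.ext (Prod.ext ?_ ?_) <;> simp
  right_inv p := by refine Subtype.ext (Prod.ext ?_ ?_) <;> simp

@[simp] theorem refl_fst (p : HypSpace) : (refl p).1.1 = (starRingEnd ℂ) p.1.1 := rfl

@[simp] theorem refl_snd (p : HypSpace) : (refl p).1.2 = p.1.2 := rfl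

/-- The squared Euclidean distance to the origin. -/
def radSq (p : HypSpace) : ℝ := ‖p.1.1‖ ^ 2 + p.1.2 ^ 2

theorem radSq_pos (p : HypSpace) : 0 < radSq p := by
  have := p.2
  unfold radSq; positivity

/-- The image of a point under the inversion in the unit sphere. -/
def invFn (p : HypSpace) : HypSpace :=
  ⟨(((radSq p)⁻¹ : ℝ) * p.1.1, (radSq p)⁻¹ * p.1.2), mul_pos (inv_pos.2 (radSq_pos p)) p.2⟩

theorem radSq_invFn (p : HypSpace) : radSq (invFn p) = (radSq p)⁻¹ := by
  have h := radSq_pos p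
  have : radSq (invFn p) = (radSq p)⁻¹ ^ 2 * radSq p := by
    conv_rhs => rw [radSq]
    simp only [radSq, invFn, norm_mul, Complex.norm_real, mul_pow, norm_inv, sq_abs,
      Real.norm_eq_abs, inv_pow]
    ring
  rw [this]
  field_simp

theorem invFn_invFn (p : HypSpace) : invFn (invFn p) = p := by
  have h := radSq_pos p
  refine Subtype.ext (Prod.ext ?_ ?_)
  · change (((radSq (invFn p))⁻¹ : ℝ) : ℂ) * (((radSq p)⁻¹ : ℝ) * p.1.1) = p.1.1
    rw [radSq_invFn, ← mul_assoc, ← Complex.ofReal_mul, inv_inv, mul_inv_cancel₀ h.ne']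
    simp
  · change (radSq (invFn p))⁻¹ * ((radSq p)⁻¹ * p.1.2) = p.1.2
    rw [radSq_invFn, inv_inv, mul_inv_cancel_left₀ h.ne']

/-- The inversion in the unit sphere. -/
def inversion : Equiv.Perm HypSpace := ⟨invFn, invFn, invFn_invFn, invFn_invFn⟩

theorem inversion_fst (p : HypSpace) : (inversion p).1.1 = ((radSq p)⁻¹ : ℝ) * p.1.1 := rfl

theorem inversion_snd (p : HypSpace) : (inversion p).1.2 = (radSq p)⁻¹ * p.1.2 := rfl

theorem radSq_inversion (p : HypSpace) : radSq (inversion p) = (radSq p)⁻¹ := radSq_invFn p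

theorem inversion_mem_isom : inversion ∈ isom := by
  rw [mem_isom_iff]
  -- The inversion exchanges the two null coordinates of the hyperboloid, in which the form is
  -- symmetric.
  have e : ∀ p, emb (inversion p) = ((emb p).2.2, (emb p).2.1, (emb p).1) := by
    intro p
    have h := radSq_pos p
    have hp := p.2
    refine Prod.ext ?_ (Prod.ext ?_ ?_)
    · simp only [emb, inversion_snd]
      change _ = radSq p / _
      field_simp
    · simp only [emb, inversion_snd, inversion_fst]
      rw [← mul_assoc, ← Complex.ofReal_mul]
      congr 2
      field_simp
    · change radSq (inversion p) / _ = _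
      rw [radSq_inversion, inversion_snd]
      simp only [emb]
      field_simp
  intro p q
  rw [e, e]
  simp only [form]
  ring

/-- One approaching path is enough to identify the image of an ideal point: the image exists by
`exists_mapsIdeal`, and limits at infinity are unique. -/
theorem mapsIdeal_of_tendsto {φ : Equiv.Perm HypSpace} (hφ : φ ∈ isom) {ξ η : OnePoint ℂ}
    {α : Type*} {f : α → HypSpace} {l : Filter α} [l.NeBot] (hf : Tendsto f l (idealNhds ξ))
    (h : Tendsto (fun a => φ (f a)) l (idealNhds η)) : MapsIdeal φ ξ η := by
  obtain ⟨ζ, hζ⟩ := exists_mapsIdeal hφ ξ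
  rwa [idealNhds_unique h (Tendsto.comp hζ hf)]

theorem mapsIdeal_of_similar {φ : Equiv.Perm HypSpace} (hφ : φ ∈ isom) {g : ℂ → ℂ} {c : ℝ}
    (h1 : ∀ p, (φ p).1.1 = g p.1.1) (h2 : ∀ p, (φ p).1.2 = c * p.1.2) (v : ℂ) :
    MapsIdeal φ v (g v) := by
  refine mapsIdeal_of_tendsto hφ (tendsto_vertical v) (tendsto_idealNhds_coe_iff.2 ⟨?_, ?_⟩)
  · simp only [h1, pt]; exact tendsto_const_nhds
  · simp only [h2, pt]
    simpa using (tendsto_one_div_add_atTop_nhds_zero_nat (𝕜 := ℝ)).const_mul c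

theorem mapsIdeal_infty_of_similar {φ : Equiv.Perm HypSpace} (hφ : φ ∈ isom) {c : ℝ} (hc : 0 < c)
    (h2 : ∀ p, (φ p).1.2 = c * p.1.2) : MapsIdeal φ OnePoint.infty OnePoint.infty := by
  refine mapsIdeal_of_tendsto hφ (tendsto_upward 0 1 one_pos)
    (tendsto_idealNhds_infty_of_height ?_)
  simp only [h2, pt]
  exact (tendsto_atTop_add_const_right _ _ tendsto_natCast_atTop_atTop).const_mul_atTop hc

theorem mapsIdeal_sim (μ : ℂˣ) (ν v : ℂ) : MapsIdeal (sim μ ν) v ((μ * v + ν : ℂ)) :=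
  mapsIdeal_of_similar (g := fun v => μ * v + ν) (sim_mem_isom μ ν) (fun _ => rfl) (fun _ => rfl) v

theorem mapsIdeal_sim_infty (μ : ℂˣ) (ν : ℂ) :
    MapsIdeal (sim μ ν) OnePoint.infty OnePoint.infty :=
  mapsIdeal_infty_of_similar (sim_mem_isom μ ν) (norm_pos_iff.2 μ.ne_zero) fun _ => rfl

theorem mapsIdeal_inversion_zero : MapsIdeal inversion (0 : ℂ) OnePoint.infty := by
  refine mapsIdeal_of_tendsto inversion_mem_isom (tendsto_vertical 0)
    (tendsto_idealNhds_infty_of_height ?_)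
  refine (tendsto_atTop_add_const_right _ (1 : ℝ) (tendsto_natCast_atTop_atTop (R := ℝ))).congr
    fun n => ?_
  have : (n : ℝ) + 1 ≠ 0 := by positivity
  simp [inversion_snd, radSq, pt]
  field_simp

theorem mapsIdeal_inversion {v : ℂ} (hv : v ≠ 0) :
    MapsIdeal inversion v ((((‖v‖ ^ 2)⁻¹ : ℝ) : ℂ) * v : ℂ) := by
  have hv' : ‖v‖ ^ 2 ≠ 0 := by positivity
  have h0 := tendsto_one_div_add_atTop_nhds_zero_nat (𝕜 := ℝ)
  have h1 : Tendsto (fun n : ℕ => (‖v‖ ^ 2 + (1 / ((n : ℝ) + 1)) ^ 2)⁻¹) atTop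
      (𝓝 (‖v‖ ^ 2)⁻¹) := by
    have := ((h0.pow 2).const_add (‖v‖ ^ 2)).inv₀ (by simpa using hv)
    simpa using this
  refine mapsIdeal_of_tendsto inversion_mem_isom (tendsto_vertical v)
    (tendsto_idealNhds_coe_iff.2 ⟨?_, ?_⟩)
  · exact ((Complex.continuous_ofReal.tendsto _).comp h1).mul_const v
  · have := h1.mul h0
    rw [mul_zero] at this
    exact this

/-! ### The standard polyhedra -/

/-- The standard tetrahedron and the standard octahedron. -/
def std : Bool → Set HypSpace
  | false => stdTetrahedron
  | true => stdOctahedron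

/-- The finite ideal vertices adjacent to `∞` of a standard polyhedron. -/
def corners : Bool → Set ℂ
  | false => {0, 1, omega}
  | true => {0, 1, 1 + Complex.I, Complex.I}

/-- The circumcentre of the base polygon. -/
def centre : Bool → ℂ
  | false => (1 + omega) / 3
  | true => (1 + Complex.I) / 2

/-- The ideal vertices in `ℂ` of a standard polyhedron. -/
def finiteVertices : Bool → Set ℂ
  | false => corners false
  | true => insert (centre true) (corners true)

/-- The base polygon of a standard polyhedron. -/
def base (b : Bool) : Set ℂ := convexHull ℝ (corners b)

theorem sqrt_three_sq : √3 * √3 = (3 : ℝ) := Real.mul_self_sqrt (by norm_num)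

theorem sqrt_three_pos : 0 < √(3 : ℝ) := by positivity

theorem convex_of_le {f : ℂ → ℝ} (hf : ∀ x y : ℂ, ∀ a b : ℝ, a + b = 1 →
    f (a • x + b • y) = a * f x + b * f y) (c : ℝ) : Convex ℝ {z | c ≤ f z} := by
  intro x hx y hy a b ha hb hab
  simp only [mem_ofPred_eq] at *
  rw [hf x y a b hab]
  calc c = a * c + b * c := by rw [← add_mul, hab, one_mul]
    _ ≤ _ := by gcongr

theorem mem_base_false (z : ℂ) :
    z ∈ base false ↔ 0 ≤ z.im ∧ z.im ≤ √3 * z.re ∧ z.im ≤ √3 * (1 - z.re) := by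
  have h3 := sqrt_three_sq
  have hp := sqrt_three_pos
  constructor
  · intro hz
    have hc : Convex ℝ ({z : ℂ | 0 ≤ z.im} ∩ ({z : ℂ | 0 ≤ √3 * z.re - z.im} ∩
        {z : ℂ | 0 ≤ √3 * (1 - z.re) - z.im})) := by
      refine (convex_of_le ?_ 0).inter ((convex_of_le ?_ 0).inter (convex_of_le ?_ 0))
      all_goals
        intro x y a b hab
        obtain rfl : a = 1 - b := by linarith
        simp
        try ring
    have := convexHull_min (s := corners false) ?_ hc hz
    · simp only [mem_inter_iff, mem_ofPred_eq] at this
      exact ⟨this.1, by linarith, by linarith⟩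
    · intro w hw
      simp only [corners, mem_insert_iff, mem_singleton_iff] at hw
      rcases hw with rfl | rfl | rfl
      · simp
      · simp
      · simp only [omega, mem_inter_iff, mem_ofPred_eq]
        refine ⟨by positivity, by linarith, by linarith⟩
  · rintro ⟨h1, h2, h3'⟩
    have hmem : ∀ i, (![0, 1, omega] : Fin 3 → ℂ) i ∈ convexHull ℝ (corners false) := by
      intro i
      apply subset_convexHull
      fin_cases i <;> simp [corners]
    have h := (convex_convexHull ℝ (corners false)).sum_mem (t := Finset.univ)
      (w := ![1 - z.re - √3 * z.im / 3, z.re - √3 * z.im / 3, 2 * √3 * z.im / 3])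
      (z := ![0, 1, omega]) ?_ ?_ fun i _ => hmem i
    · change z ∈ convexHull ℝ (corners false)
      rw [Fin.sum_univ_three] at h
      refine (congrArg (· ∈ convexHull ℝ (corners false)) ?_).mpr h
      apply Complex.ext
      · simp [omega]; ring
      · simp [omega]; linear_combination (-z.im / 3) * h3
    · intro i _
      fin_cases i
      · simp; nlinarith
      · simp; nlinarith
      · simp; positivity
    · simp [Fin.sum_univ_three]; ring

theorem mem_base_true (z : ℂ) :
    z ∈ base true ↔ 0 ≤ z.re ∧ z.re ≤ 1 ∧ 0 ≤ z.im ∧ z.im ≤ 1 := by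
  constructor
  · intro hz
    have hc : Convex ℝ ({z : ℂ | 0 ≤ z.re} ∩ ({z : ℂ | 0 ≤ 1 - z.re} ∩
        ({z : ℂ | 0 ≤ z.im} ∩ {z : ℂ | 0 ≤ 1 - z.im}))) := by
      refine (convex_of_le ?_ 0).inter ((convex_of_le ?_ 0).inter
        ((convex_of_le ?_ 0).inter (convex_of_le ?_ 0)))
      all_goals
        intro x y a b hab
        obtain rfl : a = 1 - b := by linarith
        simp
        try ring
    have := convexHull_min (s := corners true) ?_ hc hz
    · simp only [mem_inter_iff, mem_ofPred_eq] at this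
      exact ⟨this.1, by linarith, by linarith, by linarith⟩
    · intro w hw
      simp only [corners, mem_insert_iff, mem_singleton_iff] at hw
      rcases hw with rfl | rfl | rfl | rfl <;> simp
  · rintro ⟨h1, h2, h3, h4⟩
    have hmem : ∀ i, (![0, 1, 1 + Complex.I, Complex.I] : Fin 4 → ℂ) i ∈
        convexHull ℝ (corners true) := by
      intro i
      apply subset_convexHull
      fin_cases i <;> simp [corners]
    have h := (convex_convexHull ℝ (corners true)).sum_mem (t := Finset.univ)
      (w := ![(1 - z.re) * (1 - z.im), z.re * (1 - z.im), z.re * z.im, (1 - z.re) * z.im])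
      (z := ![0, 1, 1 + Complex.I, Complex.I]) ?_ ?_ fun i _ => hmem i
    · change z ∈ convexHull ℝ (corners true)
      rw [Fin.sum_univ_four] at h
      refine (congrArg (· ∈ convexHull ℝ (corners true)) ?_).mpr h
      apply Complex.ext <;> simp <;> ring
    · have h2' : 0 ≤ 1 - z.re := by linarith
      have h4' : 0 ≤ 1 - z.im := by linarith
      intro i _
      fin_cases i <;> simp <;> positivity
    · simp [Fin.sum_univ_four]; ring

theorem radSq_eq (p : HypSpace) : radSq p = p.1.1.re ^ 2 + p.1.1.im ^ 2 + p.1.2 ^ 2 := by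
  rw [radSq, sq_norm_eq]

theorem mem_std_false (p : HypSpace) : p ∈ std false ↔ p.1.1 ∈ base false ∧
    3 * p.1.1.re + √3 * p.1.1.im ≤ 3 * radSq p := by
  have h3 := sqrt_three_sq
  have e : ‖p.1.1 - (1 + omega) / 3‖ ^ 2 =
      (p.1.1.re - 1 / 2) ^ 2 + (p.1.1.im - √3 / 6) ^ 2 := by
    have : (1 + omega) / 3 = ⟨1 / 2, √3 / 6⟩ := by
      apply Complex.ext <;> simp [omega] <;> ring
    rw [this, sq_norm_eq]; simp
  simp only [std, stdTetrahedron, mem_ofPred_eq, e, radSq_eq]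
  refine and_congr Iff.rfl ?_
  constructor <;> intro h <;> nlinarith

theorem mem_std_true (p : HypSpace) : p ∈ std true ↔ p.1.1 ∈ base true ∧
    p.1.1.re ≤ radSq p ∧ p.1.1.im ≤ radSq p ∧ 2 * p.1.1.re + p.1.1.im ≤ radSq p + 1 ∧
      p.1.1.re + 2 * p.1.1.im ≤ radSq p + 1 := by
  simp only [std, stdOctahedron, mem_ofPred_eq, mem_insert_iff, mem_singleton_iff, forall_eq_or_imp,
    forall_eq, sq_norm_eq, radSq_eq]
  refine and_congr Iff.rfl ?_
  simp
  constructor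
  · rintro ⟨h1, h2, h3, h4⟩
    refine ⟨?_, ?_, ?_, ?_⟩ <;> nlinarith
  · rintro ⟨h1, h2, h3, h4⟩
    refine ⟨?_, ?_, ?_, ?_⟩ <;> nlinarith

theorem std_subset {b : Bool} {p : HypSpace} (hp : p ∈ std b) : p.1.1 ∈ base b := by
  cases b
  · exact ((mem_std_false p).1 hp).1
  · exact ((mem_std_true p).1 hp).1

/-- The hemispheres bounding the two polyhedra from below have radii `1 / √3` and `1 / 2`. Any
threshold from `1 / √3` up would do; one strictly below `1` leaves room for a neighbourhood of the
horosphere at height `1`. -/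
theorem mem_std_of_height {b : Bool} {p : HypSpace} (hp : p.1.1 ∈ base b) (ht : 9 / 10 ≤ p.1.2) :
    p ∈ std b := by
  have h3 := sqrt_three_sq
  have hs := sqrt_three_pos
  cases b
  · rw [mem_std_false, radSq_eq]
    refine ⟨hp, ?_⟩
    rw [mem_base_false] at hp
    nlinarith [sq_nonneg (p.1.1.re - 1 / 2), sq_nonneg (p.1.1.im - √3 / 6)]
  · rw [mem_std_true, radSq_eq]
    refine ⟨hp, ?_⟩
    rw [mem_base_true] at hp
    refine ⟨?_, ?_, ?_, ?_⟩ <;>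
      nlinarith [sq_nonneg (p.1.1.re - 1 / 2), sq_nonneg (p.1.1.im - 1 / 2),
        sq_nonneg (p.1.1.re - 1), sq_nonneg (p.1.1.im - 1)]

/-! ### Symmetries of the standard polyhedra -/

theorem image_eq_of_mem_iff {α : Type*} {φ : Equiv.Perm α} {s : Set α} (h : ∀ p, φ p ∈ s ↔ p ∈ s) :
    φ '' s = s := by
  ext q
  constructor
  · rintro ⟨p, hp, rfl⟩; exact (h p).2 hp
  · intro hq
    exact ⟨φ.symm q, (h _).1 (by simpa using hq), by simp⟩

theorem omega_sq : omega ^ 2 = omega - 1 := by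
  have h3 := sqrt_three_sq
  apply Complex.ext
  · simp [omega, pow_two]; linarith
  · simp [omega, pow_two]; ring

theorem omega_ne_zero : omega ≠ 0 := fun h => by
  have := congrArg Complex.re h
  simp [omega] at this

/-- The unit generating the rotations of the base polygon. -/
def rotUnit : Bool → ℂˣ
  | false => Units.mk0 (omega - 1) (by rw [← omega_sq]; exact pow_ne_zero 2 omega_ne_zero)
  | true => Units.mk0 Complex.I Complex.I_ne_zero

theorem norm_omega : ‖omega‖ = 1 := by
  have h3 := sqrt_three_sq
  have : ‖omega‖ ^ 2 = 1 := by rw [sq_norm_eq]; simp only [omega]; nlinarith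
  exact (sq_eq_sq₀ (norm_nonneg _) zero_le_one).1 (by simpa using this)

theorem norm_rotUnit (b : Bool) : ‖(rotUnit b : ℂ)‖ = 1 := by
  cases b
  · simp only [rotUnit, Units.val_mk0]
    rw [← omega_sq, norm_pow, norm_omega, one_pow]
  · simp [rotUnit]

/-- The rotation of a standard polyhedron about its vertical axis. -/
def rot (b : Bool) : Equiv.Perm HypSpace := sim (rotUnit b) 1

theorem radSq_sim (μ : ℂˣ) (ν : ℂ) (hμ : ‖(μ : ℂ)‖ = 1) (p : HypSpace) :
    radSq (sim μ ν p) = ‖μ * p.1.1 + ν‖ ^ 2 - ‖p.1.1‖ ^ 2 + radSq p := by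
  simp [radSq, hμ]; ring

theorem rot_false_re (z : ℂ) :
    ((rotUnit false : ℂ) * z + 1).re = 1 - z.re / 2 - √3 / 2 * z.im := by
  simp [rotUnit, omega]; ring

theorem rot_false_im (z : ℂ) :
    ((rotUnit false : ℂ) * z + 1).im = √3 / 2 * z.re - z.im / 2 := by
  simp [rotUnit, omega]; ring

theorem rot_true_re (z : ℂ) : ((rotUnit true : ℂ) * z + 1).re = 1 - z.im := by
  simp [rotUnit]; ring

theorem rot_true_im (z : ℂ) : ((rotUnit true : ℂ) * z + 1).im = z.re := by
  simp [rotUnit]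

theorem rot_mem_base (b : Bool) (z : ℂ) : (rotUnit b : ℂ) * z + 1 ∈ base b ↔ z ∈ base b := by
  have h3 := sqrt_three_sq
  have hs := sqrt_three_pos
  cases b
  · rw [mem_base_false, mem_base_false, rot_false_re, rot_false_im]
    have e1 : √3 * (1 - z.re / 2 - √3 / 2 * z.im) = √3 * (1 - z.re / 2) - 3 / 2 * z.im := by
      linear_combination (-z.im / 2) * h3
    have e2 : √3 * (1 - (1 - z.re / 2 - √3 / 2 * z.im)) = √3 * (z.re / 2) + 3 / 2 * z.im := by
      linear_combination (z.im / 2) * h3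
    rw [e1, e2]
    constructor
    · rintro ⟨h1, h2, h4⟩
      exact ⟨by linarith, by linarith, by linarith⟩
    · rintro ⟨h1, h2, h4⟩
      exact ⟨by linarith, by linarith, by linarith⟩
  · rw [mem_base_true, mem_base_true, rot_true_re, rot_true_im]
    constructor
    · rintro ⟨h1, h2, h4, h5⟩
      exact ⟨by linarith, by linarith, by linarith, by linarith⟩
    · rintro ⟨h1, h2, h4, h5⟩
      exact ⟨by linarith, by linarith, by linarith, by linarith⟩

theorem rot_image_std (b : Bool) : rot b '' std b = std b := by
  refine image_eq_of_mem_iff fun p => ?_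
  have h3 := sqrt_three_sq
  have hr := radSq_sim (rotUnit b) 1 (norm_rotUnit b) p
  have hr' : radSq (rot b p) = ‖(rotUnit b : ℂ) * p.1.1 + 1‖ ^ 2 - ‖p.1.1‖ ^ 2 + radSq p := hr
  have e : (rot b p).1.1 = (rotUnit b : ℂ) * p.1.1 + 1 := rfl
  cases b
  · rw [mem_std_false, mem_std_false, e, rot_mem_base, hr', sq_norm_eq, sq_norm_eq, rot_false_re,
      rot_false_im]
    refine and_congr Iff.rfl ?_
    have e1 : 3 * ((1 - p.1.1.re / 2 - √3 / 2 * p.1.1.im) ^ 2 + (√3 / 2 * p.1.1.re - p.1.1.im / 2) ^ 2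
        - (p.1.1.re ^ 2 + p.1.1.im ^ 2) + radSq p) - (3 * (1 - p.1.1.re / 2 - √3 / 2 * p.1.1.im) +
          √3 * (√3 / 2 * p.1.1.re - p.1.1.im / 2)) =
        3 * radSq p - (3 * p.1.1.re + √3 * p.1.1.im) := by
      linear_combination (3 / 4 * p.1.1.im ^ 2 + 3 / 4 * p.1.1.re ^ 2 - p.1.1.re / 2) * h3
    constructor <;> intro h <;> linarith
  · rw [mem_std_true, mem_std_true, e, rot_mem_base, hr', sq_norm_eq, sq_norm_eq, rot_true_re,
      rot_true_im]
    refine and_congr Iff.rfl ?_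
    constructor
    · rintro ⟨h1, h2, h4, h5⟩
      exact ⟨by linarith, by linarith, by linarith, by linarith⟩
    · rintro ⟨h1, h2, h4, h5⟩
      exact ⟨by linarith, by linarith, by linarith, by linarith⟩

/-- The reflection of a standard polyhedron that exchanges the ideal vertices `0` and `1`. -/
def flip : Equiv.Perm HypSpace := sim (-1) 1 * refl

theorem flip_mem_base (b : Bool) (z : ℂ) : 1 - (starRingEnd ℂ) z ∈ base b ↔ z ∈ base b := by
  have hre : (1 - (starRingEnd ℂ) z).re = 1 - z.re := by simp
  have him : (1 - (starRingEnd ℂ) z).im = z.im := by simp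
  cases b
  · rw [mem_base_false, mem_base_false, hre, him]
    constructor <;> rintro ⟨h1, h2, h3⟩ <;> exact ⟨h1, by linarith, by linarith⟩
  · rw [mem_base_true, mem_base_true, hre, him]
    constructor <;> rintro ⟨h1, h2, h3⟩ <;> exact ⟨by linarith, by linarith, h3⟩

theorem flip_image_std (b : Bool) : flip '' std b = std b := by
  refine image_eq_of_mem_iff fun p => ?_
  have hre : (flip p).1.1.re = 1 - p.1.1.re := by
    simp [flip]; ring
  have him : (flip p).1.1.im = p.1.1.im := by simp [flip]
  have ht : (flip p).1.2 = p.1.2 := by simp [flip]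
  have hb : (flip p).1.1 ∈ base b ↔ p.1.1 ∈ base b := by
    have e : (flip p).1.1 = 1 - (starRingEnd ℂ) p.1.1 := by
      simp [flip]; ring
    rw [e, flip_mem_base]
  have hr := radSq_eq (flip p)
  rw [hre, him, ht] at hr
  have hr' := radSq_eq p
  cases b
  · rw [mem_std_false, mem_std_false, hb, hre, him]
    refine and_congr Iff.rfl ?_
    constructor <;> intro h <;> linarith
  · rw [mem_std_true, mem_std_true, hb, hre, him]
    refine and_congr Iff.rfl ?_
    constructor <;> rintro ⟨h1, h2, h4, h5⟩ <;>
      exact ⟨by linarith, by linarith, by linarith, by linarith⟩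

/-- The inversion preserves the walls whose planes end at both `0` and `∞` or are orthogonal to the
unit sphere, and exchanges the others in pairs: the vertical side `1, omega` with the hemisphere of
the tetrahedron, and the sides `Re = 1`, `Im = 1` with the hemispheres centred at `1 / 2` and `i /
2`. -/
theorem inversion_image_std (b : Bool) : inversion '' std b = std b := by
  refine image_eq_of_mem_iff fun p => ?_
  have h3 := sqrt_three_sq
  have hs := sqrt_three_pos
  have hr := radSq_pos p
  have hre : (inversion p).1.1.re = (radSq p)⁻¹ * p.1.1.re := by
    rw [inversion_fst, Complex.re_ofReal_mul]
  have him : (inversion p).1.1.im = (radSq p)⁻¹ * p.1.1.im := by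
    rw [inversion_fst, Complex.im_ofReal_mul]
  have hri := inv_pos.2 hr
  have hm : ∀ {a b : ℝ}, (radSq p)⁻¹ * a ≤ (radSq p)⁻¹ * b ↔ a ≤ b := mul_le_mul_iff_right₀ hri
  have h1 : (1 : ℝ) = (radSq p)⁻¹ * radSq p := by field_simp
  have hsq : ∀ a b : ℝ, a ≤ √3 * b ↔ √3 * a ≤ 3 * b := fun a b => by
    rw [← mul_le_mul_iff_right₀ hs, ← mul_assoc, h3]
  cases b
  · rw [mem_std_false, mem_std_false, mem_base_false, mem_base_false, radSq_inversion, hre, him]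
    have e1 : 0 ≤ (radSq p)⁻¹ * p.1.1.im ↔ 0 ≤ p.1.1.im := by
      exact mul_nonneg_iff_of_pos_left hri
    have e2 : (radSq p)⁻¹ * p.1.1.im ≤ √3 * ((radSq p)⁻¹ * p.1.1.re) ↔
        p.1.1.im ≤ √3 * p.1.1.re := by
      rw [← hm (a := p.1.1.im), mul_left_comm]
    have e3 : (radSq p)⁻¹ * p.1.1.im ≤ √3 * (1 - (radSq p)⁻¹ * p.1.1.re) ↔
        3 * p.1.1.re + √3 * p.1.1.im ≤ 3 * radSq p := by
      rw [show √3 * (1 - (radSq p)⁻¹ * p.1.1.re) = (radSq p)⁻¹ * (√3 * (radSq p - p.1.1.re)) by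
        field_simp, hm, hsq]
      constructor <;> intro h <;> linarith
    have e4 : 3 * ((radSq p)⁻¹ * p.1.1.re) + √3 * ((radSq p)⁻¹ * p.1.1.im) ≤ 3 * (radSq p)⁻¹ ↔
        p.1.1.im ≤ √3 * (1 - p.1.1.re) := by
      rw [show 3 * ((radSq p)⁻¹ * p.1.1.re) + √3 * ((radSq p)⁻¹ * p.1.1.im) =
        (radSq p)⁻¹ * (3 * p.1.1.re + √3 * p.1.1.im) by ring,
        mul_comm 3 (radSq p)⁻¹, hm, hsq]
      constructor <;> intro h <;> linarith
    rw [e1, e2, e3, e4]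
    tauto
  · rw [mem_std_true, mem_std_true, mem_base_true, mem_base_true, radSq_inversion, hre, him]
    have e0 : ∀ a, 0 ≤ (radSq p)⁻¹ * a ↔ 0 ≤ a := fun a =>
      mul_nonneg_iff_of_pos_left hri
    have e1 : ∀ a, (radSq p)⁻¹ * a ≤ 1 ↔ a ≤ radSq p := fun a => by
      rw [h1, hm]
    have e2 : ∀ a, (radSq p)⁻¹ * a ≤ (radSq p)⁻¹ ↔ a ≤ 1 := fun a => by
      rw [← hm (b := 1), mul_one]
    have e3 : 2 * ((radSq p)⁻¹ * p.1.1.re) + (radSq p)⁻¹ * p.1.1.im ≤ (radSq p)⁻¹ + 1 ↔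
        2 * p.1.1.re + p.1.1.im ≤ radSq p + 1 := by
      rw [← hm (a := 2 * p.1.1.re + p.1.1.im), mul_add, mul_add, ← h1, mul_left_comm]
      constructor <;> intro h <;> linarith
    have e4 : (radSq p)⁻¹ * p.1.1.re + 2 * ((radSq p)⁻¹ * p.1.1.im) ≤ (radSq p)⁻¹ + 1 ↔
        p.1.1.re + 2 * p.1.1.im ≤ radSq p + 1 := by
      rw [← hm (a := p.1.1.re + 2 * p.1.1.im), mul_add, mul_add, ← h1, mul_left_comm 2]
      constructor <;> intro h <;> linarith
    rw [e0, e0, e1, e1, e2, e2, e3, e4]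
    tauto

/-! ### Ideal vertices -/

/-- The ideal points in the closure of a set. -/
def idealVertices (P : Set HypSpace) : Set (OnePoint ℂ) :=
  {ξ | (idealNhds ξ ⊓ 𝓟 P).NeBot}

theorem mem_idealVertices_image {φ : Equiv.Perm HypSpace} {ξ η : OnePoint ℂ}
    (h : MapsIdeal φ ξ η) {P : Set HypSpace} (hξ : ξ ∈ idealVertices P) :
    η ∈ idealVertices (φ '' P) := by
  have : (idealNhds ξ ⊓ 𝓟 P).NeBot := hξ
  have h2 : Tendsto φ (idealNhds ξ ⊓ 𝓟 P) (idealNhds η ⊓ 𝓟 (φ '' P)) :=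
    h.inf (tendsto_principal_principal.2 fun p hp => mem_image_of_mem φ hp)
  exact h2.neBot

theorem mem_idealVertices_of_tendsto {P : Set HypSpace} {ξ : OnePoint ℂ} {f : ℕ → HypSpace}
    (hf : Tendsto f atTop (idealNhds ξ)) (h : ∀ n, f n ∈ P) : ξ ∈ idealVertices P :=
  (tendsto_inf.2 ⟨hf, tendsto_principal.2 (.of_forall h)⟩ :
    Tendsto f atTop (idealNhds ξ ⊓ 𝓟 P)).neBot

theorem zero_mem_base (b : Bool) : (0 : ℂ) ∈ base b :=
  subset_convexHull _ _ (by cases b <;> simp [corners])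

theorem infty_mem_idealVertices_std (b : Bool) : OnePoint.infty ∈ idealVertices (std b) := by
  refine mem_idealVertices_of_tendsto (tendsto_upward 0 1 one_pos) fun n => ?_
  refine mem_std_of_height (zero_mem_base b) ?_
  have : (0 : ℝ) ≤ n := n.cast_nonneg
  simp only [pt]
  linarith

theorem finiteVertices_subset_base (b : Bool) : finiteVertices b ⊆ base b := by
  cases b
  · exact subset_convexHull _ _
  · refine insert_subset ?_ (subset_convexHull _ _)
    rw [mem_base_true]
    simp [centre]
    norm_num

theorem mem_idealVertices_std {b : Bool} {v : ℂ} (hv : v ∈ finiteVertices b) :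
    (v : OnePoint ℂ) ∈ idealVertices (std b) := by
  have h3 := sqrt_three_sq
  have hb := finiteVertices_subset_base b hv
  refine mem_idealVertices_of_tendsto (tendsto_vertical v) fun n => ?_
  generalize_proofs ht
  revert ht
  generalize 1 / ((n : ℝ) + 1) = t
  intro ht
  cases b
  · rw [mem_std_false, radSq_eq]
    refine ⟨hb, ?_⟩
    simp only [finiteVertices, corners, mem_insert_iff, mem_singleton_iff] at hv
    rcases hv with rfl | rfl | rfl
    · simp [pt]; positivity
    · simp [pt]; nlinarith
    · simp [pt, omega]; nlinarith
  · rw [mem_std_true, radSq_eq]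
    refine ⟨hb, ?_⟩
    simp only [finiteVertices, corners, centre, mem_insert_iff, mem_singleton_iff] at hv
    rcases hv with rfl | rfl | rfl | rfl | rfl <;> simp [pt] <;>
      constructorm* _ ∧ _ <;> nlinarith

/-- The closed conditions defining the polyhedron persist in the limit `t = 0`: the ideal point lies
in the base polygon and in none of the open discs under the hemispheres. These discs leave only the
vertices uncovered. -/
theorem mem_finiteVertices {b : Bool} {v : ℂ} (hv : (v : OnePoint ℂ) ∈ idealVertices (std b)) :
    v ∈ finiteVertices b := by
  have hne : (idealNhds (v : OnePoint ℂ) ⊓ 𝓟 (std b)).NeBot := hv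
  have hz : Tendsto (fun p : HypSpace => p.1) (idealNhds (v : OnePoint ℂ) ⊓ 𝓟 (std b))
      (𝓝 (v, 0)) := by
    rw [idealNhds_coe]
    exact tendsto_comap.mono_left inf_le_left
  have lim : ∀ f : ℂ × ℝ → ℝ, Continuous f → (∀ p ∈ std b, 0 ≤ f p.1) → 0 ≤ f (v, 0) := by
    intro f hf h
    refine ge_of_tendsto ((hf.tendsto _).comp hz) ?_
    exact mem_inf_of_right (mem_principal.2 fun p hp => h p hp)
  have h3 := sqrt_three_sq
  have hs := sqrt_three_pos
  have hre : Continuous fun x : ℂ × ℝ => x.1.re := Complex.continuous_re.comp continuous_fst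
  have him : Continuous fun x : ℂ × ℝ => x.1.im := Complex.continuous_im.comp continuous_fst
  cases b
  · have i1 := lim (fun x => x.1.im) him fun p hp => by
      rw [mem_std_false, mem_base_false] at hp; exact hp.1.1
    have i2 := lim (fun x => √3 * x.1.re - x.1.im) (by fun_prop) fun p hp => by
      rw [mem_std_false, mem_base_false] at hp; linarith [hp.1.2.1]
    have i3 := lim (fun x => √3 * (1 - x.1.re) - x.1.im) (by fun_prop) fun p hp => by
      rw [mem_std_false, mem_base_false] at hp; linarith [hp.1.2.2]
    have i4 := lim (fun x => 3 * (x.1.re ^ 2 + x.1.im ^ 2 + x.2 ^ 2) -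
        (3 * x.1.re + √3 * x.1.im)) (by fun_prop) fun p hp => by
      rw [mem_std_false, radSq_eq] at hp; linarith [hp.2]
    simp only at i1 i2 i3 i4
    set x := v.re with hx
    set y := v.im with hy
    -- The power of a point with respect to the circumcircle, which is nonnegative by `i4`, is minus
    -- a positive combination of pairwise products of barycentric coordinates. So all these products
    -- vanish, and the point is a vertex.
    have key : 3 * (x ^ 2 + y ^ 2 + 0 ^ 2) - (3 * x + √3 * y) =
        -((√3 * x - y) * (√3 * (1 - x) - y)) - 2 * y * (√3 * x - y) - 2 * y * (√3 * (1 - x) - y) := by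
      linear_combination (-x ^ 2 + x) * h3
    have p1 := mul_nonneg i2 i3
    have p2 := mul_nonneg i1 i2
    have p3 := mul_nonneg i1 i3
    have z1 : (√3 * x - y) * (√3 * (1 - x) - y) = 0 := by linarith
    have z2 : y * (√3 * x - y) = 0 := by linarith
    have z3 : y * (√3 * (1 - x) - y) = 0 := by linarith
    simp only [finiteVertices, corners, mem_insert_iff, mem_singleton_iff]
    rcases mul_eq_zero.1 z1 with h | h
    · rcases mul_eq_zero.1 z3 with h' | h'
      · left
        have : x = 0 := by
          have : √3 * x = 0 := by linarith
          exact (mul_eq_zero.1 this).resolve_left hs.ne'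
        exact Complex.ext this h'
      · right; right
        have : x = 1 / 2 := by
          have : √3 * (2 * x - 1) = 0 := by linarith
          have := (mul_eq_zero.1 this).resolve_left hs.ne'
          linarith
        refine Complex.ext this ?_
        rw [this] at h
        simp only [omega]; linarith
    · rcases mul_eq_zero.1 z2 with h' | h'
      · right; left
        have : x = 1 := by
          have : √3 * (1 - x) = 0 := by linarith
          have := (mul_eq_zero.1 this).resolve_left hs.ne'
          linarith
        exact Complex.ext this h'
      · right; right
        have : x = 1 / 2 := by
          have : √3 * (2 * x - 1) = 0 := by linarith
          have := (mul_eq_zero.1 this).resolve_left hs.ne'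
          linarith
        refine Complex.ext this ?_
        rw [this] at h
        simp only [omega]; linarith
  · have i1 := lim (fun x => x.1.re) hre fun p hp => by
      rw [mem_std_true, mem_base_true] at hp; exact hp.1.1
    have i2 := lim (fun x => 1 - x.1.re) (by fun_prop) fun p hp => by
      rw [mem_std_true, mem_base_true] at hp; linarith [hp.1.2.1]
    have i3 := lim (fun x => x.1.im) him fun p hp => by
      rw [mem_std_true, mem_base_true] at hp; linarith [hp.1.2.2.1]
    have i4 := lim (fun x => 1 - x.1.im) (by fun_prop) fun p hp => by
      rw [mem_std_true, mem_base_true] at hp; linarith [hp.1.2.2.2]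
    have i5 := lim (fun x => (x.1.re ^ 2 + x.1.im ^ 2 + x.2 ^ 2) - x.1.re) (by fun_prop)
      fun p hp => by rw [mem_std_true, radSq_eq] at hp; linarith [hp.2.1]
    have i6 := lim (fun x => (x.1.re ^ 2 + x.1.im ^ 2 + x.2 ^ 2) - x.1.im) (by fun_prop)
      fun p hp => by rw [mem_std_true, radSq_eq] at hp; linarith [hp.2.2.1]
    have i7 := lim (fun x => (x.1.re ^ 2 + x.1.im ^ 2 + x.2 ^ 2) + 1 - (2 * x.1.re + x.1.im))
      (by fun_prop) fun p hp => by rw [mem_std_true, radSq_eq] at hp; linarith [hp.2.2.2.1]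
    have i8 := lim (fun x => (x.1.re ^ 2 + x.1.im ^ 2 + x.2 ^ 2) + 1 - (x.1.re + 2 * x.1.im))
      (by fun_prop) fun p hp => by rw [mem_std_true, radSq_eq] at hp; linarith [hp.2.2.2.2]
    simp only at i1 i2 i3 i4 i5 i6 i7 i8
    obtain ⟨x, y⟩ := v
    simp only at i1 i2 i3 i4 i5 i6 i7 i8
    have hau : |x - 1 / 2| ≤ 1 / 2 := abs_le.2 ⟨by linarith, by linarith⟩
    have hav : |y - 1 / 2| ≤ 1 / 2 := abs_le.2 ⟨by linarith, by linarith⟩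
    have hu2 := sq_abs (x - 1 / 2)
    have hv2 := sq_abs (y - 1 / 2)
    have hu : |x - 1 / 2| ≤ (x - 1 / 2) ^ 2 + (y - 1 / 2) ^ 2 :=
      abs_le.2 ⟨by linarith, by linarith⟩
    have hv : |y - 1 / 2| ≤ (x - 1 / 2) ^ 2 + (y - 1 / 2) ^ 2 :=
      abs_le.2 ⟨by linarith, by linarith⟩
    have hu0 := abs_nonneg (x - 1 / 2)
    have hv0 := abs_nonneg (y - 1 / 2)
    rw [← hu2, ← hv2] at hu hv
    -- The numbers `a, b ≤ 1 / 2` satisfy `a, b ≤ a ^ 2 + b ^ 2`. Adding the last two inequalities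
    -- forces `a (1 / 2 - a) = b (1 / 2 - b) = 0`, and a mixed pair `0, 1 / 2` violates one of them.
    have key : (|x - 1 / 2| = 0 ∧ |y - 1 / 2| = 0) ∨ (|x - 1 / 2| = 1 / 2 ∧ |y - 1 / 2| = 1 / 2) := by
      generalize |x - 1 / 2| = a at *
      generalize |y - 1 / 2| = b at *
      have p1 : 0 ≤ a * (1 / 2 - a) := mul_nonneg hu0 (by linarith)
      have p2 : 0 ≤ b * (1 / 2 - b) := mul_nonneg hv0 (by linarith)
      have z1 : a * (1 / 2 - a) = 0 := by linarith
      have z2 : b * (1 / 2 - b) = 0 := by linarith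
      rcases mul_eq_zero.1 z1 with h | h <;> rcases mul_eq_zero.1 z2 with h' | h'
      · exact Or.inl ⟨h, h'⟩
      · obtain rfl : b = 1 / 2 := by linarith
        subst h
        norm_num at hv
      · obtain rfl : a = 1 / 2 := by linarith
        subst h'
        norm_num at hu
      · exact Or.inr ⟨by linarith, by linarith⟩
    have ex : ∀ {a b c d : ℝ}, a = c → b = d → (⟨a, b⟩ : ℂ) = ⟨c, d⟩ := by
      rintro a b c d rfl rfl; rfl
    simp only [finiteVertices, corners, centre, mem_insert_iff, mem_singleton_iff]
    rcases key with ⟨h, h'⟩ | ⟨h, h'⟩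
    · left
      rw [abs_eq_zero] at h h'
      apply Complex.ext <;> simp <;> linarith
    · right
      rcases (abs_eq (by norm_num)).1 h with h | h <;>
        rcases (abs_eq (by norm_num)).1 h' with h' | h'
      · right; right; left; apply Complex.ext <;> simp <;> linarith
      · right; left; apply Complex.ext <;> simp <;> linarith
      · right; right; right; apply Complex.ext <;> simp <;> linarith
      · left; apply Complex.ext <;> simp <;> linarith

/-- Every ideal vertex of a standard polyhedron is moved to `∞` by one of its symmetries. -/
theorem exists_symmetry {b : Bool} {ξ : OnePoint ℂ} (hξ : ξ ∈ idealVertices (std b)) :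
    ∃ χ ∈ isom, χ '' std b = std b ∧ MapsIdeal χ ξ OnePoint.infty := by
  have step : ∀ {χ : Equiv.Perm HypSpace} {ξ η : OnePoint ℂ}, χ ∈ isom → χ '' std b = std b →
      MapsIdeal χ ξ η → (∃ χ ∈ isom, χ '' std b = std b ∧ MapsIdeal χ η OnePoint.infty) →
      ∃ χ ∈ isom, χ '' std b = std b ∧ MapsIdeal χ ξ OnePoint.infty := by
    rintro χ ξ η h1 h2 h3 ⟨ψ, h4, h5, h6⟩
    refine ⟨ψ * χ, isom.mul_mem h4 h1, ?_, h6.comp h3⟩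
    rw [Equiv.Perm.coe_mul, image_comp, h2, h5]
  induction ξ using OnePoint.rec with
  | infty => exact ⟨1, isom.one_mem, by simp, mapsIdeal_one _⟩
  | coe v =>
    have h0 : ∃ χ ∈ isom, χ '' std b = std b ∧ MapsIdeal χ (0 : ℂ) OnePoint.infty :=
      ⟨inversion, inversion_mem_isom, inversion_image_std b, mapsIdeal_inversion_zero⟩
    have hrot : ∀ {v w : ℂ}, (rotUnit b : ℂ) * v + 1 = w →
        (∃ χ ∈ isom, χ '' std b = std b ∧ MapsIdeal χ w OnePoint.infty) →
        ∃ χ ∈ isom, χ '' std b = std b ∧ MapsIdeal χ v OnePoint.infty := by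
      rintro v w rfl h
      exact step (sim_mem_isom _ _) (rot_image_std b) (mapsIdeal_sim (rotUnit b) 1 v) h
    have hv := mem_finiteVertices hξ
    cases b
    · have hω : ∃ χ ∈ isom, χ '' std false = std false ∧ MapsIdeal χ omega OnePoint.infty := by
        refine hrot ?_ h0
        simp only [rotUnit, Units.val_mk0]
        linear_combination omega_sq
      simp only [finiteVertices, corners, mem_insert_iff, mem_singleton_iff] at hv
      rcases hv with rfl | rfl | rfl
      · exact h0
      · exact hrot (by simp [rotUnit]) hω
      · exact hω
    · have hI : ∃ χ ∈ isom, χ '' std true = std true ∧ MapsIdeal χ Complex.I OnePoint.infty :=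
        hrot (by simp [rotUnit]) h0
      have h1I : ∃ χ ∈ isom, χ '' std true = std true ∧
          MapsIdeal χ (1 + Complex.I : ℂ) OnePoint.infty :=
        hrot (by simp [rotUnit, mul_add]) hI
      simp only [finiteVertices, corners, mem_insert_iff, mem_singleton_iff] at hv
      rcases hv with rfl | rfl | rfl | rfl | rfl
      · have hc : centre true ≠ 0 := fun h => by
          have := congrArg Complex.re h
          simp [centre] at this
        have hn : ‖centre true‖ ^ 2 = 1 / 2 := by
          rw [sq_norm_eq]; simp [centre]; norm_num
        have := mapsIdeal_inversion hc
        rw [hn] at this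
        -- The centre `(1 + i) / 2` has squared modulus `1 / 2`, so the inversion doubles it and
        -- takes it to the corner `1 + i`.
        refine step inversion_mem_isom (inversion_image_std true) this ?_
        convert h1I using 5
        simp [centre]
        ring
      · exact h0
      · exact hrot (by simp [rotUnit, add_comm]) h1I
      · exact h1I
      · exact hI

/-- A polyhedron with an ideal vertex at `∞` is a standard one up to a similarity. -/
theorem eq_sim_image {b : Bool} {φ : Equiv.Perm HypSpace} (hφ : φ ∈ isom)
    (h : OnePoint.infty ∈ idealVertices (φ '' std b)) :
    ∃ μ ν, φ '' std b = sim μ ν '' std b := by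
  obtain ⟨ξ, hξ⟩ := exists_mapsIdeal (isom.inv_mem hφ) OnePoint.infty
  have h1 := mem_idealVertices_image hξ h
  rw [← image_comp, ← Equiv.Perm.coe_mul, inv_mul_cancel, Equiv.Perm.coe_one, image_id] at h1
  obtain ⟨χ, hχ, h2, h3⟩ := exists_symmetry h1
  have h4 : φ '' std b = (φ * χ⁻¹) '' std b := by
    conv_rhs => rw [← h2]
    rw [← image_comp, ← Equiv.Perm.coe_mul, inv_mul_cancel_right]
  have h5 : MapsIdeal (φ * χ⁻¹) OnePoint.infty OnePoint.infty := by
    have := hξ.inv (isom.inv_mem hφ)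
    rw [inv_inv] at this
    exact this.comp (h3.inv hχ)
  obtain ⟨μ, ν, hμ, ht, hz | hz⟩ := isometry_fixing_infty (isom.mul_mem hφ (isom.inv_mem hχ)) h5
  · refine ⟨Units.mk0 μ hμ, ν, ?_⟩
    rw [h4]
    congr 1
    funext p
    exact Subtype.ext (Prod.ext (hz p) (ht p))
  -- An orientation-reversing similarity is composed with the symmetry `flip`, that is `z ↦ 1 - conj
  -- z`, of the standard polyhedron.
  · refine ⟨-Units.mk0 μ hμ, μ + ν, ?_⟩
    rw [h4]
    conv_lhs => rw [← flip_image_std b]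
    rw [← image_comp]
    congr 1
    funext p
    refine Subtype.ext (Prod.ext ?_ ?_)
    · simp only [Function.comp_apply]
      rw [hz]
      simp [flip]
      ring
    · simp only [Function.comp_apply]
      rw [ht]
      simp [flip]

/-! ### Images of tilings -/

theorem exists_std {𝒟 : Set (Set HypSpace)} (h𝒟 : IsTiling 𝒟) {P : Set HypSpace} (hP : P ∈ 𝒟) :
    ∃ b, ∃ φ ∈ isom, P = φ '' std b := by
  rcases h𝒟.tiles P hP with ⟨φ, hφ, h⟩ | ⟨φ, hφ, h⟩
  · exact ⟨false, φ, hφ, h⟩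
  · exact ⟨true, φ, hφ, h⟩

theorem isClosed_base (b : Bool) : IsClosed (base b) := by
  have : (corners b).Finite := by cases b <;> simp [corners]
  exact this.isClosed_convexHull ℝ

theorem isClosed_std (b : Bool) : IsClosed (std b) := by
  have hz : Continuous fun p : HypSpace => p.1.1 := by fun_prop
  have hre : Continuous fun p : HypSpace => p.1.1.re := Complex.continuous_re.comp hz
  have him : Continuous fun p : HypSpace => p.1.1.im := Complex.continuous_im.comp hz
  have hr : Continuous radSq := by unfold radSq; fun_prop
  have hb := (isClosed_base b).preimage hz
  cases b
  · have : std false = (fun p : HypSpace => p.1.1) ⁻¹' base false ∩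
        {p | 3 * p.1.1.re + √3 * p.1.1.im ≤ 3 * radSq p} := by
      ext p; exact mem_std_false p
    rw [this]
    exact hb.inter (isClosed_le (by fun_prop) (by fun_prop))
  · have : std true = (fun p : HypSpace => p.1.1) ⁻¹' base true ∩
        ({p | p.1.1.re ≤ radSq p} ∩ ({p | p.1.1.im ≤ radSq p} ∩
          ({p | 2 * p.1.1.re + p.1.1.im ≤ radSq p + 1} ∩
            {p | p.1.1.re + 2 * p.1.1.im ≤ radSq p + 1}))) := by
      ext p; exact mem_std_true p
    rw [this]
    exact hb.inter ((isClosed_le (by fun_prop) (by fun_prop)).inter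
      ((isClosed_le (by fun_prop) (by fun_prop)).inter
        ((isClosed_le (by fun_prop) (by fun_prop)).inter (isClosed_le (by fun_prop) (by fun_prop)))))

theorem isClosed_tile {𝒟 : Set (Set HypSpace)} (h𝒟 : IsTiling 𝒟) {P : Set HypSpace} (hP : P ∈ 𝒟) :
    IsClosed P := by
  obtain ⟨b, φ, hφ, rfl⟩ := exists_std h𝒟 hP
  exact (isometryHomeo hφ).isClosedMap _ (isClosed_std b)

/-- The image of a tiling under a permutation of hyperbolic space. -/
def push (φ : Equiv.Perm HypSpace) (𝒟 : Set (Set HypSpace)) : Set (Set HypSpace) :=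
  (fun P => φ '' P) '' 𝒟

theorem image_mul (φ ψ : Equiv.Perm HypSpace) (P : Set HypSpace) :
    (φ * ψ) '' P = φ '' (ψ '' P) := by
  rw [Equiv.Perm.coe_mul, image_comp]

theorem image_one (P : Set HypSpace) : (1 : Equiv.Perm HypSpace) '' P = P := by
  rw [Equiv.Perm.coe_one, image_id]

theorem inv_image_image (φ : Equiv.Perm HypSpace) (P : Set HypSpace) : (φ⁻¹ : Equiv.Perm HypSpace) '' (φ '' P) = P := by
  rw [← image_mul, inv_mul_cancel, image_one]

theorem image_inv_image (φ : Equiv.Perm HypSpace) (P : Set HypSpace) : φ '' ((φ⁻¹ : Equiv.Perm HypSpace) '' P) = P := by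
  rw [← image_mul, mul_inv_cancel, image_one]

theorem mem_push {φ : Equiv.Perm HypSpace} {𝒟 : Set (Set HypSpace)} {P : Set HypSpace} :
    P ∈ push φ 𝒟 ↔ (φ⁻¹ : Equiv.Perm HypSpace) '' P ∈ 𝒟 := by
  constructor
  · rintro ⟨Q, hQ, rfl⟩
    simpa only [inv_image_image] using hQ
  · intro h
    exact ⟨_, h, image_inv_image φ P⟩

theorem image_mem_push {φ : Equiv.Perm HypSpace} {𝒟 : Set (Set HypSpace)} {P : Set HypSpace} :
    φ '' P ∈ push φ 𝒟 ↔ P ∈ 𝒟 := by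
  rw [mem_push, inv_image_image]

theorem push_mul (φ ψ : Equiv.Perm HypSpace) (𝒟 : Set (Set HypSpace)) :
    push (φ * ψ) 𝒟 = push φ (push ψ 𝒟) := by
  ext P
  rw [mem_push, mem_push, mem_push, mul_inv_rev, image_mul]

theorem isTetrahedron_image {φ : Equiv.Perm HypSpace} (hφ : φ ∈ isom) {P : Set HypSpace}
    (h : IsTetrahedron P) : IsTetrahedron (φ '' P) := by
  obtain ⟨ψ, hψ, rfl⟩ := h
  exact ⟨φ * ψ, isom.mul_mem hφ hψ, (image_mul φ ψ _).symm⟩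

theorem isOctahedron_image {φ : Equiv.Perm HypSpace} (hφ : φ ∈ isom) {P : Set HypSpace}
    (h : IsOctahedron P) : IsOctahedron (φ '' P) := by
  obtain ⟨ψ, hψ, rfl⟩ := h
  exact ⟨φ * ψ, isom.mul_mem hφ hψ, (image_mul φ ψ _).symm⟩

theorem IsFace.image {φ : Equiv.Perm HypSpace} (hφ : φ ∈ isom) {C F : Set HypSpace}
    (h : IsFace C F) : IsFace (φ '' C) (φ '' F) := by
  obtain ⟨u, v, huv, hle, rfl⟩ := h
  have hd : ∀ p q, hdist (φ p) (φ q) = hdist p q := hφ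
  refine ⟨φ u, φ v, φ.injective.ne huv, ?_, ?_⟩
  · rintro _ ⟨p, hp, rfl⟩
    rw [hd, hd]
    exact hle p hp
  · ext q
    constructor
    · rintro ⟨p, ⟨hp, he⟩, rfl⟩
      refine ⟨mem_image_of_mem φ hp, ?_⟩
      rwa [hd, hd]
    · rintro ⟨⟨p, hp, rfl⟩, he⟩
      rw [hd, hd] at he
      exact ⟨p, ⟨hp, he⟩, rfl⟩

theorem isTiling_push {φ : Equiv.Perm HypSpace} (hφ : φ ∈ isom) {𝒟 : Set (Set HypSpace)}
    (h : IsTiling 𝒟) : IsTiling (push φ 𝒟) where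
  tiles := by
    rintro _ ⟨P, hP, rfl⟩
    exact (h.tiles P hP).imp (isTetrahedron_image hφ) (isOctahedron_image hφ)
  covers := by
    refine eq_univ_of_forall fun p => ?_
    have : φ.symm p ∈ ⋃₀ 𝒟 := by rw [h.covers]; trivial
    obtain ⟨P, hP, hp⟩ := this
    exact ⟨φ '' P, image_mem_push.2 hP, φ.symm p, hp, φ.apply_symm_apply p⟩
  locallyFinite := by
    have h1 := h.locallyFinite.preimage_continuous (isometry_continuous (isom.inv_mem hφ))
    let f : MixedPlatonic.push φ 𝒟 → 𝒟 := fun Q => ⟨(φ⁻¹ : Equiv.Perm HypSpace) '' Q, mem_push.1 Q.2⟩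
    have hf : Function.Injective f := by
      intro Q R hQR
      have : (φ⁻¹ : Equiv.Perm HypSpace) '' (Q : Set HypSpace) = (φ⁻¹ : Equiv.Perm HypSpace) '' (R : Set HypSpace) := congrArg Subtype.val hQR
      exact Subtype.ext ((image_injective.2 φ⁻¹.injective) this)
    refine (h1.comp_injective hf).subset fun Q p hp => ?_
    exact ⟨p, hp, rfl⟩
  faceToFace := by
    rintro _ ⟨P, hP, rfl⟩ _ ⟨Q, hQ, rfl⟩ hne
    have hPQ : P ≠ Q := by rintro rfl; exact hne rfl
    have := h.faceToFace P hP Q hQ hPQ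
    simp only [← image_inter φ.injective]
    exact ⟨this.1.image hφ, this.2.image hφ⟩

/-! ### Faces -/

/-- A face is cut out by a sphere or a plane orthogonal to the boundary. -/
theorem IsFace.exists_quadric {C F : Set HypSpace} (h : IsFace C F) :
    ∃ α β γ δ : ℝ, ¬ (α = 0 ∧ β = 0 ∧ γ = 0) ∧
      (∀ p ∈ C, α * radSq p + β * p.1.1.re + γ * p.1.1.im + δ ≤ 0) ∧
      ∀ p, p ∈ F ↔ p ∈ C ∧ α * radSq p + β * p.1.1.re + γ * p.1.1.im + δ = 0 := by
  obtain ⟨u, v, huv, hle, rfl⟩ := h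
  have hu := u.2
  have hv := v.2
  have key : ∀ p : HypSpace, 2 * p.1.2 * (form (emb p) (emb u) - form (emb p) (emb v)) =
      (1 / u.1.2 - 1 / v.1.2) * radSq p + (-2 * (u.1.1.re / u.1.2 - v.1.1.re / v.1.2)) * p.1.1.re +
        (-2 * (u.1.1.im / u.1.2 - v.1.1.im / v.1.2)) * p.1.1.im +
          (radSq u / u.1.2 - radSq v / v.1.2) := by
    intro p
    have hp := p.2
    simp only [form, emb, radSq, sq_norm_eq, Complex.re_ofReal_mul, Complex.im_ofReal_mul]
    field_simp
    ring
  refine ⟨1 / u.1.2 - 1 / v.1.2, -2 * (u.1.1.re / u.1.2 - v.1.1.re / v.1.2),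
    -2 * (u.1.1.im / u.1.2 - v.1.1.im / v.1.2), radSq u / u.1.2 - radSq v / v.1.2,
    ?_, fun p hp => ?_, fun p => and_congr_right fun _ => ?_⟩
  rotate_left
  · rw [← key]
    have := (hdist_le_iff _ _ _ _).1 (hle p hp)
    have hp := p.2
    have : 0 ≤ form (emb p) (emb v) - form (emb p) (emb u) := by linarith
    have : 0 ≤ 2 * p.1.2 * (form (emb p) (emb v) - form (emb p) (emb u)) := by positivity
    linarith
  · rw [← key, hdist_eq_iff, mul_eq_zero, sub_eq_zero]
    have hp := p.2
    have : 2 * p.1.2 ≠ 0 := by positivity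
    simp [this]
  · rintro ⟨h1, h2, h3⟩
    apply huv
    have ht : u.1.2 = v.1.2 := by
      field_simp at h1; linarith
    rw [ht] at h2 h3
    have hr : u.1.1.re = v.1.1.re := by
      field_simp at h2; linarith
    have hi : u.1.1.im = v.1.1.im := by
      field_simp at h3; linarith
    exact Subtype.ext (Prod.ext (Complex.ext hr hi) ht)

/-- The quadric of the face is at most `0` on `C` and vanishes at a point of `F`. If that point were
interior to `C`, moving it both ways in the vertical, real and imaginary directions would make the
coefficients `α`, `β`, `γ` vanish in turn. -/
theorem IsFace.notMem_of_mem_interior {C F : Set HypSpace} (h : IsFace C F) {p : HypSpace}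
    (hp : p ∈ interior C) : p ∉ F := by
  obtain ⟨α, β, γ, δ, h0, hle, hF⟩ := h.exists_quadric
  intro hpF
  have hq := ((hF p).1 hpF).2
  have hnear : ∀ f : ℝ → HypSpace, ContinuousAt f 0 → f 0 = p →
      ∃ ε > 0, f ε ∈ C ∧ f (-ε) ∈ C := by
    intro f hf hf0
    have h1 : ∀ᶠ e in 𝓝 (0 : ℝ), f e ∈ C := by
      have : C ∈ 𝓝 (f 0) := by rw [hf0]; exact mem_interior_iff_mem_nhds.1 hp
      exact hf this
    obtain ⟨ε, hε, hb⟩ := Metric.eventually_nhds_iff.1 h1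
    exact ⟨ε / 2, by positivity, hb (by simp [abs_of_pos hε]; linarith),
      hb (by simp [abs_of_pos hε]; linarith)⟩
  have hpt := p.2
  have hα : α = 0 := by
    obtain ⟨ε, hε, h1, h2⟩ := hnear
      (fun e => ⟨(p.1.1, p.1.2 * Real.exp e), mul_pos hpt (Real.exp_pos e)⟩)
      (Continuous.continuousAt (by fun_prop)) (by simp)
    have l1 := hle _ h1
    have l2 := hle _ h2
    rw [radSq_eq] at l1 l2 hq
    simp only at l1 l2
    have e1 : 1 < Real.exp ε := Real.one_lt_exp_iff.2 hε
    have e2 : Real.exp (-ε) < 1 := Real.exp_lt_one_iff.2 (by linarith)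
    have e3 : 0 < Real.exp (-ε) := Real.exp_pos _
    have m1 : α * (p.1.2 ^ 2 * (Real.exp ε ^ 2 - 1)) ≤ 0 := by nlinarith
    have m2 : 0 ≤ α * (p.1.2 ^ 2 * (1 - Real.exp (-ε) ^ 2)) := by nlinarith
    have p1 : 0 < p.1.2 ^ 2 * (Real.exp ε ^ 2 - 1) := by
      have : 0 < Real.exp ε ^ 2 - 1 := by nlinarith
      positivity
    have p2 : 0 < p.1.2 ^ 2 * (1 - Real.exp (-ε) ^ 2) := by
      have : 0 < 1 - Real.exp (-ε) ^ 2 := by nlinarith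
      positivity
    exact le_antisymm (nonpos_of_mul_nonpos_left m1 p1) (nonneg_of_mul_nonneg_left m2 p2)
  subst hα
  have hβ : β = 0 := by
    obtain ⟨ε, hε, h1, h2⟩ := hnear (fun e => ⟨(p.1.1 + (e : ℝ), p.1.2), hpt⟩)
      (Continuous.continuousAt (by fun_prop)) (by simp)
    have l1 := hle _ h1
    have l2 := hle _ h2
    simp at l1 l2
    have m1 : β * ε ≤ 0 := by linarith
    have m2 : 0 ≤ β * ε := by linarith
    exact le_antisymm (nonpos_of_mul_nonpos_left m1 hε) (nonneg_of_mul_nonneg_left m2 hε)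
  subst hβ
  refine h0 ⟨rfl, rfl, ?_⟩
  obtain ⟨ε, hε, h1, h2⟩ := hnear (fun e => ⟨(p.1.1 + (e : ℝ) * Complex.I, p.1.2), hpt⟩)
    (Continuous.continuousAt (by fun_prop)) (by simp)
  have l1 := hle _ h1
  have l2 := hle _ h2
  simp at l1 l2
  have m1 : γ * ε ≤ 0 := by linarith
  have m2 : 0 ≤ γ * ε := by linarith
  exact le_antisymm (nonpos_of_mul_nonpos_left m1 hε) (nonneg_of_mul_nonneg_left m2 hε)

theorem IsTiling.eq_of_mem_interior {𝒟 : Set (Set HypSpace)} (h : IsTiling 𝒟) {P Q : Set HypSpace}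
    (hP : P ∈ 𝒟) (hQ : Q ∈ 𝒟) {p : HypSpace} (hp : p ∈ interior P) (hq : p ∈ Q) : P = Q := by
  by_contra hne
  exact (h.faceToFace P hP Q hQ hne).1.notMem_of_mem_interior hp ⟨interior_subset hp, hq⟩

/-! ### Vertical tiles -/

/-- The polygon below a vertical tile. -/
def simBase (μ : ℂˣ) (ν : ℂ) (b : Bool) : Set ℂ := (fun z => μ * z + ν) '' base b

theorem mem_sim_image_iff {μ : ℂˣ} {ν : ℂ} {b : Bool} {p : HypSpace}
    (h : 9 / 10 * ‖(μ : ℂ)‖ ≤ p.1.2) : p ∈ sim μ ν '' std b ↔ p.1.1 ∈ simBase μ ν b := by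
  have hμ : 0 < ‖(μ : ℂ)‖ := norm_pos_iff.2 μ.ne_zero
  constructor
  · rintro ⟨q, hq, rfl⟩
    exact ⟨q.1.1, std_subset hq, rfl⟩
  · rintro ⟨w, hw, hwp⟩
    refine ⟨(sim μ ν).symm p, mem_std_of_height ?_ ?_, (sim μ ν).apply_symm_apply p⟩
    · have : ((sim μ ν).symm p).1.1 = (μ : ℂ)⁻¹ * (p.1.1 - ν) := rfl
      rw [this, ← hwp]
      simpa using hw
    · have : ((sim μ ν).symm p).1.2 = ‖(μ : ℂ)‖⁻¹ * p.1.2 := rfl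
      rw [this]
      field_simp
      linarith

theorem mem_interior_sim_image {μ : ℂˣ} {ν : ℂ} {b : Bool} {p : HypSpace}
    (h : ‖(μ : ℂ)‖ ≤ p.1.2) (hp : p.1.1 ∈ interior (simBase μ ν b)) :
    p ∈ interior (sim μ ν '' std b) := by
  have hμ : 0 < ‖(μ : ℂ)‖ := norm_pos_iff.2 μ.ne_zero
  refine mem_interior.2 ⟨{q | q.1.1 ∈ interior (simBase μ ν b) ∧ 9 / 10 * ‖(μ : ℂ)‖ < q.1.2},
    fun q hq => (mem_sim_image_iff hq.2.le).2 (interior_subset hq.1), ?_, hp, by linarith⟩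
  have h1 : Continuous fun q : HypSpace => q.1.1 := by fun_prop
  have h2 : Continuous fun q : HypSpace => q.1.2 := by fun_prop
  exact (isOpen_interior.preimage h1).inter (isOpen_lt continuous_const h2)

theorem sim_one_zero : sim 1 0 = 1 := by
  refine Equiv.ext fun p => Subtype.ext (Prod.ext ?_ ?_) <;> simp

theorem sim_mul (μ μ' : ℂˣ) (ν ν' : ℂ) : sim μ ν * sim μ' ν' = sim (μ * μ') (μ * ν' + ν) := by
  refine Equiv.ext fun p => Subtype.ext (Prod.ext ?_ ?_) <;> simp <;> ring

theorem simBase_one_zero (b : Bool) : simBase 1 0 b = base b := by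
  simp [simBase]

theorem simBase_rot (μ : ℂˣ) (ν : ℂ) (b : Bool) :
    simBase (μ * rotUnit b) (μ + ν) b = simBase μ ν b := by
  have : (fun z : ℂ => (↑(μ * rotUnit b) : ℂ) * z + (μ + ν)) =
      (fun z => (μ : ℂ) * z + ν) ∘ fun z => (rotUnit b : ℂ) * z + 1 := by
    funext z
    simp
    ring
  rw [simBase, simBase, this, image_comp]
  congr 1
  let e : Equiv.Perm ℂ := ⟨fun z => (rotUnit b : ℂ) * z + 1, fun z => (rotUnit b : ℂ)⁻¹ * (z - 1),
    fun z => by simp, fun z => by simp⟩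
  exact image_eq_of_mem_iff (φ := e) fun z => rot_mem_base b z

theorem sim_image_rot (μ : ℂˣ) (ν : ℂ) (b : Bool) :
    sim (μ * rotUnit b) (μ + ν) '' std b = sim μ ν '' std b := by
  conv_rhs => rw [← rot_image_std b, ← image_mul, rot, sim_mul, mul_one]

/-- The lines `Im = 0` bounding a polygon meet it, unless in a point, in a side; up to a rotation
of the polygon it is the side from `0` to `1`. -/
theorem exists_side {μ : ℂˣ} {ν : ℂ} {b : Bool} {σ : ℝ} (hσ : σ ≠ 0)
    (h : ∀ w ∈ base b, 0 ≤ σ * ((μ : ℂ) * w + ν).im) {w₀ w₁ : ℂ} (h₀ : w₀ ∈ base b)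
    (h₁ : w₁ ∈ base b) (hne : w₀ ≠ w₁) (z₀ : ((μ : ℂ) * w₀ + ν).im = 0)
    (z₁ : ((μ : ℂ) * w₁ + ν).im = 0) :
    ∃ (μ' : ℂˣ) (ν' : ℂ), simBase μ' ν' b = simBase μ ν b ∧
      sim μ' ν' '' std b = sim μ ν '' std b ∧ (μ' : ℂ).im = 0 ∧ ν'.im = 0 := by
  have h3 := sqrt_three_sq
  have hs := sqrt_three_pos
  have hstep : ∀ {μ : ℂˣ} {ν : ℂ}, (∃ (μ' : ℂˣ) (ν' : ℂ),
      simBase μ' ν' b = simBase (μ * rotUnit b) (μ + ν) b ∧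
      sim μ' ν' '' std b = sim (μ * rotUnit b) (μ + ν) '' std b ∧ (μ' : ℂ).im = 0 ∧ ν'.im = 0) →
      ∃ (μ' : ℂˣ) (ν' : ℂ), simBase μ' ν' b = simBase μ ν b ∧
      sim μ' ν' '' std b = sim μ ν '' std b ∧ (μ' : ℂ).im = 0 ∧ ν'.im = 0 := by
    rintro μ ν ⟨μ', ν', e1, e2, e3⟩
    exact ⟨μ', ν', e1.trans (simBase_rot μ ν b), e2.trans (sim_image_rot μ ν b), e3⟩
  have hbase : ∀ {μ : ℂˣ} {ν : ℂ}, ν.im = 0 → (μ : ℂ).im + ν.im = 0 →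
      ∃ (μ' : ℂˣ) (ν' : ℂ), simBase μ' ν' b = simBase μ ν b ∧
      sim μ' ν' '' std b = sim μ ν '' std b ∧ (μ' : ℂ).im = 0 ∧ ν'.im = 0 := by
    intro μ ν e1 e2
    exact ⟨μ, ν, rfl, rfl, by linarith, e1⟩
  have him : ∀ w : ℂ, ((μ : ℂ) * w + ν).im = (μ : ℂ).re * w.im + (μ : ℂ).im * w.re + ν.im :=
    fun w => by simp
  set a := (μ : ℂ).re with ha
  set c := (μ : ℂ).im with hc
  set n := ν.im with hn
  have hsub : corners b ⊆ base b := subset_convexHull _ _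
  rw [him] at z₀ z₁
  cases b
  · have f0 := h 0 (hsub (by simp [corners]))
    have f1 := h 1 (hsub (by simp [corners]))
    have f2 := h omega (hsub (by simp [corners]))
    rw [him] at f0 f1 f2
    simp only [omega, Complex.zero_re, Complex.zero_im, Complex.one_re, Complex.one_im, mul_zero,
      mul_one, zero_add] at f0 f1 f2
    set F0 := σ * n
    set F1 := σ * (c + n)
    set F2 := σ * (a * (√3 / 2) + c * (1 / 2) + n)
    -- The value of an affine function at `w` is the barycentric mean of its corner values, here
    -- nonnegative. At a zero each weighted corner value vanishes, and two distinct zeros leave two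
    -- corners with value `0`.
    have key : ∀ w ∈ base false, a * w.im + c * w.re + n = 0 →
        (√3 * (1 - w.re) - w.im) * F0 = 0 ∧ (√3 * w.re - w.im) * F1 = 0 ∧ w.im * F2 = 0 := by
      intro w hw hz
      rw [mem_base_false] at hw
      have p0 : 0 ≤ (√3 * (1 - w.re) - w.im) * F0 := mul_nonneg (by linarith) f0
      have p1 : 0 ≤ (√3 * w.re - w.im) * F1 := mul_nonneg (by linarith) f1
      have p2 : 0 ≤ w.im * F2 := mul_nonneg hw.1 f2
      have : (√3 * (1 - w.re) - w.im) * F0 + (√3 * w.re - w.im) * F1 + 2 * (w.im * F2) =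
          √3 * (σ * (a * w.im + c * w.re + n)) := by
        simp only [F0, F1, F2]; ring
      rw [hz] at this
      refine ⟨by linarith, by linarith, by linarith⟩
    have k0 := key w₀ h₀ z₀
    have k1 := key w₁ h₁ z₁
    have hF : ∀ {x F : ℝ}, F ≠ 0 → x * F = 0 → x = 0 := fun hF hx =>
      (mul_eq_zero.1 hx).resolve_right hF
    have cancel : ∀ {x y : ℝ}, √3 * x = √3 * y → x = y := fun hxy =>
      mul_left_cancel₀ hs.ne' hxy
    by_cases e0 : F0 = 0
    · have n0 : n = 0 := (mul_eq_zero.1 e0).resolve_left hσ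
      by_cases e1 : F1 = 0
      · have n1 : c + n = 0 := (mul_eq_zero.1 e1).resolve_left hσ
        exact hbase n0 n1
      · by_cases e2 : F2 = 0
        · have n2 : a * (√3 / 2) + c * (1 / 2) + n = 0 := (mul_eq_zero.1 e2).resolve_left hσ
          refine hstep (hstep (hbase ?_ ?_))
          · simp [rotUnit, omega, ← ha, ← hc, ← hn]; linarith
          · simp [rotUnit, omega, ← ha, ← hc, ← hn]; linear_combination n0 - c / 4 * h3
        · exfalso
          have y0 := hF e2 k0.2.2
          have y1 := hF e2 k1.2.2
          have x0 := hF e1 k0.2.1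
          have x1 := hF e1 k1.2.1
          exact hne (Complex.ext (cancel (by linarith)) (by linarith))
    · have x0 := hF e0 k0.1
      have x1 := hF e0 k1.1
      by_cases e1 : F1 = 0
      · have n1 : c + n = 0 := (mul_eq_zero.1 e1).resolve_left hσ
        by_cases e2 : F2 = 0
        · have n2 : a * (√3 / 2) + c * (1 / 2) + n = 0 := (mul_eq_zero.1 e2).resolve_left hσ
          refine hstep (hbase ?_ ?_)
          · simp [← hc, ← hn]; linarith
          · simp [rotUnit, omega, ← ha, ← hc, ← hn]; linarith
        · exfalso
          have y0 := hF e2 k0.2.2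
          have y1 := hF e2 k1.2.2
          exact hne (Complex.ext (cancel (by linarith)) (by linarith))
      · exfalso
        have y0 := hF e1 k0.2.1
        have y1 := hF e1 k1.2.1
        have : w₀.re = w₁.re := cancel (by linarith)
        exact hne (Complex.ext this (by rw [this] at y0; linarith))
  · have f0 := h 0 (hsub (by simp [corners]))
    have f1 := h 1 (hsub (by simp [corners]))
    have f2 := h (1 + Complex.I) (hsub (by simp [corners]))
    have f3 := h Complex.I (hsub (by simp [corners]))
    rw [him] at f0 f1 f2 f3
    simp at f0 f1 f2 f3
    set F0 := σ * n with hF0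
    set F1 := σ * (c + n) with hF1
    set F2 := σ * (a + c + n) with hF2
    set F3 := σ * (a + n) with hF3
    have key : ∀ w ∈ base true, a * w.im + c * w.re + n = 0 →
        (1 - w.re) * (1 - w.im) * F0 = 0 ∧ w.re * (1 - w.im) * F1 = 0 ∧ w.re * w.im * F2 = 0 ∧
          (1 - w.re) * w.im * F3 = 0 := by
      intro w hw hz
      rw [mem_base_true] at hw
      obtain ⟨i1, i2, i3, i4⟩ := hw
      have i2' : 0 ≤ 1 - w.re := by linarith
      have i4' : 0 ≤ 1 - w.im := by linarith
      have p0 : 0 ≤ (1 - w.re) * (1 - w.im) * F0 := by positivity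
      have p1 : 0 ≤ w.re * (1 - w.im) * F1 := by positivity
      have p2 : 0 ≤ w.re * w.im * F2 := by positivity
      have p3 : 0 ≤ (1 - w.re) * w.im * F3 := by positivity
      have : (1 - w.re) * (1 - w.im) * F0 + w.re * (1 - w.im) * F1 + w.re * w.im * F2 +
          (1 - w.re) * w.im * F3 = σ * (a * w.im + c * w.re + n) := by
        simp only [F0, F1, F2, F3]; ring
      rw [hz] at this
      refine ⟨by linarith, by linarith, by linarith, by linarith⟩
    have k0 := key w₀ h₀ z₀
    have k1 := key w₁ h₁ z₁
    have hF : ∀ {x y F : ℝ}, F ≠ 0 → x * y * F = 0 → x = 0 ∨ y = 0 := fun hF hx =>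
      mul_eq_zero.1 ((mul_eq_zero.1 hx).resolve_right hF)
    have hpar : F0 + F2 = F1 + F3 := by simp only [F0, F1, F2, F3]; ring
    have hz : ∀ {x : ℝ}, σ * x = 0 → x = 0 := fun hx => (mul_eq_zero.1 hx).resolve_left hσ
    -- By `hpar` and nonnegativity, two opposite vanishing corner values force all four to vanish.
    -- If no two adjacent ones vanish, at least three are nonzero, which pins the zero `w` to a
    -- single point.
    have hcase : (F0 = 0 ∧ F1 = 0) ∨ (F1 = 0 ∧ F2 = 0) ∨ (F2 = 0 ∧ F3 = 0) ∨ (F3 = 0 ∧ F0 = 0) := by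
      by_contra hcon
      have e02 : ¬ (F0 = 0 ∧ F2 = 0) := fun ⟨e, e'⟩ => hcon (Or.inl ⟨e, by linarith⟩)
      have e13 : ¬ (F1 = 0 ∧ F3 = 0) := fun ⟨e, e'⟩ => hcon (Or.inl ⟨by linarith, e⟩)
      have two : ∀ {F G H : ℝ} {x y x' y' x'' y'' : ℂ → ℝ} {r s : ℝ}, F ≠ 0 → G ≠ 0 → H ≠ 0 →
          (∀ w, (x w = 0 ∨ y w = 0) → (x' w = 0 ∨ y' w = 0) → (x'' w = 0 ∨ y'' w = 0) →
            w.re = r ∧ w.im = s) →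
          x w₀ * y w₀ * F = 0 → x' w₀ * y' w₀ * G = 0 → x'' w₀ * y'' w₀ * H = 0 →
          x w₁ * y w₁ * F = 0 → x' w₁ * y' w₁ * G = 0 → x'' w₁ * y'' w₁ * H = 0 → False := by
        intro F G H x y x' y' x'' y'' r s hF' hG hH hw a1 a2 a3 b1 b2 b3
        have p := hw w₀ (hF hF' a1) (hF hG a2) (hF hH a3)
        have q := hw w₁ (hF hF' b1) (hF hG b2) (hF hH b3)
        exact hne (Complex.ext (p.1.trans q.1.symm) (p.2.trans q.2.symm))
      by_cases e0 : F0 = 0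
      · have e1 : F1 ≠ 0 := fun e => hcon (Or.inl ⟨e0, e⟩)
        have e2 : F2 ≠ 0 := fun e => e02 ⟨e0, e⟩
        have e3 : F3 ≠ 0 := fun e => hcon (Or.inr (Or.inr (Or.inr ⟨e, e0⟩)))
        refine two (x := fun w => w.re) (y := fun w => 1 - w.im) (x' := fun w => w.re)
          (y' := fun w => w.im) (x'' := fun w => 1 - w.re) (y'' := fun w => w.im) (r := 0) (s := 0)
          e1 e2 e3 ?_ k0.2.1 k0.2.2.1 k0.2.2.2 k1.2.1 k1.2.2.1 k1.2.2.2
        rintro w (h | h) (h' | h') (h'' | h'') <;> exact ⟨by linarith, by linarith⟩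
      by_cases e1 : F1 = 0
      · have e2 : F2 ≠ 0 := fun e => hcon (Or.inr (Or.inl ⟨e1, e⟩))
        have e3 : F3 ≠ 0 := fun e => e13 ⟨e1, e⟩
        refine two (x := fun w => 1 - w.re) (y := fun w => 1 - w.im) (x' := fun w => w.re)
          (y' := fun w => w.im) (x'' := fun w => 1 - w.re) (y'' := fun w => w.im) (r := 1) (s := 0)
          e0 e2 e3 ?_ k0.1 k0.2.2.1 k0.2.2.2 k1.1 k1.2.2.1 k1.2.2.2
        rintro w (h | h) (h' | h') (h'' | h'') <;> exact ⟨by linarith, by linarith⟩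
      by_cases e2 : F2 = 0
      · have e3 : F3 ≠ 0 := fun e => hcon (Or.inr (Or.inr (Or.inl ⟨e2, e⟩)))
        refine two (x := fun w => 1 - w.re) (y := fun w => 1 - w.im) (x' := fun w => w.re)
          (y' := fun w => 1 - w.im) (x'' := fun w => 1 - w.re) (y'' := fun w => w.im) (r := 1)
          (s := 1) e0 e1 e3 ?_ k0.1 k0.2.1 k0.2.2.2 k1.1 k1.2.1 k1.2.2.2
        rintro w (h | h) (h' | h') (h'' | h'') <;> exact ⟨by linarith, by linarith⟩
      · refine two (x := fun w => 1 - w.re) (y := fun w => 1 - w.im) (x' := fun w => w.re)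
          (y' := fun w => 1 - w.im) (x'' := fun w => w.re) (y'' := fun w => w.im) (r := 0)
          (s := 1) e0 e1 e2 ?_ k0.1 k0.2.1 k0.2.2.1 k1.1 k1.2.1 k1.2.2.1
        rintro w (h | h) (h' | h') (h'' | h'') <;> exact ⟨by linarith, by linarith⟩
    rcases hcase with ⟨e, e'⟩ | ⟨e, e'⟩ | ⟨e, e'⟩ | ⟨e, e'⟩
    · exact hbase (hz e) (hz e')
    · have n1 := hz e
      have n2 := hz e'
      refine hstep (hbase ?_ ?_)
      · simp [← hc, ← hn]; linarith
      · simp [rotUnit, ← ha, ← hc, ← hn]; linarith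
    · have n1 := hz e
      have n2 := hz e'
      refine hstep (hstep (hbase ?_ ?_))
      · simp [rotUnit, ← ha, ← hc, ← hn]; linarith
      · simp [rotUnit, ← ha, ← hc, ← hn]; linarith
    · have n1 := hz e
      have n2 := hz e'
      refine hstep (hstep (hstep (hbase ?_ ?_)))
      · simp [rotUnit, ← ha, ← hc, ← hn]; linarith
      · simp [rotUnit, ← ha, ← hc, ← hn]; linarith


theorem re_le_of_mem_base {b : Bool} {w : ℂ} (hw : w ∈ base b) (hi : w.im = 0) :
    0 ≤ w.re ∧ w.re ≤ 1 := by
  have hs := sqrt_three_pos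
  cases b
  · rw [mem_base_false, hi] at hw
    exact ⟨nonneg_of_mul_nonneg_right hw.2.1 hs,
      by linarith [nonneg_of_mul_nonneg_right hw.2.2 hs]⟩
  · rw [mem_base_true] at hw
    exact ⟨hw.1, hw.2.1⟩

theorem mem_base_of_real (b : Bool) {x : ℝ} (h0 : 0 ≤ x) (h1 : x ≤ 1) : (x : ℂ) ∈ base b := by
  have hs := sqrt_three_pos
  cases b
  · rw [mem_base_false]
    simp only [Complex.ofReal_re, Complex.ofReal_im]
    exact ⟨le_rfl, by positivity, mul_nonneg hs.le (by linarith)⟩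
  · rw [mem_base_true]
    simp [h0, h1]

theorem im_nonneg_of_mem_base {b : Bool} {w : ℂ} (hw : w ∈ base b) : 0 ≤ w.im := by
  cases b
  · exact ((mem_base_false w).1 hw).1
  · exact ((mem_base_true w).1 hw).2.2.1

theorem refl_image_std (b : Bool) : refl '' std b = sim (-1) 1 '' std b := by
  have h : refl * flip = sim (-1) 1 := by
    refine Equiv.ext fun p => Subtype.ext (Prod.ext ?_ ?_) <;> simp [flip]
  rw [← h, image_mul, flip_image_std]

/-- A vertical tile whose polygon lies on one side of the real line and meets it in `[0, 1]` is in
standard position up to a reflection. -/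
theorem sim_image_eq_of_side {μ : ℂˣ} {ν : ℂ} {b : Bool} {σ : ℝ} (hσ : σ ≠ 0)
    (h : ∀ z ∈ simBase μ ν b, 0 ≤ σ * z.im)
    (hr : ∀ z : ℂ, z.im = 0 → (z ∈ simBase μ ν b ↔ 0 ≤ z.re ∧ z.re ≤ 1)) :
    sim μ ν '' std b = std b ∨ sim μ ν '' std b = refl '' std b := by
  obtain ⟨w₀, h₀, e₀⟩ := (hr 0 (by simp)).2 (by simp)
  obtain ⟨w₁, h₁, e₁⟩ := (hr 1 (by simp)).2 (by simp)
  simp only at e₀ e₁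
  have hne : w₀ ≠ w₁ := by
    rintro rfl
    exact zero_ne_one (e₀.symm.trans e₁)
  obtain ⟨μ', ν', f1, f2, i1, i2⟩ := exists_side hσ (fun w hw => h _ (mem_image_of_mem _ hw)) h₀ h₁
    hne (by rw [e₀]; simp) (by rw [e₁]; simp)
  rw [← f1] at hr
  rw [← f2]
  obtain ⟨w₀, h₀, e₀⟩ := (hr 0 (by simp)).2 (by simp)
  obtain ⟨w₁, h₁, e₁⟩ := (hr 1 (by simp)).2 (by simp)
  have g0 := (hr ν' i2).1 ⟨0, zero_mem_base b, by simp⟩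
  have g1 := (hr (μ' + ν') (by simp [i1, i2])).1
    ⟨1, by simpa using mem_base_of_real b zero_le_one le_rfl, by simp⟩
  have r0 := congrArg Complex.re e₀
  have r1 := congrArg Complex.re e₁
  have m0 := congrArg Complex.im e₀
  have m1 := congrArg Complex.im e₁
  simp [i1, i2] at r0 r1 m0 m1 g1
  have hμ : (μ' : ℂ).re ≠ 0 := fun e => μ'.ne_zero (Complex.ext e i1)
  have y0 := m0.resolve_left hμ
  have y1 := m1.resolve_left hμ
  have x0 := re_le_of_mem_base h₀ y0
  have x1 := re_le_of_mem_base h₁ y1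
  rcases hμ.lt_or_gt with hneg | hpos
  · right
    have a1 : ν'.re = 1 := by nlinarith
    have a2 : (μ' : ℂ).re = -1 := by nlinarith
    have b1 : ν' = 1 := Complex.ext a1 i2
    have b2 : μ' = -1 := Units.ext (Complex.ext (by simpa using a2) (by simpa using i1))
    rw [b1, b2, refl_image_std]
  · left
    have a1 : ν'.re = 0 := by nlinarith
    have a2 : (μ' : ℂ).re = 1 := by nlinarith
    have b1 : ν' = 0 := Complex.ext a1 i2
    have b2 : μ' = 1 := Units.ext (Complex.ext a2 i1)
    rw [b1, b2, sim_one_zero, image_one]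

/-- A quadric through the vertical strip over `[0, 1]` is the vertical plane through it. -/
theorem quadric_eq {α β δ : ℝ} (h : ∀ x t : ℝ, 0 ≤ x → x ≤ 1 → 2 ≤ t →
    α * (x ^ 2 + t ^ 2) + β * x + δ = 0) : α = 0 ∧ β = 0 ∧ δ = 0 := by
  have h1 := h 0 2 le_rfl zero_le_one le_rfl
  have h2 := h 0 3 le_rfl zero_le_one (by norm_num)
  have h3 := h 1 2 zero_le_one le_rfl le_rfl
  refine ⟨by linarith, by linarith, by linarith⟩

theorem half_mem_interior (b : Bool) : (⟨1 / 2, 1 / 4⟩ : ℂ) ∈ interior (base b) := by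
  have h3 := sqrt_three_sq
  have hs := sqrt_three_pos
  have hs1 : 1 < √3 := by nlinarith
  refine mem_interior.2 ⟨{z | 0 < z.im ∧ z.im < √3 * z.re ∧ z.im < √3 * (1 - z.re) ∧ 0 < z.re ∧
    z.re < 1 ∧ z.im < 1}, ?_, ?_, ?_⟩
  · rintro z ⟨h1, h2, h4, h5, h6, h7⟩
    cases b
    · exact (mem_base_false z).2 ⟨h1.le, h2.le, h4.le⟩
    · exact (mem_base_true z).2 ⟨h5.le, h6.le, h1.le, h7.le⟩
  · have hre := Complex.continuous_re
    have him := Complex.continuous_im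
    exact (isOpen_lt continuous_const him).inter ((isOpen_lt him (by fun_prop)).inter
      ((isOpen_lt him (by fun_prop)).inter ((isOpen_lt continuous_const hre).inter
        ((isOpen_lt hre continuous_const).inter (isOpen_lt him continuous_const)))))
  · refine ⟨by norm_num, ?_, ?_, by norm_num, by norm_num, by norm_num⟩ <;> simp only <;> linarith

/-- The tile on the other side of the vertical side over `[0, 1]` of a standard tile. -/
theorem IsTiling.exists_neighbour {𝒟 : Set (Set HypSpace)} (h𝒟 : IsTiling 𝒟) {b : Bool}
    (hb : std b ∈ 𝒟) : ∃ b', refl '' std b' ∈ 𝒟 := by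
  have hlf : LocallyFinite (fun P : {P : 𝒟 // (P : Set HypSpace) ≠ std b} => (P.1 : Set HypSpace)) :=
    h𝒟.locallyFinite.comp_injective Subtype.val_injective
  have hcl := hlf.isClosed_iUnion fun P => isClosed_tile h𝒟 P.1.2
  -- These points lie just outside the side. The union of the other tiles is closed by local
  -- finiteness, so one of them reaches the limit point in the middle of the vertical side.
  let z : ℕ → ℂ := fun n => ⟨1 / 2, -(1 / ((n : ℝ) + 1))⟩
  have hmem : ∀ n, pt (z n) 2 two_pos ∈
      ⋃ P : {P : 𝒟 // (P : Set HypSpace) ≠ std b}, (P.1 : Set HypSpace) := by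
    intro n
    have : pt (z n) 2 two_pos ∈ ⋃₀ 𝒟 := by rw [h𝒟.covers]; trivial
    obtain ⟨P, hP, hp⟩ := this
    refine mem_iUnion.2 ⟨⟨⟨P, hP⟩, ?_⟩, hp⟩
    rintro rfl
    have h1 := im_nonneg_of_mem_base (std_subset hp)
    have h2 : 0 < 1 / ((n : ℝ) + 1) := by positivity
    simp only [pt, z] at h1
    linarith
  have hlim : Tendsto (fun n => pt (z n) 2 two_pos) atTop (𝓝 (pt ⟨1 / 2, 0⟩ 2 two_pos)) := by
    rw [tendsto_subtype_rng]
    refine Tendsto.prodMk_nhds ?_ tendsto_const_nhds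
    have h0 := (tendsto_one_div_add_atTop_nhds_zero_nat (𝕜 := ℝ)).neg
    rw [neg_zero] at h0
    have h1 : Tendsto (fun n : ℕ => ((1 / 2 : ℝ) : ℂ) + ((-(1 / ((n : ℝ) + 1)) : ℝ) : ℂ) * Complex.I)
        atTop (𝓝 (((1 / 2 : ℝ) : ℂ) + ((0 : ℝ) : ℂ) * Complex.I)) :=
      (((Complex.continuous_ofReal.tendsto _).comp h0).mul_const _).const_add _
    have e : ∀ x y : ℝ, ((x : ℂ) + (y : ℂ) * Complex.I) = ⟨x, y⟩ := fun x y =>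
      (Complex.mk_eq_add_mul_I x y).symm
    simp only [e] at h1
    exact h1
  obtain ⟨⟨⟨Q, hQ⟩, hne⟩, hpQ⟩ := mem_iUnion.1 (hcl.mem_of_tendsto hlim (.of_forall hmem))
  simp only at hne hpQ
  have hstd : ∀ x t : ℝ, 0 ≤ x → x ≤ 1 → ∀ ht : 1 ≤ t, pt x t (by linarith) ∈ std b :=
    fun x t h0 h1 ht => mem_std_of_height (mem_base_of_real b h0 h1) (by simp only [pt]; linarith)
  have hrad : ∀ x t : ℝ, ∀ ht : 0 < t, radSq (pt x t ht) = x ^ 2 + t ^ 2 := by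
    intro x t ht; simp [radSq_eq, pt]
  obtain ⟨hf1, hf2⟩ := h𝒟.faceToFace _ hb _ hQ hne.symm
  obtain ⟨α, β, γ, δ, n0, hle, hF⟩ := hf1.exists_quadric
  have hp0 : pt ((1 / 2 : ℝ) : ℂ) 2 two_pos ∈ std b ∩ Q :=
    ⟨hstd _ _ (by norm_num) (by norm_num) (by norm_num), hpQ⟩
  have q0 := ((hF _).1 hp0).2
  -- The quadric is at most `0` above, below, left and right of its zero inside the vertical side.
  -- So it depends on `Im z` only, and the common face is the whole vertical side.
  have t1 := hle _ (hstd (1 / 2) 1 (by norm_num) (by norm_num) le_rfl)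
  have t2 := hle _ (hstd (1 / 2) 3 (by norm_num) (by norm_num) (by norm_num))
  have t3 := hle _ (hstd (1 / 4) 2 (by norm_num) (by norm_num) (by norm_num))
  have t4 := hle _ (hstd (3 / 4) 2 (by norm_num) (by norm_num) (by norm_num))
  rw [hrad] at q0 t1 t2 t3 t4
  simp only [pt, Complex.ofReal_re, Complex.ofReal_im, mul_zero, add_zero] at q0 t1 t2 t3 t4
  have hα : α = 0 := by linarith
  subst hα
  have hβ : β = 0 := by linarith
  subst hβ
  have hδ : δ = 0 := by linarith
  subst hδ
  have hγ : γ ≠ 0 := fun e => n0 ⟨rfl, rfl, e⟩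
  have hF' : ∀ p, p ∈ std b ∩ Q ↔ p ∈ std b ∧ p.1.1.im = 0 := by
    intro p
    rw [hF]
    simp [hγ]
  have hQ' : ∀ x t : ℝ, 0 ≤ x → x ≤ 1 → ∀ ht : 1 ≤ t, pt x t (by linarith) ∈ std b ∩ Q :=
    fun x t h0 h1 ht => (hF' _).2 ⟨hstd x t h0 h1 ht, by simp [pt]⟩
  have hinf : OnePoint.infty ∈ idealVertices Q := by
    refine mem_idealVertices_of_tendsto (tendsto_upward ((0 : ℝ) : ℂ) 1 one_pos) fun n => ?_
    exact (hQ' 0 _ le_rfl zero_le_one (by simp)).2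
  obtain ⟨b', μ, ν, rfl⟩ : ∃ b' μ ν, Q = sim μ ν '' std b' := by
    obtain ⟨b', φ, hφ, rfl⟩ := exists_std h𝒟 hQ
    exact ⟨b', eq_sim_image hφ hinf⟩
  -- The face of `Q` contains the same strip, so `Q` lies on one side of the same vertical plane and
  -- meets it exactly over `[0, 1]`.
  obtain ⟨α, β, γ', δ, n0', hle', hFQ⟩ := hf2.exists_quadric
  obtain ⟨rfl, rfl, rfl⟩ := quadric_eq (α := α) (β := β) (δ := δ) fun x t h0 h1 ht => by
    have := ((hFQ _).1 (hQ' x t h0 h1 (by linarith))).2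
    rw [hrad] at this
    simpa [pt] using this
  have hγ' : γ' ≠ 0 := fun e => n0' ⟨rfl, rfl, e⟩
  have hμ : 0 < ‖(μ : ℂ)‖ := norm_pos_iff.2 μ.ne_zero
  have hhigh : ∀ w, pt w (‖(μ : ℂ)‖ + 1) (by positivity) ∈ sim μ ν '' std b' ↔ w ∈ simBase μ ν b' :=
    fun w => mem_sim_image_iff (by simp only [pt]; linarith)
  have hcases := sim_image_eq_of_side (μ := μ) (ν := ν) (b := b') (σ := -γ') (neg_ne_zero.2 hγ')
    (fun w hw => by
      have := hle' _ ((hhigh w).2 hw)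
      simp only [pt] at this
      linarith)
    (fun w hw => by
      rw [← hhigh]
      have hwr : w = ((w.re : ℝ) : ℂ) := Complex.ext (by simp) (by simp [hw])
      constructor
      · intro hmem
        have : pt w (‖(μ : ℂ)‖ + 1) (by positivity) ∈ std b ∩ sim μ ν '' std b' :=
          (hFQ _).2 ⟨hmem, by simp [pt, hw]⟩
        exact re_le_of_mem_base (std_subset this.1) hw
      · rintro ⟨h0, h1⟩
        have := (hQ' w.re (‖(μ : ℂ)‖ + 1) h0 h1 (by linarith)).2
        rwa [← hwr] at this)
  rcases hcases with h | h
  -- An unreflected `Q` would be on the same side as `std b` and share interior points with it.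
  · exfalso
    apply hne
    rw [h] at hQ ⊢
    have hin : ∀ b, pt ⟨1 / 2, 1 / 4⟩ 2 two_pos ∈ interior (std b) := fun b => by
      have := mem_interior_sim_image (μ := 1) (ν := 0) (b := b) (p := pt ⟨1 / 2, 1 / 4⟩ 2 two_pos)
        (by simp [pt]) (by rw [simBase_one_zero]; exact half_mem_interior b)
      rwa [sim_one_zero, image_one] at this
    exact h𝒟.eq_of_mem_interior hQ hb (hin b') (interior_subset (hin b))
  · exact ⟨b', h ▸ hQ⟩

/-! ### Polygons inscribed in circles -/

/-- A disc is strictly convex, so points of its boundary circle are extreme in every subset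
containing them. A polygon thereby determines its corners. -/
theorem extremePoints_convexHull_of_sphere {A : Set ℂ} {c : ℂ} {r : ℝ}
    (h : A ⊆ Metric.sphere c r) : extremePoints ℝ (convexHull ℝ A) = A := by
  refine Subset.antisymm extremePoints_convexHull_subset fun a ha => ?_
  have hball : convexHull ℝ A ⊆ Metric.closedBall c r :=
    convexHull_min (h.trans Metric.sphere_subset_closedBall) (convex_closedBall c r)
  have hext : a ∈ extremePoints ℝ (Metric.closedBall c r) := by
    rw [StrictConvexSpace.extremePoints_closedBall_eq_sphere]
    exact h ha
  exact inter_extremePoints_subset_extremePoints_of_subset hball ⟨subset_convexHull _ _ ha, hext⟩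

/-- The vertices of the polygon below a vertical tile. -/
def simCorners (μ : ℂˣ) (ν : ℂ) (b : Bool) : Set ℂ := (fun z => μ * z + ν) '' corners b

theorem image_convexHull_of_isometryEquiv (g : ℂ ≃ᵢ ℂ) (A : Set ℂ) :
    g '' convexHull ℝ A = convexHull ℝ (g '' A) :=
  (IsometryEquiv.toRealAffineIsometryEquiv g).toAffineEquiv.toAffineMap.image_convexHull A

theorem simBase_eq (μ : ℂˣ) (ν : ℂ) (b : Bool) :
    simBase μ ν b = convexHull ℝ (simCorners μ ν b) :=
  ((LinearMap.mulLeft ℝ (μ : ℂ)).toAffineMap + AffineMap.const ℝ ℂ ν).image_convexHull _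

/-- The circumradius of the base polygon. -/
def circumradius (b : Bool) : ℝ := ‖centre b‖

theorem corners_subset_sphere (b : Bool) :
    corners b ⊆ Metric.sphere (centre b) (circumradius b) := by
  have h3 := sqrt_three_sq
  intro v hv
  rw [mem_sphere_iff_norm, circumradius, ← sq_eq_sq₀ (norm_nonneg _) (norm_nonneg _), sq_norm_eq,
    sq_norm_eq]
  cases b
  · have : centre false = ⟨1 / 2, √3 / 6⟩ := by
      apply Complex.ext <;> simp [centre, omega] <;> ring
    rw [this]
    simp only [corners, mem_insert_iff, mem_singleton_iff] at hv
    rcases hv with rfl | rfl | rfl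
    · simp
    · simp; ring
    · simp [omega]; linarith
  · have : centre true = ⟨1 / 2, 1 / 2⟩ := by
      apply Complex.ext <;> simp [centre]
    rw [this]
    simp only [corners, mem_insert_iff, mem_singleton_iff] at hv
    rcases hv with rfl | rfl | rfl | rfl <;> simp <;> norm_num

theorem simCorners_subset_sphere (μ : ℂˣ) (ν : ℂ) (b : Bool) :
    simCorners μ ν b ⊆ Metric.sphere (μ * centre b + ν) (‖(μ : ℂ)‖ * circumradius b) := by
  rintro _ ⟨v, hv, rfl⟩
  have := corners_subset_sphere b hv
  rw [mem_sphere_iff_norm] at this ⊢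
  rw [← this, ← norm_mul]
  congr 1
  ring

theorem extremePoints_simBase (μ : ℂˣ) (ν : ℂ) (b : Bool) :
    extremePoints ℝ (simBase μ ν b) = simCorners μ ν b := by
  rw [simBase_eq]
  exact extremePoints_convexHull_of_sphere (simCorners_subset_sphere μ ν b)

theorem finite_corners (b : Bool) : (corners b).Finite := by cases b <;> simp [corners]

theorem similarity_injective (μ : ℂˣ) (ν : ℂ) : Function.Injective fun z : ℂ => μ * z + ν :=
  fun _ _ h => mul_left_cancel₀ μ.ne_zero (add_right_cancel h)

theorem ncard_corners (b : Bool) : (corners b).ncard = if b then 4 else 3 := by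
  have h3 := sqrt_three_pos
  cases b
  · have h1 : (1 : ℂ) ≠ omega := fun h => by
      have := congrArg Complex.re h
      simp [omega] at this
    rw [corners, ncard_insert_of_notMem, ncard_pair h1]
    · simp
    · simp [omega_ne_zero.symm]
  · have h1 : (1 + Complex.I : ℂ) ≠ Complex.I := by simp
    have h2 : (1 : ℂ) ∉ ({1 + Complex.I, Complex.I} : Set ℂ) := by
      simp [Complex.ext_iff]
    have h0 : (0 : ℂ) ∉ ({1, 1 + Complex.I, Complex.I} : Set ℂ) := by
      simp [Complex.ext_iff]
    rw [corners, ncard_insert_of_notMem h0, ncard_insert_of_notMem h2, ncard_pair h1]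
    simp

/-- The diameter of the base polygon. -/
def diameter (b : Bool) : ℝ := if b then √2 else 1

theorem diameter_pos (b : Bool) : 0 < diameter b := by cases b <;> simp [diameter]

theorem norm_sub_corners_le {b : Bool} {v w : ℂ} (hv : v ∈ corners b) (hw : w ∈ corners b) :
    ‖v - w‖ ≤ diameter b := by
  have h3 := sqrt_three_sq
  have h : ‖v - w‖ ^ 2 ≤ diameter b ^ 2 := by
    rw [sq_norm_eq]
    cases b
    · simp only [corners, mem_insert_iff, mem_singleton_iff] at hv hw
      rcases hv with rfl | rfl | rfl <;> rcases hw with rfl | rfl | rfl <;>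
        simp [omega, diameter] <;> nlinarith
    · simp only [corners, mem_insert_iff, mem_singleton_iff] at hv hw
      have : diameter true ^ 2 = 2 := by simp [diameter]
      rw [this]
      rcases hv with rfl | rfl | rfl | rfl <;> rcases hw with rfl | rfl | rfl | rfl <;>
        simp <;> norm_num
  exact (pow_le_pow_iff_left₀ (norm_nonneg _) (diameter_pos b).le two_ne_zero).1 h

theorem exists_norm_sub_corners (b : Bool) :
    ∃ v ∈ corners b, ∃ w ∈ corners b, ‖v - w‖ = diameter b := by
  cases b
  · exact ⟨1, by simp [corners], 0, by simp [corners], by simp [diameter]⟩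
  · refine ⟨1 + Complex.I, by simp [corners], 0, by simp [corners], ?_⟩
    rw [← sq_eq_sq₀ (norm_nonneg _) (diameter_pos true).le, sq_norm_eq]
    simp [diameter]; norm_num

theorem norm_le_of_simCorners_subset {μ μ' : ℂˣ} {ν ν' : ℂ} {b : Bool}
    (h : simCorners μ ν b ⊆ simCorners μ' ν' b) : ‖(μ : ℂ)‖ ≤ ‖(μ' : ℂ)‖ := by
  obtain ⟨v, hv, w, hw, e⟩ := exists_norm_sub_corners b
  obtain ⟨v', hv', ev⟩ := h (mem_image_of_mem _ hv)
  obtain ⟨w', hw', ew⟩ := h (mem_image_of_mem _ hw)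
  simp only at ev ew
  have h1 : (μ : ℂ) * (v - w) = μ' * (v' - w') := by linear_combination ew - ev
  have h2 := congrArg norm h1
  rw [norm_mul, norm_mul, e] at h2
  have h3 := norm_sub_corners_le hv' hw'
  have h4 : ‖(μ : ℂ)‖ * diameter b ≤ ‖(μ' : ℂ)‖ * diameter b := by
    rw [h2]; gcongr
  exact le_of_mul_le_mul_right h4 (diameter_pos b)

/-- The number of extreme points tells triangles from squares, and the diameter of the corner set
gives the scale. -/
theorem simBase_eq_iff {μ μ' : ℂˣ} {ν ν' : ℂ} {b b' : Bool}
    (h : simBase μ ν b = simBase μ' ν' b') :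
    b = b' ∧ ‖(μ : ℂ)‖ = ‖(μ' : ℂ)‖ := by
  have hc : simCorners μ ν b = simCorners μ' ν' b' := by
    rw [← extremePoints_simBase, h, extremePoints_simBase]
  have hn := congrArg ncard hc
  rw [simCorners, simCorners, ncard_image_of_injective _ (similarity_injective μ ν),
    ncard_image_of_injective _ (similarity_injective μ' ν'), ncard_corners, ncard_corners] at hn
  obtain rfl : b = b' := by
    cases b <;> cases b' <;> simp at hn <;> rfl
  exact ⟨rfl, le_antisymm (norm_le_of_simCorners_subset hc.subset)
    (norm_le_of_simCorners_subset hc.symm.subset)⟩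

theorem sim_image_eq_iff {μ μ' : ℂˣ} {ν ν' : ℂ} {b b' : Bool}
    (h : sim μ ν '' std b = sim μ' ν' '' std b') :
    simBase μ ν b = simBase μ' ν' b' := by
  ext w
  have hμ : 0 < ‖(μ : ℂ)‖ := norm_pos_iff.2 μ.ne_zero
  have hμ' : 0 < ‖(μ' : ℂ)‖ := norm_pos_iff.2 μ'.ne_zero
  have h1 := mem_sim_image_iff (μ := μ) (ν := ν) (b := b)
    (p := pt w (‖(μ : ℂ)‖ + ‖(μ' : ℂ)‖) (by positivity)) (by simp only [pt]; linarith)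
  have h2 := mem_sim_image_iff (μ := μ') (ν := ν') (b := b')
    (p := pt w (‖(μ : ℂ)‖ + ‖(μ' : ℂ)‖) (by positivity)) (by simp only [pt]; linarith)
  rw [h] at h1
  exact h1.symm.trans h2

/-! ### The polygons at infinity cover the plane -/

/-- A boundary point of the base polygon that is not a vertex lies on the side from `0` to `1`, up
to a rotation of the polygon. -/
theorem mem_interior_or_side {b : Bool} {w : ℂ} (hw : w ∈ base b) (hc : w ∉ corners b) :
    w ∈ interior (base b) ∨ ∀ (μ : ℂˣ) (ν : ℂ), ∃ (μ' : ℂˣ) (ν' : ℂ) (x : ℝ), ‖(μ' : ℂ)‖ = ‖(μ : ℂ)‖ ∧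
      sim μ' ν' '' std b = sim μ ν '' std b ∧ (μ' : ℂ) * x + ν' = μ * w + ν ∧ 0 < x ∧ x < 1 := by
  have h3 := sqrt_three_sq
  have hs := sqrt_three_pos
  let Side : ℂ → Prop := fun w => ∀ (μ : ℂˣ) (ν : ℂ), ∃ (μ' : ℂˣ) (ν' : ℂ) (x : ℝ),
    ‖(μ' : ℂ)‖ = ‖(μ : ℂ)‖ ∧ sim μ' ν' '' std b = sim μ ν '' std b ∧ (μ' : ℂ) * x + ν' = μ * w + ν ∧
      0 < x ∧ x < 1
  change _ ∨ Side w
  have hreal : ∀ x : ℝ, 0 < x → x < 1 → Side x := fun x h0 h1 μ ν =>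
    ⟨μ, ν, x, rfl, rfl, rfl, h0, h1⟩
  have hstep : ∀ {w w' : ℂ}, w = rotUnit b * w' + 1 → Side w' → Side w := by
    rintro _ w' rfl h μ ν
    obtain ⟨μ', ν', x, e1, e2, e3, e4⟩ := h (μ * rotUnit b) (μ + ν)
    refine ⟨μ', ν', x, ?_, e2.trans (sim_image_rot μ ν b), ?_, e4⟩
    · rw [e1, Units.val_mul, norm_mul, norm_rotUnit, mul_one]
    · rw [e3, Units.val_mul]; ring
  have hre := Complex.continuous_re
  have him := Complex.continuous_im
  cases b
  · rw [mem_base_false] at hw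
    simp only [corners, mem_insert_iff, mem_singleton_iff, not_or] at hc
    obtain ⟨c0, c1, c2⟩ := hc
    obtain ⟨i0, i1, i2⟩ := hw
    rcases i0.eq_or_lt with e0 | l0
    · right
      have hx0 : 0 ≤ w.re := nonneg_of_mul_nonneg_right (by rw [e0]; exact i1) hs
      have hx1 : 0 ≤ 1 - w.re := nonneg_of_mul_nonneg_right (by rw [e0]; exact i2) hs
      have hw' : w = (w.re : ℂ) := Complex.ext (by simp) (by simp [← e0])
      rw [hw']
      refine hreal _ (hx0.lt_of_ne fun e => c0 ?_) (lt_of_le_of_ne (by linarith) fun e => c1 ?_)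
      · rw [hw', ← e]; simp
      · rw [hw', e]; simp
    rcases i1.eq_or_lt with e1 | l1
    · right
      have hx : w.re ≤ 1 / 2 := by
        have : √3 * w.re ≤ √3 * (1 - w.re) := by linarith
        linarith [le_of_mul_le_mul_left this hs]
      have hx0 : 0 < w.re := pos_of_mul_pos_right (by linarith : 0 < √3 * w.re) hs.le
      refine hstep (w' := rotUnit false * ((1 - 2 * w.re : ℝ) : ℂ) + 1) ?_
        (hstep rfl (hreal _ ?_ (by linarith)))
      · apply Complex.ext
        · rw [rot_false_re, rot_false_re, rot_false_im]
          simp only [Complex.ofReal_re, Complex.ofReal_im]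
          linear_combination (1 / 4 - w.re / 2) * h3
        · rw [rot_false_im, rot_false_re, rot_false_im]
          simp only [Complex.ofReal_re, Complex.ofReal_im]
          linear_combination e1
      · have : w.re ≠ 1 / 2 := fun e => c2 (Complex.ext e (by rw [e1, e]; simp [omega]; ring))
        have := lt_of_le_of_ne hx this
        linarith
    rcases i2.eq_or_lt with e2 | l2
    · right
      have hx : 1 / 2 ≤ w.re := by
        have : √3 * (1 - w.re) ≤ √3 * w.re := by linarith
        linarith [le_of_mul_le_mul_left this hs]
      have hx0 : 0 < 1 - w.re := pos_of_mul_pos_right (by linarith : 0 < √3 * (1 - w.re)) hs.le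
      refine hstep (w' := ((2 - 2 * w.re : ℝ) : ℂ)) ?_ (hreal _ (by linarith) ?_)
      · apply Complex.ext
        · rw [rot_false_re]
          simp only [Complex.ofReal_re, Complex.ofReal_im]
          ring
        · rw [rot_false_im]
          simp only [Complex.ofReal_re, Complex.ofReal_im]
          linear_combination e2
      · have : 1 / 2 ≠ w.re := fun e => c2 (Complex.ext e.symm (by rw [e2, ← e]; simp [omega]; ring))
        have := lt_of_le_of_ne hx this
        linarith
    left
    refine mem_interior.2 ⟨{z | 0 < z.im ∧ z.im < √3 * z.re ∧ z.im < √3 * (1 - z.re)},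
      fun z hz => (mem_base_false z).2 ⟨hz.1.le, hz.2.1.le, hz.2.2.le⟩, ?_, l0, l1, l2⟩
    exact (isOpen_lt continuous_const him).inter ((isOpen_lt him (by fun_prop)).inter
      (isOpen_lt him (by fun_prop)))
  · rw [mem_base_true] at hw
    simp only [corners, mem_insert_iff, mem_singleton_iff, not_or] at hc
    obtain ⟨c0, c1, c2, c3⟩ := hc
    obtain ⟨i0, i1, i2, i3⟩ := hw
    rcases i2.eq_or_lt with e2 | l2
    · right
      have hw' : w = (w.re : ℂ) := Complex.ext (by simp) (by simp [← e2])
      rw [hw']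
      refine hreal _ (i0.lt_of_ne fun e => c0 ?_) (i1.lt_of_ne fun e => c1 ?_)
      · rw [hw', ← e]; simp
      · rw [hw', e]; simp
    rcases i1.eq_or_lt with e1 | l1
    · right
      refine hstep (w' := (w.im : ℂ)) ?_ (hreal _ l2 (i3.lt_of_ne fun e => c2 ?_))
      · apply Complex.ext
        · rw [rot_true_re]; simp [e1]
        · rw [rot_true_im]; simp
      · apply Complex.ext <;> simp [e1, e]
    rcases i3.eq_or_lt with e3 | l3
    · right
      refine hstep (w' := rotUnit true * ((1 - w.re : ℝ) : ℂ) + 1) ?_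
        (hstep rfl (hreal _ (by linarith) ?_))
      rotate_left
      · have := i0.lt_of_ne fun e => c3 (Complex.ext (by simp [← e]) (by simp [e3]))
        linarith
      · apply Complex.ext
        · rw [rot_true_re, rot_true_im]; simp
        · rw [rot_true_im, rot_true_re]; simp [e3]
    rcases i0.eq_or_lt with e0 | l0
    · right
      refine hstep (w' := rotUnit true * (rotUnit true * ((1 - w.im : ℝ) : ℂ) + 1) + 1) ?_
        (hstep rfl (hstep rfl (hreal _ (by linarith) (by linarith))))
      apply Complex.ext
      · rw [rot_true_re, rot_true_im, rot_true_re]; simp [← e0]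
      · rw [rot_true_im, rot_true_re, rot_true_im]; simp
    left
    refine mem_interior.2 ⟨{z | 0 < z.re ∧ z.re < 1 ∧ 0 < z.im ∧ z.im < 1},
      fun z hz => (mem_base_true z).2 ⟨hz.1.le, hz.2.1.le, hz.2.2.1.le, hz.2.2.2.le⟩, ?_, l0, l1,
      l2, l3⟩
    exact (isOpen_lt continuous_const hre).inter ((isOpen_lt hre continuous_const).inter
      ((isOpen_lt continuous_const him).inter (isOpen_lt him continuous_const)))

theorem base_union_mem_nhds (b b' : Bool) {x : ℝ} (h0 : 0 < x) (h1 : x < 1) :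
    base b ∪ (starRingEnd ℂ) '' base b' ∈ 𝓝 (x : ℂ) := by
  have hs := sqrt_three_pos
  have hre := Complex.continuous_re
  have him : Continuous fun z : ℂ => |z.im| := Complex.continuous_im.abs
  have hopen : IsOpen {z : ℂ | |z.im| < √3 * z.re ∧ |z.im| < √3 * (1 - z.re) ∧ 0 < z.re ∧ z.re < 1 ∧
      |z.im| < 1} :=
    (isOpen_lt him (by fun_prop)).inter ((isOpen_lt him (by fun_prop)).inter
      ((isOpen_lt continuous_const hre).inter ((isOpen_lt hre continuous_const).inter
        (isOpen_lt him continuous_const))))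
  refine mem_of_superset (hopen.mem_nhds ?_) ?_
  · have : 0 < 1 - x := by linarith
    simp only [mem_ofPred_eq, Complex.ofReal_re, Complex.ofReal_im, abs_zero]
    exact ⟨by positivity, by positivity, h0, h1, one_pos⟩
  · rintro z ⟨i1, i2, i3, i4, i5⟩
    have hb : ∀ b, ∀ z : ℂ, 0 ≤ z.im → |z.im| < √3 * z.re → |z.im| < √3 * (1 - z.re) → 0 < z.re →
        z.re < 1 → |z.im| < 1 → z ∈ base b := by
      intro b z h j1 j2 j3 j4 j5
      rw [abs_of_nonneg h] at j1 j2 j5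
      cases b
      · exact (mem_base_false z).2 ⟨h, j1.le, j2.le⟩
      · exact (mem_base_true z).2 ⟨j3.le, j4.le, h, j5.le⟩
    rcases le_total 0 z.im with h | h
    · exact Or.inl (hb b z h i1 i2 i3 i4 i5)
    · refine Or.inr ⟨(starRingEnd ℂ) z, hb b' _ ?_ ?_ ?_ ?_ ?_ ?_, by simp⟩ <;> simpa

theorem image_interior_base (μ : ℂˣ) (ν : ℂ) (b : Bool) :
    (fun z : ℂ => μ * z + ν) '' interior (base b) = interior (simBase μ ν b) :=
  ((Homeomorph.mulLeft₀ (μ : ℂ) μ.ne_zero).trans (Homeomorph.addRight ν)).image_interior _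

theorem interior_simBase_nonempty (μ : ℂˣ) (ν : ℂ) (b : Bool) :
    (interior (simBase μ ν b)).Nonempty := by
  rw [← image_interior_base]
  exact ⟨_, mem_image_of_mem _ (half_mem_interior b)⟩

theorem continuous_horosphere : Continuous horosphere :=
  Continuous.subtype_mk (continuous_id.prodMk continuous_const) _

theorem preimage_horosphere {μ : ℂˣ} {ν : ℂ} {b : Bool} (hμ : ‖(μ : ℂ)‖ = 1) :
    horosphere ⁻¹' (sim μ ν '' std b) = simBase μ ν b := by
  ext z
  exact mem_sim_image_iff (p := horosphere z) (by rw [hμ]; simp [horosphere]; norm_num)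

/-- The vertical tiles with polygons of side length one. -/
def unitTiles (𝒟 : Set (Set HypSpace)) : Set (Set HypSpace) :=
  {U | U ∈ 𝒟 ∧ ∃ (μ : ℂˣ) (ν : ℂ) (b : Bool), ‖(μ : ℂ)‖ = 1 ∧ U = sim μ ν '' std b}

theorem one_zero_mem_unitTiles {𝒟 : Set (Set HypSpace)} {b : Bool} (hb : std b ∈ 𝒟) :
    std b ∈ unitTiles 𝒟 :=
  ⟨hb, 1, 0, b, by simp, by rw [sim_one_zero, image_one]⟩

/-- Across the interior of each side lies, by `IsTiling.exists_neighbour`, another vertical tile of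
side one. The two polygons together fill a neighbourhood, so only corners can fail to be interior
points of the union. -/
theorem IsTiling.mem_interior_or_extreme {𝒟 : Set (Set HypSpace)} (h𝒟 : IsTiling 𝒟)
    {U : Set HypSpace} (hU : U ∈ unitTiles 𝒟) {z : ℂ} (hz : z ∈ horosphere ⁻¹' U) :
    z ∈ interior (⋃ V ∈ unitTiles 𝒟, horosphere ⁻¹' V) ∨
      z ∈ extremePoints ℝ (horosphere ⁻¹' U) := by
  have hU' := hU
  obtain ⟨hUD, μ, ν, b, hμ, rfl⟩ := hU
  have hsl := preimage_horosphere (ν := ν) (b := b) hμ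
  rw [hsl] at hz ⊢
  obtain ⟨w, hw, rfl⟩ := hz
  by_cases hc : w ∈ corners b
  · right
    rw [extremePoints_simBase]
    exact mem_image_of_mem _ hc
  left
  rcases mem_interior_or_side hw hc with hi | hi
  · have h1 : (μ : ℂ) * w + ν ∈ interior (simBase μ ν b) := by
      rw [← image_interior_base]; exact mem_image_of_mem _ hi
    refine interior_mono ?_ h1
    rw [← hsl]
    exact subset_biUnion_of_mem (u := fun V => horosphere ⁻¹' V) hU'
  · obtain ⟨μ', ν', x, e1, e2, e3, h0, h1⟩ := hi μ ν
    have hμ' : ‖(μ' : ℂ)‖ = 1 := e1.trans hμ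
    simp only
    rw [← e3]
    have hstd : std b ∈ push (sim μ' ν')⁻¹ 𝒟 := by
      rw [mem_push, inv_inv, e2]; exact hUD
    obtain ⟨b', hb'⟩ := (isTiling_push (isom.inv_mem (sim_mem_isom μ' ν')) h𝒟).exists_neighbour hstd
    rw [mem_push, inv_inv, refl_image_std, ← image_mul, sim_mul] at hb'
    have hn : ‖((μ' * -1 : ℂˣ) : ℂ)‖ = 1 := by simpa using hμ'
    have hV : sim (μ' * -1) (μ' * 1 + ν') '' std b' ∈ unitTiles 𝒟 := ⟨hb', _, _, _, hn, rfl⟩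
    rw [← e2] at hU'
    let e : ℂ ≃ₜ ℂ := (Homeomorph.mulLeft₀ (μ' : ℂ) μ'.ne_zero).trans (Homeomorph.addRight ν')
    have hnhds := (e.isOpenMap.image_mem_nhds (base_union_mem_nhds b b' h0 h1) :
      e '' _ ∈ 𝓝 (e (x : ℂ)))
    refine mem_interior_iff_mem_nhds.2 (mem_of_superset hnhds ?_)
    rw [image_union]
    refine union_subset ?_ ?_
    · have : e '' base b = horosphere ⁻¹' (sim μ' ν' '' std b) :=
        (preimage_horosphere (ν := ν') (b := b) hμ').symm
      rw [this]
      exact subset_biUnion_of_mem (u := fun V => horosphere ⁻¹' V) hU'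
    · refine Subset.trans ?_ (subset_biUnion_of_mem (u := fun V => horosphere ⁻¹' V) hV)
      rw [preimage_horosphere hn]
      rintro _ ⟨_, ⟨v, hv, rfl⟩, rfl⟩
      refine ⟨1 - (starRingEnd ℂ) v, ?_, ?_⟩
      · have := flip_mem_base b' v
        rwa [this]
      · simp only [e, Homeomorph.trans_apply, Homeomorph.coe_mulLeft₀, Homeomorph.coe_addRight,
          Units.val_mul, Units.val_neg, Units.val_one]
        ring

/-- The union of the unit polygons is closed and, away from the countable set of their corners,
open. The plane minus a countable set is connected and dense, so nothing is left out. -/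
theorem IsTiling.cover {𝒟 : Set (Set HypSpace)} (h𝒟 : IsTiling 𝒟) {b : Bool} (hb : std b ∈ 𝒟) :
    ⋃ V ∈ unitTiles 𝒟, horosphere ⁻¹' V = univ := by
  set S := ⋃ V ∈ unitTiles 𝒟, horosphere ⁻¹' V with hS
  have hlf : LocallyFinite fun V : unitTiles 𝒟 => horosphere ⁻¹' (V : Set HypSpace) := by
    have h1 := h𝒟.locallyFinite.preimage_continuous continuous_horosphere
    let f : unitTiles 𝒟 → 𝒟 := fun V => ⟨V.1, V.2.1⟩
    have hf : Function.Injective f := fun V W h =>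
      Subtype.ext (congrArg (Subtype.val : 𝒟 → Set HypSpace) h)
    exact h1.comp_injective hf
  have hSi : S = ⋃ V : unitTiles 𝒟, horosphere ⁻¹' (V : Set HypSpace) := biUnion_eq_iUnion _ _
  have hclosed : IsClosed S := by
    rw [hSi]
    exact hlf.isClosed_iUnion fun V =>
      (isClosed_tile h𝒟 V.2.1).preimage continuous_horosphere
  have hcount : (unitTiles 𝒟).Countable := by
    have := hlf.countable_univ (fun V => by
      obtain ⟨V, hV, μ, ν, b, hμ, rfl⟩ := V
      rw [preimage_horosphere hμ]
      exact (interior_simBase_nonempty μ ν b).mono interior_subset)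
    exact countable_univ_iff.1 this
  set W := ⋃ V ∈ unitTiles 𝒟, extremePoints ℝ (horosphere ⁻¹' V) with hW
  have hWc : W.Countable := by
    refine hcount.biUnion fun V hV => ?_
    obtain ⟨hV, μ, ν, b, hμ, rfl⟩ := hV
    rw [preimage_horosphere hμ, extremePoints_simBase]
    exact ((finite_corners b).image _).countable
  have hconn : IsPreconnected Wᶜ := by
    refine (hWc.isPathConnected_compl_of_one_lt_rank ?_).isConnected.isPreconnected
    rw [Complex.rank_real_complex]
    exact Nat.one_lt_ofNat
  have hdense : Dense Wᶜ := hWc.dense_compl ℝ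
  by_contra hne
  have hne' : (Sᶜ).Nonempty := by
    rw [nonempty_compl]; exact hne
  have hint : (interior S).Nonempty := by
    have h1 := one_zero_mem_unitTiles hb
    have h2 : horosphere ⁻¹' std b ⊆ S := subset_biUnion_of_mem (u := fun V => horosphere ⁻¹' V) h1
    refine Nonempty.mono (interior_mono h2) ?_
    have := preimage_horosphere (μ := 1) (ν := 0) (b := b) (by simp)
    rw [sim_one_zero, image_one] at this
    rw [this]
    exact interior_simBase_nonempty 1 0 b
  obtain ⟨z, hz, hz'⟩ := hconn (interior S) Sᶜ isOpen_interior hclosed.isOpen_compl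
    (fun z hz => by
      by_cases hzS : z ∈ S
      · left
        obtain ⟨V, hV, hzV⟩ := mem_iUnion₂.1 hzS
        refine (h𝒟.mem_interior_or_extreme hV hzV).resolve_right fun h => hz ?_
        exact mem_biUnion hV h
      · exact Or.inr hzS)
    (by rw [inter_comm]; exact hdense.inter_open_nonempty _ isOpen_interior hint)
    (by rw [inter_comm]; exact hdense.inter_open_nonempty _ hclosed.isOpen_compl hne')
  exact hz'.2 (interior_subset hz'.1)

/-- Each polygon is the closure of its interior. Hence the covering yields overlaps of interiors, to
which `IsTiling.eq_of_mem_interior` applies. -/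
theorem IsTiling.exists_unitTile {𝒟 : Set (Set HypSpace)} (h𝒟 : IsTiling 𝒟) {b : Bool}
    (hb : std b ∈ 𝒟) {O : Set ℂ} (hO : IsOpen O) (hne : O.Nonempty) :
    ∃ (μ : ℂˣ) (ν : ℂ) (b' : Bool), ‖(μ : ℂ)‖ = 1 ∧ sim μ ν '' std b' ∈ 𝒟 ∧
      (O ∩ interior (simBase μ ν b')).Nonempty := by
  obtain ⟨z, hz⟩ := hne
  have : z ∈ ⋃ V ∈ unitTiles 𝒟, horosphere ⁻¹' V := by rw [h𝒟.cover hb]; trivial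
  obtain ⟨V, ⟨hV, μ, ν, b', hμ, rfl⟩, hzV⟩ := mem_iUnion₂.1 this
  rw [preimage_horosphere hμ] at hzV
  refine ⟨μ, ν, b', hμ, hV, ?_⟩
  have hconv : Convex ℝ (simBase μ ν b') := by
    rw [simBase_eq]; exact convex_convexHull _ _
  have hcl := hconv.closure_interior_eq_closure_of_nonempty_interior
    (interior_simBase_nonempty μ ν b')
  have : z ∈ closure (interior (simBase μ ν b')) := by
    rw [hcl]; exact subset_closure hzV
  exact mem_closure_iff.1 this O hO hz

/-- All vertical tiles have the same size. -/
theorem IsTiling.norm_eq_one {𝒟 : Set (Set HypSpace)} (h𝒟 : IsTiling 𝒟) {b b' : Bool}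
    (hb : std b ∈ 𝒟) {μ : ℂˣ} {ν : ℂ} (h : sim μ ν '' std b' ∈ 𝒟) : ‖(μ : ℂ)‖ = 1 := by
  obtain ⟨μ₁, ν₁, b₁, h1, h2, z, hz, hz'⟩ :=
    h𝒟.exists_unitTile hb isOpen_interior (interior_simBase_nonempty μ ν b')
  have hμ : 0 < ‖(μ : ℂ)‖ := norm_pos_iff.2 μ.ne_zero
  -- At height `‖μ‖ + 1` both tiles are full vertical prisms, so overlapping polygons mean
  -- overlapping tiles.
  have i1 := mem_interior_sim_image (p := pt z (‖(μ : ℂ)‖ + 1) (by positivity))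
    (by simp only [pt]; linarith) hz
  have i2 := mem_interior_sim_image (p := pt z (‖(μ : ℂ)‖ + 1) (by positivity))
    (by simp only [pt]; linarith) hz'
  have e := h𝒟.eq_of_mem_interior h h2 i1 (interior_subset i2)
  rw [(simBase_eq_iff (sim_image_eq_iff e)).2, h1]

/-- A tile whose horospherical section has non-empty interior is vertical. -/
theorem IsTiling.exists_eq_sim {𝒟 : Set (Set HypSpace)} (h𝒟 : IsTiling 𝒟) {b : Bool}
    (hb : std b ∈ 𝒟) {P : Set HypSpace} (hP : P ∈ 𝒟)
    (hne : (interior (horosphere ⁻¹' P)).Nonempty) :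
    ∃ (μ : ℂˣ) (ν : ℂ) (b' : Bool), ‖(μ : ℂ)‖ = 1 ∧ P = sim μ ν '' std b' := by
  obtain ⟨μ, ν, b', h1, h2, z, hz, hz'⟩ := h𝒟.exists_unitTile hb isOpen_interior hne
  refine ⟨μ, ν, b', h1, ?_⟩
  have i2 := mem_interior_sim_image (p := horosphere z) (by rw [h1]; exact le_rfl) hz'
  exact (h𝒟.eq_of_mem_interior h2 hP i2 (interior_subset hz :)).symm

/-! ### Groups acting on a tiling -/

/-- The permutations in `Γ` preserve `𝒟`, with finitely many orbits of tiles. -/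
def IsCofinite (Γ : Subgroup (Equiv.Perm HypSpace)) (𝒟 : Set (Set HypSpace)) : Prop :=
  (∀ γ ∈ Γ, ∀ P ∈ 𝒟, γ '' P ∈ 𝒟) ∧
    ∃ T : Set (Set HypSpace), T.Finite ∧ ∀ P ∈ 𝒟, ∃ Q ∈ T, ∃ γ ∈ Γ, P = γ '' Q

theorem exists_representatives {Γ : Subgroup (Equiv.Perm HypSpace)} {S : Set (Set HypSpace)}
    (h : (tileOrbits Γ S).Finite) :
    ∃ T : Set (Set HypSpace), T.Finite ∧ ∀ P ∈ S, ∃ Q ∈ T, ∃ γ ∈ Γ, P = γ '' Q := by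
  classical
  -- The default `∅` is never reached, since an orbit contains the tile that defines it.
  let f : Set (Set HypSpace) → Set HypSpace := fun O => if hO : O.Nonempty then hO.some else ∅
  refine ⟨f '' tileOrbits Γ S, h.image f, fun P hP => ?_⟩
  have hO : {Q | ∃ γ ∈ Γ, Q = γ '' P} ∈ tileOrbits Γ S := ⟨P, hP, rfl⟩
  have hne : {Q | ∃ γ ∈ Γ, Q = γ '' P}.Nonempty := ⟨P, 1, Γ.one_mem, (image_one P).symm⟩
  refine ⟨_, mem_image_of_mem f hO, ?_⟩
  have hf : f {Q | ∃ γ ∈ Γ, Q = γ '' P} = hne.some := dif_pos hne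
  obtain ⟨γ, hγ, e⟩ := hne.some_mem
  rw [hf, e]
  exact ⟨γ⁻¹, Γ.inv_mem hγ, (inv_image_image γ P).symm⟩

theorem IsMixedPlatonicTiling.isCofinite {Γ : Subgroup (Equiv.Perm HypSpace)}
    {𝒟 : Set (Set HypSpace)} (h : IsMixedPlatonicTiling Γ 𝒟) : IsCofinite Γ 𝒟 := by
  obtain ⟨T₁, f₁, h₁⟩ := exists_representatives h.finite_tetrahedra
  obtain ⟨T₂, f₂, h₂⟩ := exists_representatives h.finite_octahedra
  refine ⟨h.invariant, T₁ ∪ T₂, f₁.union f₂, fun P hP => ?_⟩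
  rcases h.isTiling.tiles P hP with ht | ht
  · obtain ⟨Q, hQ, hγ⟩ := h₁ P ⟨hP, ht⟩
    exact ⟨Q, Or.inl hQ, hγ⟩
  · obtain ⟨Q, hQ, hγ⟩ := h₂ P ⟨hP, ht⟩
    exact ⟨Q, Or.inr hQ, hγ⟩

/-- Only the identity of `Γ` has a fixed point in hyperbolic space. -/
def ActsFreely (Γ : Subgroup (Equiv.Perm HypSpace)) : Prop := ∀ γ ∈ Γ, ∀ p, γ p = p → γ = 1

/-- The conjugate subgroup. -/
abbrev conjGroup (ψ : Equiv.Perm HypSpace) (Γ : Subgroup (Equiv.Perm HypSpace)) :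
    Subgroup (Equiv.Perm HypSpace) := Γ.map (MulAut.conj ψ).toMonoidHom

theorem mem_conjGroup {ψ γ : Equiv.Perm HypSpace} {Γ : Subgroup (Equiv.Perm HypSpace)} :
    γ ∈ conjGroup ψ Γ ↔ ∃ δ ∈ Γ, ψ * δ * ψ⁻¹ = γ := by
  simp [conjGroup, Subgroup.mem_map]

theorem conjGroup_le_isom {ψ : Equiv.Perm HypSpace} {Γ : Subgroup (Equiv.Perm HypSpace)}
    (hψ : ψ ∈ isom) (h : Γ ≤ isom) : conjGroup ψ Γ ≤ isom := by
  intro γ hγ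
  obtain ⟨δ, hδ, rfl⟩ := mem_conjGroup.1 hγ
  exact isom.mul_mem (isom.mul_mem hψ (h hδ)) (isom.inv_mem hψ)

theorem ActsFreely.conj {Γ : Subgroup (Equiv.Perm HypSpace)} (h : ActsFreely Γ)
    (ψ : Equiv.Perm HypSpace) : ActsFreely (conjGroup ψ Γ) := by
  intro γ hγ p hp
  obtain ⟨δ, hδ, rfl⟩ := mem_conjGroup.1 hγ
  have : δ (ψ⁻¹ p) = ψ⁻¹ p := by
    have := congrArg (ψ⁻¹ : Equiv.Perm HypSpace) hp
    simpa [Equiv.Perm.mul_apply] using this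
  rw [h δ hδ _ this]
  simp

theorem IsCofinite.conj {Γ : Subgroup (Equiv.Perm HypSpace)} {𝒟 : Set (Set HypSpace)}
    (h : IsCofinite Γ 𝒟) (ψ : Equiv.Perm HypSpace) : IsCofinite (conjGroup ψ Γ) (push ψ 𝒟) := by
  obtain ⟨h1, T, hT, h2⟩ := h
  refine ⟨?_, push ψ T, hT.image _, ?_⟩
  · rintro γ hγ _ ⟨P, hP, rfl⟩
    obtain ⟨δ, hδ, rfl⟩ := mem_conjGroup.1 hγ
    refine ⟨δ '' P, h1 δ hδ P hP, ?_⟩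
    simp only [← image_mul, inv_mul_cancel_right]
  · rintro _ ⟨P, hP, rfl⟩
    obtain ⟨Q, hQ, γ, hγ, rfl⟩ := h2 P hP
    refine ⟨_, image_mem_push.2 hQ, ψ * γ * ψ⁻¹, mem_conjGroup.2 ⟨γ, hγ, rfl⟩, ?_⟩
    simp only [← image_mul, inv_mul_cancel_right]

theorem IsParabolic.conj {γ ψ : Equiv.Perm HypSpace} (hψ : ψ ∈ isom) (h : IsParabolic γ) :
    IsParabolic (ψ * γ * ψ⁻¹) := by
  obtain ⟨h1, h2, ξ, h3, h4⟩ := h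
  refine ⟨isom.mul_mem (isom.mul_mem hψ h1) (isom.inv_mem hψ), fun p hp => ?_, ?_⟩
  · refine h2 (ψ⁻¹ p) ?_
    have := congrArg (ψ⁻¹ : Equiv.Perm HypSpace) hp
    simpa [Equiv.Perm.mul_apply] using this
  · obtain ⟨η, hη⟩ := exists_mapsIdeal hψ ξ
    refine ⟨η, (hη.comp h3).comp (hη.inv hψ), fun ζ hζ => ?_⟩
    obtain ⟨ζ', hζ'⟩ := exists_mapsIdeal (isom.inv_mem hψ) ζ
    have h5 := hζ'.inv (isom.inv_mem hψ)
    rw [inv_inv] at h5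
    have h6 := (hζ'.comp hζ).comp h5
    have e : ψ⁻¹ * (ψ * γ * ψ⁻¹) * ψ = γ := by group
    rw [e] at h6
    rw [h4 ζ' h6] at h5
    exact h5.unique hη

theorem mem_parabolicPoints_conj {Γ : Subgroup (Equiv.Perm HypSpace)} {ψ : Equiv.Perm HypSpace}
    (hψ : ψ ∈ isom) {ξ η : OnePoint ℂ} (h : MapsIdeal ψ ξ η) :
    η ∈ parabolicPoints (conjGroup ψ Γ) ↔ ξ ∈ parabolicPoints Γ := by
  constructor
  · rintro ⟨γ, hγ, h1, h2⟩
    obtain ⟨δ, hδ, rfl⟩ := mem_conjGroup.1 hγ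
    have e : ψ⁻¹ * (ψ * δ * ψ⁻¹) * ψ = δ := by group
    have h3 := h1.conj (isom.inv_mem hψ)
    rw [inv_inv, e] at h3
    have h4 := ((h.inv hψ).comp h2).comp h
    rw [e] at h4
    exact ⟨δ, hδ, h3, h4⟩
  · rintro ⟨γ, hγ, h1, h2⟩
    exact ⟨ψ * γ * ψ⁻¹, mem_conjGroup.2 ⟨γ, hγ, rfl⟩, h1.conj hψ, (h.comp h2).comp (h.inv hψ)⟩

theorem IsOneCusped.conj {Γ : Subgroup (Equiv.Perm HypSpace)} {ψ : Equiv.Perm HypSpace}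
    (hψ : ψ ∈ isom) (h : IsOneCusped Γ) : IsOneCusped (conjGroup ψ Γ) := by
  obtain ⟨⟨ξ, hξ⟩, h2⟩ := h
  refine ⟨?_, fun ξ hξ η hη => ?_⟩
  · obtain ⟨η, hη⟩ := exists_mapsIdeal hψ ξ
    exact ⟨η, (mem_parabolicPoints_conj hψ hη).2 hξ⟩
  · obtain ⟨ξ', hξ'⟩ := exists_mapsIdeal (isom.inv_mem hψ) ξ
    obtain ⟨η', hη'⟩ := exists_mapsIdeal (isom.inv_mem hψ) η
    have h3 := hξ'.inv (isom.inv_mem hψ)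
    have h4 := hη'.inv (isom.inv_mem hψ)
    rw [inv_inv] at h3 h4
    obtain ⟨γ, hγ, h5⟩ := h2 ξ' ((mem_parabolicPoints_conj hψ h3).1 hξ) η'
      ((mem_parabolicPoints_conj hψ h4).1 hη)
    exact ⟨ψ * γ * ψ⁻¹, mem_conjGroup.2 ⟨γ, hγ, rfl⟩, (h4.comp h5).comp hξ'⟩

/-! ### Ideal vertices of tiles are parabolic points -/

theorem finite_idealVertices_std (b : Bool) : (idealVertices (std b)).Finite := by
  have hf : (finiteVertices b).Finite := by
    cases b
    · exact finite_corners false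
    · exact (finite_corners true).insert _
  refine ((hf.image ((↑) : ℂ → OnePoint ℂ)).insert OnePoint.infty).subset fun ξ hξ => ?_
  induction ξ using OnePoint.rec with
  | infty => exact mem_insert _ _
  | coe v => exact mem_insert_of_mem _ (mem_image_of_mem _ (mem_finiteVertices hξ))

theorem mem_idealVertices_of_image {φ : Equiv.Perm HypSpace} (hφ : φ ∈ isom) {ξ η : OnePoint ℂ}
    (h : MapsIdeal φ ξ η) {P : Set HypSpace} (hη : η ∈ idealVertices (φ '' P)) :
    ξ ∈ idealVertices P := by
  have := mem_idealVertices_image (h.inv hφ) hη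
  rwa [inv_image_image] at this

theorem finite_idealVertices {𝒟 : Set (Set HypSpace)} (h𝒟 : IsTiling 𝒟) {P : Set HypSpace}
    (hP : P ∈ 𝒟) : (idealVertices P).Finite := by
  obtain ⟨b, φ, hφ, rfl⟩ := exists_std h𝒟 hP
  choose f hf using exists_mapsIdeal (isom.inv_mem hφ)
  refine Finite.of_injOn (f := f) (t := idealVertices (std b)) (fun η hη => ?_)
    (fun η _ ζ _ h => ?_) (finite_idealVertices_std b)
  · have := (hf η).inv (isom.inv_mem hφ)
    rw [inv_inv] at this
    exact mem_idealVertices_of_image hφ this hη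
  · have h1 := hf η
    rw [h] at h1
    exact h1.injective (isom.inv_mem hφ) (hf ζ)

/-- Finitely many bounded polygons cannot cover the plane. -/
theorem infinite_unitTiles {𝒟 : Set (Set HypSpace)} (h𝒟 : IsTiling 𝒟) {b : Bool}
    (hb : std b ∈ 𝒟) : (unitTiles 𝒟).Infinite := by
  intro hfin
  have hbd : Bornology.IsBounded (⋃ V ∈ unitTiles 𝒟, horosphere ⁻¹' V) := by
    refine (Bornology.isBounded_biUnion hfin).2 fun V hV => ?_
    obtain ⟨-, μ, ν, b, hμ, rfl⟩ := hV
    rw [preimage_horosphere hμ, simBase_eq, isBounded_convexHull]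
    exact ((finite_corners b).image _).isBounded
  rw [h𝒟.cover hb] at hbd
  exact NormedSpace.unbounded_univ ℝ ℂ hbd

/-- An isometry fixing `∞` is a similarity, possibly preceded by a reflection. -/
theorem eq_sim_of_fixing_infty {φ : Equiv.Perm HypSpace} (hφ : φ ∈ isom)
    (h : MapsIdeal φ OnePoint.infty OnePoint.infty) :
    ∃ μ ν, φ = sim μ ν ∨ φ = sim μ ν * refl := by
  obtain ⟨μ, ν, hμ, ht, hz | hz⟩ := isometry_fixing_infty hφ h
  · exact ⟨Units.mk0 μ hμ, ν, Or.inl (Equiv.ext fun p => Subtype.ext (Prod.ext (hz p) (ht p)))⟩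
  · exact ⟨Units.mk0 μ hμ, ν, Or.inr (Equiv.ext fun p => Subtype.ext (Prod.ext (hz p) (ht p)))⟩

theorem sim_image_of_eq {φ : Equiv.Perm HypSpace} {μ : ℂˣ} {ν : ℂ}
    (h : φ = sim μ ν ∨ φ = sim μ ν * refl) (μ₁ : ℂˣ) (ν₁ : ℂ) (b : Bool) :
    ∃ (μ₂ : ℂˣ) (ν₂ : ℂ), φ '' (sim μ₁ ν₁ '' std b) = sim μ₂ ν₂ '' std b ∧
      ‖(μ₂ : ℂ)‖ = ‖(μ : ℂ)‖ * ‖(μ₁ : ℂ)‖ := by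
  rcases h with rfl | rfl
  · refine ⟨_, _, by rw [← image_mul, sim_mul], by simp⟩
  · have hne : (starRingEnd ℂ) μ₁ ≠ 0 := (map_ne_zero _).2 μ₁.ne_zero
    have e : refl * sim μ₁ ν₁ = sim (Units.mk0 _ hne) ((starRingEnd ℂ) ν₁) * refl := by
      refine Equiv.ext fun p => Subtype.ext (Prod.ext ?_ ?_) <;> simp
    refine ⟨_, _, by rw [← image_mul, mul_assoc, e, image_mul, image_mul, refl_image_std, ← image_mul,
      ← image_mul, mul_assoc, sim_mul, sim_mul], by simp⟩

/-- Send each unit tile to the pair formed by its orbit representative and the ideal vertex of this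
representative that is carried to `∞`. There are infinitely many tiles and finitely many pairs, so
two different tiles share a pair. The resulting element of `Γ` fixes `∞` and takes one tile to the
other. -/
theorem infty_mem_parabolicPoints {Γ : Subgroup (Equiv.Perm HypSpace)} {𝒟 : Set (Set HypSpace)}
    (hΓ : Γ ≤ isom) (hfree : ActsFreely Γ) (h𝒟 : IsTiling 𝒟) (hco : IsCofinite Γ 𝒟) {b : Bool}
    (hb : std b ∈ 𝒟) : OnePoint.infty ∈ parabolicPoints Γ := by
  obtain ⟨hinv, T, hT, hrep⟩ := hco
  have key : ∀ U ∈ unitTiles 𝒟, ∃ (Q : Set HypSpace) (γ : Equiv.Perm HypSpace) (ξ : OnePoint ℂ),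
      Q ∈ T ∧ Q ∈ 𝒟 ∧ γ ∈ Γ ∧ U = γ '' Q ∧ MapsIdeal γ ξ OnePoint.infty ∧ ξ ∈ idealVertices Q := by
    rintro U ⟨hU, μ, ν, b, hμ, e⟩
    obtain ⟨Q, hQ, γ, hγ, rfl⟩ := hrep U hU
    have hQD : Q ∈ 𝒟 := by
      have := hinv γ⁻¹ (Γ.inv_mem hγ) _ hU
      rwa [inv_image_image] at this
    obtain ⟨ξ, hξ⟩ := exists_mapsIdeal (hΓ (Γ.inv_mem hγ)) OnePoint.infty
    have h1 := hξ.inv (hΓ (Γ.inv_mem hγ))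
    rw [inv_inv] at h1
    refine ⟨Q, γ, ξ, hQ, hQD, hγ, rfl, h1, mem_idealVertices_of_image (hΓ hγ) h1 ?_⟩
    rw [e]
    exact mem_idealVertices_image (mapsIdeal_sim_infty μ ν) (infty_mem_idealVertices_std b)
  choose! Q γ ξ hQT hQD hγ hU hξ hv using key
  have hfin : (⋃ Q ∈ T ∩ 𝒟, ({Q} : Set (Set HypSpace)) ×ˢ idealVertices Q).Finite :=
    (hT.inter_of_left 𝒟).biUnion fun Q hQ => (finite_singleton Q).prod (finite_idealVertices h𝒟 hQ.2)
  have hmaps : MapsTo (fun U => (Q U, ξ U)) (unitTiles 𝒟)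
      (⋃ Q ∈ T ∩ 𝒟, ({Q} : Set (Set HypSpace)) ×ˢ idealVertices Q) := fun U hU =>
    mem_iUnion₂.2 ⟨Q U, ⟨hQT U hU, hQD U hU⟩, mk_mem_prod rfl (hv U hU)⟩
  obtain ⟨U, hUm, V, hVm, hne, he⟩ :=
    (infinite_unitTiles h𝒟 hb).exists_ne_map_eq_of_mapsTo hmaps hfin
  simp only [Prod.mk.injEq] at he
  set δ := γ V * (γ U)⁻¹ with hδ
  have hδΓ : δ ∈ Γ := Γ.mul_mem (hγ V hVm) (Γ.inv_mem (hγ U hUm))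
  have hδi : MapsIdeal δ OnePoint.infty OnePoint.infty := by
    have h1 := (hξ U hUm).inv (hΓ (hγ U hUm))
    rw [he.2] at h1
    exact (hξ V hVm).comp h1
  have hδU : δ '' U = V := by
    conv_lhs => rw [hU U hUm, he.1, hδ, image_mul, inv_image_image]
    exact (hU V hVm).symm
  have hfix : ∀ p, δ p ≠ p := by
    intro p hp
    have := hfree δ hδΓ p hp
    rw [this, image_one] at hδU
    exact hne hδU
  obtain ⟨μ, ν, hμν⟩ := eq_sim_of_fixing_infty (hΓ hδΓ) hδi
  -- All vertical tiles have side one, so `δ` cannot rescale: it acts on each horosphere at `∞` by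
  -- the same Euclidean isometry.
  have hμ : ‖(μ : ℂ)‖ = 1 := by
    obtain ⟨hUD, μ₁, ν₁, b₁, hμ₁, e⟩ := hUm
    obtain ⟨μ₂, ν₂, e₂, hμ₂⟩ := sim_image_of_eq hμν μ₁ ν₁ b₁
    rw [← e, hδU] at e₂
    have := h𝒟.norm_eq_one hb (e₂ ▸ hVm.1)
    rw [this, hμ₁, mul_one] at hμ₂
    exact hμ₂.symm
  obtain ⟨g, hg⟩ : ∃ g : ℂ → ℂ, ∀ p, (δ p).1.1 = g p.1.1 := by
    rcases hμν with h | h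
    · exact ⟨fun z => μ * z + ν, fun p => by rw [h]; rfl⟩
    · exact ⟨fun z => μ * (starRingEnd ℂ) z + ν, fun p => by rw [h]; rfl⟩
  have ht : ∀ p, (δ p).1.2 = 1 * p.1.2 := by
    intro p
    rcases hμν with h | h <;> rw [h] <;> simp [hμ]
  refine ⟨δ, hδΓ, ⟨hΓ hδΓ, hfix, OnePoint.infty, hδi, fun ζ hζ => ?_⟩, hδi⟩
  induction ζ using OnePoint.rec with
  | infty => rfl
  | coe v =>
    exfalso
    have h1 := mapsIdeal_of_similar (hΓ hδΓ) hg ht v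
    have h2 := OnePoint.coe_injective (h1.unique hζ)
    -- Heights are preserved, so a fixed finite ideal point would give a fixed point of hyperbolic
    -- space right above it.
    refine hfix (horosphere v) (Subtype.ext (Prod.ext ?_ ?_))
    · rw [hg]; exact h2
    · rw [ht, one_mul]

/-! ### All horospherical sections of a one-cusped tiling are congruent -/

/-- The isometry `z ↦ μ z + ν` of the plane. -/
def planeSim (μ : ℂˣ) (ν : ℂ) (hμ : ‖(μ : ℂ)‖ = 1) : ℂ ≃ᵢ ℂ where
  toEquiv := ⟨fun z => μ * z + ν, fun z => (μ : ℂ)⁻¹ * (z - ν), fun z => by simp, fun z => by simp⟩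
  isometry_toFun := Isometry.of_dist_eq fun z w => by
    change dist ((μ : ℂ) * z + ν) (μ * w + ν) = dist z w
    rw [dist_add_right, Complex.dist_eq, Complex.dist_eq, ← mul_sub, norm_mul, hμ, one_mul]

theorem exists_planeIsometry {φ : Equiv.Perm HypSpace} {μ : ℂˣ} {ν : ℂ}
    (h : φ = sim μ ν ∨ φ = sim μ ν * refl) (hμ : ‖(μ : ℂ)‖ = 1) :
    ∃ g : ℂ ≃ᵢ ℂ, ∀ z, φ (horosphere z) = horosphere (g z) := by
  rcases h with rfl | rfl
  · refine ⟨planeSim μ ν hμ, fun z => Subtype.ext (Prod.ext rfl ?_)⟩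
    simp [horosphere, hμ]
  · refine ⟨Complex.conjLIE.toIsometryEquiv.trans (planeSim μ ν hμ),
      fun z => Subtype.ext (Prod.ext rfl ?_)⟩
    simp [horosphere, hμ]

theorem preimage_horosphere_image {φ : Equiv.Perm HypSpace} {g : ℂ ≃ᵢ ℂ}
    (h : ∀ z, φ (horosphere z) = horosphere (g z)) (P : Set HypSpace) :
    horosphere ⁻¹' (φ '' P) = g '' (horosphere ⁻¹' P) := by
  ext z
  obtain ⟨w, rfl⟩ := g.surjective z
  rw [mem_preimage, ← h, φ.injective.mem_set_image, g.injective.mem_set_image, mem_preimage]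

theorem push_eq_of_invariant {Γ : Subgroup (Equiv.Perm HypSpace)} {𝒟 : Set (Set HypSpace)}
    (hinv : ∀ γ ∈ Γ, ∀ P ∈ 𝒟, γ '' P ∈ 𝒟) {γ : Equiv.Perm HypSpace} (hγ : γ ∈ Γ) :
    push γ 𝒟 = 𝒟 := by
  ext P
  rw [mem_push]
  constructor
  · intro h
    have := hinv γ hγ _ h
    rwa [image_inv_image] at this
  · exact hinv _ (Γ.inv_mem hγ) P

/-- The ideal points `∞` and `ψ⁻¹ ∞` are both parabolic, hence some `γ ∈ Γ` takes the former to the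
latter. Then `ψ * γ` fixes `∞` and still carries `𝒟` to `push ψ 𝒟`, because `γ` preserves `𝒟`. -/
theorem section_push_congruent {Γ : Subgroup (Equiv.Perm HypSpace)} {𝒟 : Set (Set HypSpace)}
    (hΓ : Γ ≤ isom) (hfree : ActsFreely Γ) (hcusp : IsOneCusped Γ) (h𝒟 : IsTiling 𝒟)
    (hco : IsCofinite Γ 𝒟) {b b' : Bool} (hb : std b ∈ 𝒟) {ψ : Equiv.Perm HypSpace}
    (hψ : ψ ∈ isom) (hb' : std b' ∈ push ψ 𝒟) :
    ∃ g : ℂ ≃ᵢ ℂ, horosphericalSection (push ψ 𝒟) = (fun X => g '' X) '' horosphericalSection 𝒟 := by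
  have h1 := infty_mem_parabolicPoints hΓ hfree h𝒟 hco hb
  have h2 := infty_mem_parabolicPoints (conjGroup_le_isom hψ hΓ) (hfree.conj ψ)
    (isTiling_push hψ h𝒟) (hco.conj ψ) hb'
  obtain ⟨ξ, hξ⟩ := exists_mapsIdeal (isom.inv_mem hψ) OnePoint.infty
  have h3 := hξ.inv (isom.inv_mem hψ)
  rw [inv_inv] at h3
  obtain ⟨γ, hγ, h4⟩ := hcusp.2 _ h1 ξ ((mem_parabolicPoints_conj hψ h3).1 h2)
  have hχ : ψ * γ ∈ isom := isom.mul_mem hψ (hΓ hγ)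
  have hpush : push (ψ * γ) 𝒟 = push ψ 𝒟 := by
    rw [push_mul, push_eq_of_invariant hco.1 hγ]
  obtain ⟨μ, ν, hμν⟩ := eq_sim_of_fixing_infty hχ (h3.comp h4)
  -- Both tilings contain a standard tile, so their vertical tiles have the same size and the
  -- similarity has ratio one.
  have hμ : ‖(μ : ℂ)‖ = 1 := by
    obtain ⟨μ₂, ν₂, e₂, hμ₂⟩ := sim_image_of_eq hμν 1 0 b
    rw [sim_one_zero, image_one] at e₂
    have h5 : (ψ * γ) '' std b ∈ push ψ 𝒟 := by rw [← hpush]; exact image_mem_push.2 hb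
    rw [e₂] at h5
    have := (isTiling_push hψ h𝒟).norm_eq_one hb' h5
    rw [this] at hμ₂
    simpa using hμ₂.symm
  obtain ⟨g, hg⟩ := exists_planeIsometry hμν hμ
  refine ⟨g, ?_⟩
  rw [← hpush]
  ext X
  constructor
  · rintro ⟨hne, _, ⟨P, hP, rfl⟩, rfl⟩
    simp only [preimage_horosphere_image hg] at hne ⊢
    exact ⟨_, ⟨hne.of_image, P, hP, rfl⟩, rfl⟩
  · rintro ⟨_, ⟨hne, P, hP, rfl⟩, rfl⟩
    exact ⟨hne.image _, _, image_mem_push.2 hP, (preimage_horosphere_image hg P).symm⟩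

/-! ### The Eisenstein integers and the shadow of a vertex -/

/-- The Eisenstein integers. -/
def eisenstein : AddSubgroup ℂ where
  carrier := {z | ∃ x y : ℤ, z = x + y * omega}
  add_mem' := by
    rintro _ _ ⟨x, y, rfl⟩ ⟨x', y', rfl⟩
    exact ⟨x + x', y + y', by push_cast; ring⟩
  zero_mem' := ⟨0, 0, by simp⟩
  neg_mem' := by
    rintro _ ⟨x, y, rfl⟩
    exact ⟨-x, -y, by push_cast; ring⟩

theorem omega_mul_mem {z : ℂ} (hz : z ∈ eisenstein) : omega * z ∈ eisenstein := by
  obtain ⟨x, y, rfl⟩ := hz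
  refine ⟨-y, x + y, ?_⟩
  push_cast
  linear_combination (y : ℂ) * omega_sq

theorem omega_pow_mem (k : ℕ) : omega ^ k ∈ eisenstein := by
  induction k with
  | zero => exact ⟨1, 0, by simp⟩
  | succ k ih => rw [pow_succ']; exact omega_mul_mem ih

theorem eq_zero_of_add_mul_sqrt_three {x y : ℤ} (h : (x : ℝ) + y * √3 = 0) : x = 0 ∧ y = 0 := by
  have hy : y = 0 := by
    by_contra hy
    have hirr : Irrational ((x : ℝ) + y * √3) :=
      ((Nat.prime_three.irrational_sqrt).intCast_mul hy).intCast_add x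
    rw [h] at hirr
    exact hirr ⟨0, by simp⟩
  subst hy
  simpa using h

/-- That `1` and `i` are independent over `ℤ[ω]` comes down to the irrationality of `√3`, applied to
the real and to the imaginary part. -/
theorem eisenstein_independent {a b : ℂ} (ha : a ∈ eisenstein) (hb : b ∈ eisenstein)
    (h : a + Complex.I * b = 0) : a = 0 ∧ b = 0 := by
  obtain ⟨x, y, rfl⟩ := ha
  obtain ⟨x', y', rfl⟩ := hb
  have hre := congrArg Complex.re h
  have him := congrArg Complex.im h
  simp [omega] at hre him
  have h1 := eq_zero_of_add_mul_sqrt_three (x := 2 * x + y) (y := -y') (by push_cast; linarith)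
  have h2 := eq_zero_of_add_mul_sqrt_three (x := 2 * x' + y') (y := y) (by push_cast; linarith)
  obtain rfl : y = 0 := h2.2
  obtain rfl : y' = 0 := by omega
  obtain rfl : x = 0 := by omega
  obtain rfl : x' = 0 := by omega
  simp

open Classical in
/-- An additive function on `ℤ[ω] + i ℤ[ω]` that vanishes on the translation lattice of the ace
tiling. -/
def shadow (z : ℂ) : ℂ :=
  if h : ∃ q : ℂ × ℂ, q.1 ∈ eisenstein ∧ q.2 ∈ eisenstein ∧ z = q.1 + Complex.I * q.2 then
    2 * h.choose.1 + (1 - 2 * omega) * h.choose.2 else 0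

/-- The decomposition is unique by `eisenstein_independent`, so the choice in the definition is
harmless. On the vertices of the ace tiling the value is `0` at hexagon centres, of modulus `2` at
hexagon corners, and of modulus `1` at the remaining vertices. -/
theorem shadow_add_I_mul {a b : ℂ} (ha : a ∈ eisenstein) (hb : b ∈ eisenstein) :
    shadow (a + Complex.I * b) = 2 * a + (1 - 2 * omega) * b := by
  have h : ∃ q : ℂ × ℂ, q.1 ∈ eisenstein ∧ q.2 ∈ eisenstein ∧
    a + Complex.I * b = q.1 + Complex.I * q.2 := ⟨(a, b), ha, hb, rfl⟩
  rw [shadow, dif_pos h]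
  obtain ⟨h1, h2, h3⟩ := h.choose_spec
  obtain ⟨h4, h5⟩ := eisenstein_independent (eisenstein.sub_mem ha h1) (eisenstein.sub_mem hb h2)
    (by linear_combination h3)
  rw [← sub_eq_zero.1 h4, ← sub_eq_zero.1 h5]

/-- The points of the translation lattice of the ace tiling. -/
def acePeriod (l : ℂ) : ℂ := (2 * omega - 1) * l + Complex.I * (2 * l)

theorem acePeriod_left_mem {l : ℂ} (hl : l ∈ eisenstein) : (2 * omega - 1) * l ∈ eisenstein := by
  have h := omega_mul_mem hl
  have : (2 * omega - 1) * l = omega * l + omega * l - l := by ring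
  rw [this]
  exact eisenstein.sub_mem (eisenstein.add_mem h h) hl

theorem acePeriod_right_mem {l : ℂ} (hl : l ∈ eisenstein) : 2 * l ∈ eisenstein := by
  rw [two_mul]
  exact eisenstein.add_mem hl hl

/-- The period contributes `2 (2ω - 1) l + (1 - 2ω) 2 l = 0`. -/
theorem shadow_acePeriod_add {l a b : ℂ} (hl : l ∈ eisenstein) (ha : a ∈ eisenstein)
    (hb : b ∈ eisenstein) :
    shadow (acePeriod l + (a + Complex.I * b)) = 2 * a + (1 - 2 * omega) * b := by
  have : acePeriod l + (a + Complex.I * b) =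
      ((2 * omega - 1) * l + a) + Complex.I * (2 * l + b) := by rw [acePeriod]; ring
  rw [this, shadow_add_I_mul (eisenstein.add_mem (acePeriod_left_mem hl) ha)
    (eisenstein.add_mem (acePeriod_right_mem hl) hb)]
  ring

theorem shadow_neg_acePeriod_add {l a b : ℂ} (hl : l ∈ eisenstein) (ha : a ∈ eisenstein)
    (hb : b ∈ eisenstein) :
    shadow (-(acePeriod l + (a + Complex.I * b))) = -(2 * a + (1 - 2 * omega) * b) := by
  have : -(acePeriod l + (a + Complex.I * b)) =
      acePeriod (-l) + ((-a) + Complex.I * (-b)) := by simp only [acePeriod]; ring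
  rw [this, shadow_acePeriod_add (eisenstein.neg_mem hl) (eisenstein.neg_mem ha)
    (eisenstein.neg_mem hb)]
  ring

/-- Since `√3 i = 2ω - 1`, the factor `(2 + √3) i` lies in `ℤ[ω] + i ℤ[ω]`. -/
theorem acePoint_eq (m n : ℤ) : acePoint m n = acePeriod (m + n * omega) := by
  have h : (2 * omega - 1 : ℂ) = (√3 : ℝ) * Complex.I := by
    apply Complex.ext <;> simp [omega]; ring
  rw [acePoint, acePeriod, h]
  push_cast
  ring

/-! ### The cells of the ace tiling -/

/-- The poses `z ↦ μ z + ν` of the standard triangle and of the standard square that give the cells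
of the ace tiling around the hexagon centre `p`, in the direction `u`. -/
inductive IsAcePose (p u : ℂ) : Bool → ℂ → ℂ → Prop
  | inner : IsAcePose p u false u p
  | square : IsAcePose p u true u (p + (omega - 1) * u)
  | middle : IsAcePose p u false (Complex.I * u) (p + (omega - 1) * u)
  | outer : IsAcePose p u false (-(Complex.I * u))
      (p + ((omega - 1) * u + Complex.I * ((1 + omega) * u)))

/-- The vertex sets of the triangles (`false`) and of the squares (`true`) of the ace tiling. -/
def IsAceCell (b : Bool) (W : Set ℂ) : Prop :=
  ∃ l ∈ eisenstein, ∃ (k : ℕ) (μ ν : ℂ), IsAcePose (acePeriod l) (omega ^ k) b μ ν ∧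
    W = (fun z => μ * z + ν) '' corners b

theorem mem_aceTiling {X : Set ℂ} :
    X ∈ aceTiling ↔ ∃ b W, IsAceCell b W ∧ X = convexHull ℝ W := by
  have h2 := omega_sq
  have e : ∀ (p : ℂ) (k : ℕ), (fun v => p + v) '' {0, omega ^ k, omega ^ (k + 1)} =
      (fun z => omega ^ k * z + p) '' corners false := by
    intro p k
    simp only [corners, image_insert_eq, image_singleton, pow_succ, mul_zero, add_zero, mul_one, add_comm]
  have e₁ : ∀ (p : ℂ) (k : ℕ), (fun v => p + v) '' {omega ^ (k + 1), omega ^ (k + 2),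
      omega ^ (k + 2) + Complex.I * omega ^ k, omega ^ (k + 1) + Complex.I * omega ^ k} =
      (fun z => omega ^ k * z + (p + (omega - 1) * omega ^ k)) '' corners true := by
    intro p k
    simp only [corners, image_insert_eq, image_singleton, pow_succ]
    rw [insert_comm]
    congr 1
    · linear_combination omega ^ k * h2
    congr 1
    · ring
    rw [pair_comm]
    congr 1
    · ring
    congr 1
    linear_combination omega ^ k * h2
  have e₂ : ∀ (p : ℂ) (k : ℕ), (fun v => p + v) '' {omega ^ (k + 2),
      omega ^ (k + 2) + Complex.I * omega ^ k, omega ^ (k + 2) + Complex.I * omega ^ (k + 1)} =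
      (fun z => (Complex.I * omega ^ k) * z + (p + (omega - 1) * omega ^ k)) '' corners false := by
    intro p k
    simp only [corners, image_insert_eq, image_singleton, pow_succ]
    congr 1
    · linear_combination omega ^ k * h2
    congr 1
    · linear_combination omega ^ k * h2
    congr 1
    linear_combination omega ^ k * h2
  have e₃ : ∀ (p : ℂ) (k : ℕ), (fun v => p + v) '' {omega ^ (k + 2) + Complex.I * omega ^ k,
      omega ^ (k + 2) + Complex.I * omega ^ (k + 1),
      omega ^ (k + 2) + Complex.I * omega ^ k + Complex.I * omega ^ (k + 1)} =
      (fun z => (-(Complex.I * omega ^ k)) * z + (p + ((omega - 1) * omega ^ k +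
        Complex.I * ((1 + omega) * omega ^ k)))) '' corners false := by
    intro p k
    simp only [corners, image_insert_eq, image_singleton, pow_succ]
    rw [pair_comm, insert_comm]
    congr 1
    · linear_combination omega ^ k * h2
    rw [pair_comm]
    congr 1
    · linear_combination omega ^ k * h2
    congr 1
    linear_combination omega ^ k * h2
  constructor
  · rintro ⟨m, n, k, V, hV, rfl⟩
    have hl : (m + n * omega : ℂ) ∈ eisenstein := ⟨m, n, rfl⟩
    rw [acePoint_eq]
    simp only [aceVertexSets, mem_insert_iff, mem_singleton_iff] at hV
    rcases hV with rfl | rfl | rfl | rfl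
    · exact ⟨false, _, ⟨_, hl, k, _, _, .inner, rfl⟩, by rw [e]⟩
    · exact ⟨true, _, ⟨_, hl, k, _, _, .square, rfl⟩, by rw [e₁]⟩
    · exact ⟨false, _, ⟨_, hl, k, _, _, .middle, rfl⟩, by rw [e₂]⟩
    · exact ⟨false, _, ⟨_, hl, k, _, _, .outer, rfl⟩, by rw [e₃]⟩
  · rintro ⟨b, W, ⟨l, ⟨m, n, rfl⟩, k, μ, ν, hp, rfl⟩, rfl⟩
    rw [← acePoint_eq] at hp
    cases hp with
    | inner => exact ⟨m, n, k, _, by simp [aceVertexSets], congrArg _ (e _ _).symm⟩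
    | square => exact ⟨m, n, k, _, .inr (.inl rfl), congrArg _ (e₁ _ _).symm⟩
    | middle => exact ⟨m, n, k, _, .inr (.inr (.inl rfl)), congrArg _ (e₂ _ _).symm⟩
    | outer => exact ⟨m, n, k, _, .inr (.inr (.inr rfl)), congrArg _ (e₃ _ _).symm⟩

theorem norm_omega_pow (k : ℕ) : ‖omega ^ k‖ = 1 := by rw [norm_pow, norm_omega, one_pow]

theorem IsAceCell.exists_pose {b : Bool} {W : Set ℂ} (h : IsAceCell b W) :
    ∃ (μ : ℂˣ) (ν : ℂ), ‖(μ : ℂ)‖ = 1 ∧ W = simCorners μ ν b := by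
  obtain ⟨l, -, k, μ, ν, hp, rfl⟩ := h
  have hμ : ‖μ‖ = 1 := by cases hp <;> simp [norm_omega]
  exact ⟨Units.mk0 μ (norm_ne_zero_iff.1 (by rw [hμ]; exact one_ne_zero)), ν, hμ, rfl⟩

/-! ### Squares -/

theorem isAceCell_square {l : ℂ} (hl : l ∈ eisenstein) (k : ℕ) :
    IsAceCell true ((fun z => omega ^ k * z + (acePeriod l + (omega - 1) * omega ^ k)) ''
      corners true) := ⟨l, hl, k, _, _, .square, rfl⟩

/-- The four corners of a square of the ace tiling, with their shadows. -/
theorem IsAceCell.square_cases {W : Set ℂ} (h : IsAceCell true W) :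
    ∃ u a : ℂ, ‖u‖ = 1 ∧ W = {a - u, a, a + Complex.I * u, a - u + Complex.I * u} ∧
      shadow (a - u) = 2 * (omega - 1) * u ∧ shadow a = 2 * omega * u ∧
      shadow (a + Complex.I * u) = u ∧ shadow (a - u + Complex.I * u) = -u ∧
      shadow (-a) = -(2 * omega * u) := by
  obtain ⟨l, hl, k, μ, ν, hp, rfl⟩ := h
  cases hp
  have hn := norm_omega_pow k
  have hu := omega_pow_mem k
  have hwu := omega_mul_mem hu
  have h0 := eisenstein.zero_mem
  have hd : omega * omega ^ k - omega ^ k ∈ eisenstein := eisenstein.sub_mem hwu hu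
  generalize omega ^ k = u at *
  have e₁ : acePeriod l + omega * u - u = acePeriod l + ((omega * u - u) + Complex.I * 0) := by ring
  have e₂ : acePeriod l + omega * u = acePeriod l + (omega * u + Complex.I * 0) := by ring
  have e₃ : acePeriod l + omega * u + Complex.I * u =
    acePeriod l + (omega * u + Complex.I * u) := by ring
  have e₄ : acePeriod l + omega * u - u + Complex.I * u =
    acePeriod l + ((omega * u - u) + Complex.I * u) := by ring
  refine ⟨u, acePeriod l + omega * u, hn, ?_, ?_, ?_, ?_, ?_, ?_⟩
  · simp only [corners, image_insert_eq, image_singleton]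
    congr 1
    · ring
    congr 1
    · ring
    congr 1
    · ring
    congr 1
    ring
  · rw [e₁, shadow_acePeriod_add hl hd h0]; ring
  · rw [e₂, shadow_acePeriod_add hl hwu h0]; ring
  · rw [e₃, shadow_acePeriod_add hl hwu hu]; ring
  · rw [e₄, shadow_acePeriod_add hl hd hu]; ring
  · rw [e₂, shadow_neg_acePeriod_add hl hwu h0]; ring

theorem norm_omega_sub_one : ‖omega - 1‖ = 1 := by
  rw [← omega_sq, norm_pow, norm_omega, one_pow]

theorem shadow_ne_zero {W : Set ℂ} (h : IsAceCell true W) {v : ℂ} (hv : v ∈ W) :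
    shadow v ≠ 0 := by
  obtain ⟨u, a, hu, rfl, h1, h2, h3, h4, -⟩ := h.square_cases
  rw [← norm_pos_iff]
  simp only [mem_insert_iff, mem_singleton_iff] at hv
  rcases hv with rfl | rfl | rfl | rfl <;>
    simp [h1, h2, h3, h4, hu, norm_omega, norm_omega_sub_one]

/-- Two corners of a square are corners of its hexagon, with shadows of modulus `2`; the two others
have shadows `u` and `-u`. -/
theorem shadow_add_eq_zero {W : Set ℂ} (h : IsAceCell true W) {v w : ℂ} (hv : v ∈ W) (hw : w ∈ W)
    (hvw : v ≠ w) (hv1 : ‖shadow v‖ = 1) (hw1 : ‖shadow w‖ = 1) : shadow v + shadow w = 0 := by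
  obtain ⟨u, a, hu, rfl, h1, h2, h3, h4, -⟩ := h.square_cases
  have key : ∀ z ∈ ({a - u, a, a + Complex.I * u, a - u + Complex.I * u} : Set ℂ),
      ‖shadow z‖ = 1 → z = a + Complex.I * u ∨ z = a - u + Complex.I * u := by
    intro z hz hz1
    simp only [mem_insert_iff, mem_singleton_iff] at hz
    rcases hz with rfl | rfl | rfl | rfl
    · simp [h1, hu, norm_omega_sub_one] at hz1
    · simp [h2, hu, norm_omega] at hz1
    · exact .inl rfl
    · exact .inr rfl
  rcases key v hv hv1 with rfl | rfl <;> rcases key w hw hw1 with rfl | rfl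
  · exact absurd rfl hvw
  · rw [h3, h4]; ring
  · rw [h3, h4]; ring
  · exact absurd rfl hvw

/-- The origin is not the centre of a square of the ace tiling. -/
theorem not_centre {W : Set ℂ} (h : IsAceCell true W) {r : ℝ} (hr : ∀ w ∈ W, ‖w‖ = r) : False := by
  obtain ⟨u, a, hu, rfl, h1, h2, h3, h4, h5⟩ := h.square_cases
  have r1 := congrArg (· ^ 2) (hr (a - u) (by simp))
  have r2 := congrArg (· ^ 2) (hr a (by simp))
  have r3 := congrArg (· ^ 2) (hr (a + Complex.I * u) (by simp))
  have hu2 : ‖u‖ ^ 2 = 1 := by rw [hu, one_pow]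
  simp only [sq_norm_eq] at r1 r2 r3 hu2
  simp at r1 r2 r3
  have p1 : a.re * u.re + a.im * u.im = 1 / 2 := by linear_combination (r2 - r1 + hu2) / 2
  have p2 : a.re * u.im - a.im * u.re = 1 / 2 := by linear_combination (r2 - r3 + hu2) / 2
  -- If the origin is the centre, the corner opposite to `a` is `-a`. But the shadow is odd, while
  -- opposite corners have shadows of moduli `2` and `1`.
  have e : -a = a - u + Complex.I * u := by
    apply Complex.ext
    · simp
      linear_combination 2 * a.re * hu2 - 2 * u.re * p1 - 2 * u.im * p2
    · simp
      linear_combination 2 * a.im * hu2 - 2 * u.im * p1 + 2 * u.re * p2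
  rw [e, h4] at h5
  have := congrArg norm h5
  simp [hu, norm_omega] at this

/-! ### Triangles -/

/-- The three kinds of triangles of the ace tiling. -/
theorem IsAceCell.triangle_cases {W : Set ℂ} (h : IsAceCell false W) :
    ∃ a b c, W = {a, b, c} ∧
      ((shadow a = 0 ∧ ‖shadow b‖ = 2 ∧ ‖shadow c‖ = 2 ∧ ∃ Q, IsAceCell true Q ∧ b ∈ Q ∧ c ∈ Q) ∨
      (∃ u, ‖u‖ = 1 ∧ a = b - Complex.I * u ∧ ‖shadow a‖ = 2 ∧ shadow b = -u ∧
        shadow c = omega * u ∧ (∃ Q, IsAceCell true Q ∧ a ∈ Q) ∧ (∃ Q, IsAceCell true Q ∧ b ∈ Q) ∧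
        ∃ Q, IsAceCell true Q ∧ c ∈ Q) ∨
      (∃ u, ‖u‖ = 1 ∧ shadow a = (1 - omega) * u ∧ shadow b = omega * u ∧ shadow c = -u ∧
        (∃ Q, IsAceCell true Q ∧ a ∈ Q) ∧ (∃ Q, IsAceCell true Q ∧ b ∈ Q) ∧
        ∃ Q, IsAceCell true Q ∧ c ∈ Q)) := by
  obtain ⟨l, hl, k, μ, ν, hp, rfl⟩ := h
  have hw := omega_sq
  have hn := norm_omega_pow k
  have hu := omega_pow_mem k
  have hwu := omega_mul_mem hu
  have h0 := eisenstein.zero_mem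
  have hd : omega * omega ^ k - omega ^ k ∈ eisenstein := eisenstein.sub_mem hwu hu
  have hs : omega ^ k + omega * omega ^ k ∈ eisenstein := eisenstein.add_mem hu hwu
  -- The square of direction `k` stands on the hexagon side from `ω ^ (k + 1)` to `ω ^ (k + 2)`. So
  -- direction `k + 5` gives the square on the outer side of the inner triangle, directions `k` and
  -- `k + 1` the two squares flanking the middle triangle. The square `q₆`, from a neighbouring
  -- hexagon, holds the far vertex of the outer triangle.
  have q₀ := isAceCell_square hl k
  have q₁ := isAceCell_square hl (k + 1)
  have q₅ := isAceCell_square hl (k + 5)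
  have q₆ := isAceCell_square (eisenstein.add_mem hl hwu) (k + 5)
  have e5 : omega ^ (k + 5) = (1 - omega) * omega ^ k := by
    rw [pow_add]
    linear_combination omega ^ k * (omega ^ 3 + omega ^ 2 - 1) * hw
  rw [e5] at q₅ q₆
  rw [pow_succ'] at q₁
  generalize omega ^ k = u at *
  cases hp with
  | inner =>
    refine ⟨acePeriod l, acePeriod l + (μ + Complex.I * 0), acePeriod l + (omega * μ + Complex.I * 0),
      ?_, .inl ⟨?_, ?_, ?_, _, q₅, ⟨1, by simp [corners], ?_⟩, ⟨0, by simp [corners], ?_⟩⟩⟩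
    · simp only [corners, image_insert_eq, image_singleton]
      congr 1
      · ring
      congr 1
      · ring
      congr 1
      ring
    · have := shadow_acePeriod_add hl h0 h0
      simpa using this
    · rw [shadow_acePeriod_add hl hu h0]; simp [hn]
    · rw [shadow_acePeriod_add hl hwu h0]; simp [hn, norm_omega]
    all_goals linear_combination -μ * hw
  | middle =>
    refine ⟨acePeriod l + ((omega * u - u) + Complex.I * 0), acePeriod l + ((omega * u - u) +
      Complex.I * u), acePeriod l + ((omega * u - u) + Complex.I * (omega * u)),
      ?_, .inr (.inl ⟨u, hn, ?_, ?_, ?_, ?_, ⟨_, q₀, ⟨0, by simp [corners], ?_⟩⟩,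
      ⟨_, q₀, ⟨Complex.I, by simp [corners], ?_⟩⟩,
      ⟨_, q₁, ⟨1 + Complex.I, by simp [corners], ?_⟩⟩⟩)⟩
    · simp only [corners, image_insert_eq, image_singleton]
      congr 1
      · ring
      congr 1
      · ring
      congr 1
      ring
    · ring
    · rw [shadow_acePeriod_add hl hd h0]
      have : 2 * (omega * u - u) + (1 - 2 * omega) * 0 = 2 * (omega - 1) * u := by ring
      rw [this]
      simp [hn, norm_omega_sub_one]
    · rw [shadow_acePeriod_add hl hd hu]; ring
    · rw [shadow_acePeriod_add hl hd hwu]; linear_combination -2 * u * hw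
    · ring
    · ring
    · linear_combination u * hw
  | outer =>
    refine ⟨acePeriod l + ((omega * u - u) + Complex.I * (u + omega * u)), acePeriod l +
      ((omega * u - u) + Complex.I * (omega * u)), acePeriod l + ((omega * u - u) + Complex.I * u),
      ?_, .inr (.inr ⟨u, hn, ?_, ?_, ?_, ⟨_, q₆, ⟨1 + Complex.I, by simp [corners], ?_⟩⟩,
      ⟨_, q₁, ⟨1 + Complex.I, by simp [corners], ?_⟩⟩,
      ⟨_, q₀, ⟨Complex.I, by simp [corners], ?_⟩⟩⟩)⟩
    · simp only [corners, image_insert_eq, image_singleton]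
      congr 1
      · ring
      congr 1
      · ring
      congr 1
      ring
    · rw [shadow_acePeriod_add hl hd hs]; linear_combination -2 * u * hw
    · rw [shadow_acePeriod_add hl hd hwu]; linear_combination -2 * u * hw
    · rw [shadow_acePeriod_add hl hd hu]; ring
    · simp only [acePeriod]; linear_combination u * hw
    · linear_combination u * hw
    · ring

/-- If a vertex of a triangle of the ace tiling lies in no square, then the opposite side of this
triangle is a chord of a square. -/
theorem IsAceCell.exists_square {W : Set ℂ} (h : IsAceCell false W) {x y z : ℂ} (hx : x ∈ W)
    (hy : y ∈ W) (hz : z ∈ W) (hxy : x ≠ y) (hxz : x ≠ z)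
    (hno : ∀ Q, IsAceCell true Q → x ∉ Q) : ∃ Q, IsAceCell true Q ∧ y ∈ Q ∧ z ∈ Q := by
  obtain ⟨a, b, c, rfl, ht⟩ := h.triangle_cases
  simp only [mem_insert_iff, mem_singleton_iff] at hx hy hz
  -- In the two other kinds of triangles every vertex belongs to a square. So the triangle is an
  -- inner one, and `x` is its hexagon centre.
  have hcase : ¬ ((∃ Q, IsAceCell true Q ∧ a ∈ Q) ∧ (∃ Q, IsAceCell true Q ∧ b ∈ Q) ∧
      ∃ Q, IsAceCell true Q ∧ c ∈ Q) := by
    rintro ⟨⟨Qa, ha, ha'⟩, ⟨Qb, hb, hb'⟩, ⟨Qc, hc, hc'⟩⟩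
    rcases hx with rfl | rfl | rfl
    exacts [hno _ ha ha', hno _ hb hb', hno _ hc hc']
  rcases ht with ⟨-, -, -, Q, hQ, hb, hc⟩ | ⟨-, -, -, -, -, -, h⟩ | ⟨-, -, -, -, -, h⟩
  · rcases hx with rfl | rfl | rfl
    · rcases hy with rfl | rfl | rfl
      · exact absurd rfl hxy
      all_goals
        rcases hz with rfl | rfl | rfl
        · exact absurd rfl hxz
        all_goals exact ⟨Q, hQ, by assumption, by assumption⟩
    · exact absurd hb (hno Q hQ)
    · exact absurd hc (hno Q hQ)
  · exact absurd h hcase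
  · exact absurd h hcase

theorem mul_ne_zero_of_norm {a u : ℂ} (ha : ‖a‖ = 1) (hu : ‖u‖ = 1) : a * u ≠ 0 :=
  norm_pos_iff.1 (by rw [norm_mul, ha, hu]; norm_num)

/-- A vertex of shadow `0` lies in no square, which excludes inner triangles. In a middle triangle,
the side `b c` opposite to the hexagon corner lies in no square because the shadows of `b` and `c`
are not opposite, so `z` is the hexagon corner. In an outer triangle all shadows have modulus `1`.
-/
theorem IsAceCell.norm_shadow {W : Set ℂ} (h : IsAceCell false W) {x y z : ℂ} (hx : x ∈ W)
    (hy : y ∈ W) (hz : z ∈ W) (hxy : x ≠ y) (hxz : x ≠ z) (hyz : y ≠ z)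
    (h₁ : ∃ Q, IsAceCell true Q ∧ x ∈ Q ∧ z ∈ Q) (h₂ : ∃ Q, IsAceCell true Q ∧ y ∈ Q ∧ z ∈ Q) :
    ‖shadow x‖ = 1 ∧ ‖shadow y‖ = 1 := by
  obtain ⟨a, b, c, rfl, ht⟩ := h.triangle_cases
  simp only [mem_insert_iff, mem_singleton_iff] at hx hy hz
  obtain ⟨Q₁, hQ₁, hx₁, hz₁⟩ := h₁
  obtain ⟨Q₂, hQ₂, hy₂, hz₂⟩ := h₂
  have key : ∀ v ∈ ({x, y, z} : Set ℂ), shadow v ≠ 0 := by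
    rintro v (rfl | rfl | rfl)
    exacts [shadow_ne_zero hQ₁ hx₁, shadow_ne_zero hQ₂ hy₂, shadow_ne_zero hQ₁ hz₁]
  rcases ht with ⟨h0, -⟩ | ⟨u, hu, hab, ha, hb, hc, -⟩ | ⟨u, hu, ha, hb, hc, -⟩
  · exfalso
    have : a ∈ ({x, y, z} : Set ℂ) := by
      rcases hx with rfl | rfl | rfl <;> rcases hy with rfl | rfl | rfl <;>
        rcases hz with rfl | rfl | rfl <;> simp_all
    exact key a this h0
  · have hs : shadow b + shadow c ≠ 0 := by
      rw [hb, hc]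
      have := mul_ne_zero_of_norm norm_omega_sub_one hu
      intro h0
      exact this (by linear_combination h0)
    have hb1 : ‖shadow b‖ = 1 := by rw [hb, norm_neg, hu]
    have hc1 : ‖shadow c‖ = 1 := by rw [hc, norm_mul, norm_omega, hu, one_mul]
    have hno : ∀ Q, IsAceCell true Q → b ∈ Q → c ∈ Q → b ≠ c → False := fun Q hQ h1 h2 h3 =>
      hs (shadow_add_eq_zero hQ h1 h2 h3 hb1 hc1)
    rcases hx with rfl | rfl | rfl <;> rcases hy with rfl | rfl | rfl <;>
      rcases hz with rfl | rfl | rfl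
    all_goals first
      | exact absurd rfl hxy
      | exact absurd rfl hxz
      | exact absurd rfl hyz
      | exact ⟨hb1, hc1⟩
      | exact ⟨hc1, hb1⟩
      | exact (hno _ hQ₁ hx₁ hz₁ hxz).elim
      | exact (hno _ hQ₁ hz₁ hx₁ hxz.symm).elim
      | exact (hno _ hQ₂ hy₂ hz₂ hyz).elim
      | exact (hno _ hQ₂ hz₂ hy₂ hyz.symm).elim
  · have h1 : ∀ v ∈ ({a, b, c} : Set ℂ), ‖shadow v‖ = 1 := by
      rintro v (rfl | rfl | rfl)
      · rw [ha, norm_mul, hu, norm_sub_rev, norm_omega_sub_one, one_mul]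
      · rw [hb, norm_mul, norm_omega, hu, one_mul]
      · rw [hc, norm_neg, hu]
    exact ⟨h1 x hx, h1 y hy⟩

/-- Inner triangles have no shadow of modulus `1`, and in an outer triangle no two shadows are
opposite, so none of its sides lies in a square. A middle triangle remains, whose third vertex is
determined by the position and shadow of one endpoint of its base. -/
theorem IsAceCell.apex {W : Set ℂ} (h : IsAceCell false W) {x y z : ℂ} (hx : x ∈ W)
    (hy : y ∈ W) (hz : z ∈ W) (hxy : x ≠ y) (hxz : x ≠ z) (hyz : y ≠ z)
    (h₁ : ∃ Q, IsAceCell true Q ∧ x ∈ Q ∧ z ∈ Q) (hx1 : ‖shadow x‖ = 1) (hy1 : ‖shadow y‖ = 1) :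
    ∃ u, ‖u‖ = 1 ∧ ((shadow x = -u ∧ shadow y = omega * u ∧ z = x - Complex.I * u) ∨
      (shadow y = -u ∧ shadow x = omega * u ∧ z = y - Complex.I * u)) := by
  obtain ⟨a, b, c, rfl, ht⟩ := h.triangle_cases
  simp only [mem_insert_iff, mem_singleton_iff] at hx hy hz
  obtain ⟨Q₁, hQ₁, hx₁, hz₁⟩ := h₁
  rcases ht with ⟨h0, h1, h2, -⟩ | ⟨u, hu, hab, ha, hb, hc, -⟩ | ⟨u, hu, ha, hb, hc, -⟩
  · rcases hx with rfl | rfl | rfl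
    · rw [h0, norm_zero] at hx1
      norm_num at hx1
    · rw [h1] at hx1
      norm_num at hx1
    · rw [h2] at hx1
      norm_num at hx1
  · refine ⟨u, hu, ?_⟩
    have hxa : x ≠ a := by
      rintro rfl
      rw [hx1] at ha
      norm_num at ha
    have hya : y ≠ a := by
      rintro rfl
      rw [hy1] at ha
      norm_num at ha
    rcases hx.resolve_left hxa with rfl | rfl <;> rcases hy.resolve_left hya with rfl | rfl
    · exact absurd rfl hxy
    · rcases hz with rfl | rfl | rfl
      · exact .inl ⟨hb, hc, hab⟩
      · exact absurd rfl hxz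
      · exact absurd rfl hyz
    · rcases hz with rfl | rfl | rfl
      · exact .inr ⟨hb, hc, hab⟩
      · exact absurd rfl hyz
      · exact absurd rfl hxz
    · exact absurd rfl hxy
  · exfalso
    have h1 : ‖shadow z‖ = 1 := by
      rcases hz with rfl | rfl | rfl
      · rw [ha, norm_mul, hu, norm_sub_rev, norm_omega_sub_one, one_mul]
      · rw [hb, norm_mul, norm_omega, hu, one_mul]
      · rw [hc, norm_neg, hu]
    have h2 := shadow_add_eq_zero hQ₁ hx₁ hz₁ hxz hx1 h1
    have s₁ : shadow a + shadow b ≠ 0 := by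
      rw [ha, hb]
      have := mul_ne_zero_of_norm norm_one hu
      exact fun h0 => this (by linear_combination h0)
    have s₂ : shadow a + shadow c ≠ 0 := by
      rw [ha, hc]
      have := mul_ne_zero_of_norm norm_omega hu
      exact fun h0 => this (by linear_combination -h0)
    have s₃ : shadow b + shadow c ≠ 0 := by
      rw [hb, hc]
      have := mul_ne_zero_of_norm norm_omega_sub_one hu
      exact fun h0 => this (by linear_combination h0)
    rcases hx with rfl | rfl | rfl <;> rcases hz with rfl | rfl | rfl
    all_goals first
      | exact hxz rfl
      | exact s₁ h2
      | exact s₂ h2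
      | exact s₃ h2
      | exact s₁ (by rw [add_comm]; exact h2)
      | exact s₂ (by rw [add_comm]; exact h2)
      | exact s₃ (by rw [add_comm]; exact h2)

/-- Let two triangles of the ace tiling share the side `x y`, and have the third vertices `z ≠ z'`.
If `x z` and `x z'` are chords of squares, then `y z` is not. -/
theorem IsAceCell.not_exists_square {W W' : Set ℂ} (h : IsAceCell false W)
    (h' : IsAceCell false W') {x y z z' : ℂ} (hx : x ∈ W) (hy : y ∈ W) (hz : z ∈ W)
    (hx' : x ∈ W') (hy' : y ∈ W') (hz' : z' ∈ W') (hxy : x ≠ y) (hxz : x ≠ z) (hyz : y ≠ z)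
    (hxz' : x ≠ z') (hyz' : y ≠ z') (hzz' : z ≠ z')
    (h₁ : ∃ Q, IsAceCell true Q ∧ x ∈ Q ∧ z ∈ Q) (h₂ : ∃ Q, IsAceCell true Q ∧ x ∈ Q ∧ z' ∈ Q) :
    ¬ ∃ Q, IsAceCell true Q ∧ y ∈ Q ∧ z ∈ Q := by
  intro h₃
  obtain ⟨hx1, hy1⟩ := h.norm_shadow hx hy hz hxy hxz hyz h₁ h₃
  obtain ⟨u, hu, e⟩ := h.apex hx hy hz hxy hxz hyz h₁ hx1 hy1
  obtain ⟨u', -, e'⟩ := h'.apex hx' hy' hz' hxy hxz' hyz' h₂ hx1 hy1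
  -- By `norm_shadow` and `apex`, both triangles are middle ones over the base `x y`. Opposite
  -- orientations would give `ω ^ 2 * u = u`, hence `(2 - ω) * u = 0`; equal orientations give the
  -- same apex.
  have key : ∀ {v : ℂ}, -u = omega * v → omega * u = -v → False := by
    intro v h1 h2
    have h3 : (2 - omega) * u = 0 := by linear_combination -h1 - omega * h2 + u * omega_sq
    rcases mul_eq_zero.1 h3 with h4 | h4
    · have := norm_omega
      rw [← sub_eq_zero.1 h4] at this
      norm_num at this
    · simp [h4] at hu
  rcases e with ⟨h1, h2, h3⟩ | ⟨h1, h2, h3⟩ <;> rcases e' with ⟨h4, h5, h6⟩ | ⟨h4, h5, h6⟩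
  · exact hzz' (by rw [h3, h6, neg_injective (h1.symm.trans h4)])
  · exact key (h1.symm.trans h5) (h2.symm.trans h4)
  · exact key (h1.symm.trans h5) (h2.symm.trans h4)
  · exact hzz' (by rw [h3, h6, neg_injective (h1.symm.trans h4)])

/-! ### Tiles with a vertex at infinity and cells of the ace tiling -/

/-- Both corner sets are the extreme points of the same polygon, and their cardinality determines
the kind of the tile. -/
theorem corners_of_hull {g : ℂ ≃ᵢ ℂ} {μ : ℂˣ} {ν : ℂ} {b b' : Bool} {W : Set ℂ}
    (hW : IsAceCell b' W) (h : simBase μ ν b = g '' convexHull ℝ W) :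
    b = b' ∧ simCorners μ ν b = g '' W := by
  obtain ⟨μ', ν', hμ', rfl⟩ := hW.exists_pose
  have hsub : g '' simCorners μ' ν' b' ⊆
      Metric.sphere (g (μ' * centre b' + ν')) (‖(μ' : ℂ)‖ * circumradius b') := by
    rintro _ ⟨w, hw, rfl⟩
    rw [Metric.mem_sphere, g.dist_eq]
    exact simCorners_subset_sphere μ' ν' b' hw
  have hc : simCorners μ ν b = g '' simCorners μ' ν' b' := by
    rw [← extremePoints_simBase, h, image_convexHull_of_isometryEquiv,
      extremePoints_convexHull_of_sphere hsub]
  refine ⟨?_, hc⟩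
  have hn := congrArg ncard hc
  rw [ncard_image_of_injective _ g.injective, simCorners, simCorners,
    ncard_image_of_injective _ (similarity_injective μ ν),
    ncard_image_of_injective _ (similarity_injective μ' ν'), ncard_corners, ncard_corners] at hn
  cases b <;> cases b' <;> simp at hn <;> rfl

theorem exists_cell {𝒟 : Set (Set HypSpace)} {g : ℂ ≃ᵢ ℂ} {b b' : Bool} (h𝒟 : IsTiling 𝒟)
    (hb : std b ∈ 𝒟) (hg : horosphericalSection 𝒟 = (fun X => g '' X) '' aceTiling) {μ : ℂˣ}
    {ν : ℂ} (hP : sim μ ν '' std b' ∈ 𝒟) :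
    ∃ W, IsAceCell b' W ∧ simCorners μ ν b' = g '' W := by
  have hμ := h𝒟.norm_eq_one hb hP
  have hmem : simBase μ ν b' ∈ horosphericalSection 𝒟 :=
    ⟨(interior_simBase_nonempty μ ν b').mono interior_subset, _, hP, (preimage_horosphere hμ).symm⟩
  rw [hg] at hmem
  obtain ⟨X, hX, e⟩ := hmem
  obtain ⟨b'', W, hW, rfl⟩ := mem_aceTiling.1 hX
  obtain ⟨rfl, h⟩ := corners_of_hull hW e.symm
  exact ⟨W, hW, h⟩

theorem exists_tile {𝒟 : Set (Set HypSpace)} {g : ℂ ≃ᵢ ℂ} {b b' : Bool} (h𝒟 : IsTiling 𝒟)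
    (hb : std b ∈ 𝒟) (hg : horosphericalSection 𝒟 = (fun X => g '' X) '' aceTiling) {W : Set ℂ}
    (hW : IsAceCell b' W) :
    ∃ (μ : ℂˣ) (ν : ℂ), sim μ ν '' std b' ∈ 𝒟 ∧ simCorners μ ν b' = g '' W := by
  have hmem : g '' convexHull ℝ W ∈ horosphericalSection 𝒟 := by
    rw [hg]
    exact mem_image_of_mem _ (mem_aceTiling.2 ⟨_, W, hW, rfl⟩)
  obtain ⟨-, P, hP, e⟩ := hmem
  -- A cell has interior points, so the tile that cuts it out of the horosphere must be vertical.
  have hne : (interior (horosphere ⁻¹' P)).Nonempty := by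
    obtain ⟨μ', ν', hμ', rfl⟩ := hW.exists_pose
    rw [← e, ← simBase_eq, ← g.coe_toHomeomorph, ← g.toHomeomorph.image_interior]
    exact (interior_simBase_nonempty μ' ν' b').image _
  obtain ⟨μ, ν, b'', hμ, rfl⟩ := h𝒟.exists_eq_sim hb hP hne
  rw [preimage_horosphere hμ] at e
  obtain ⟨rfl, h⟩ := corners_of_hull hW e.symm
  exact ⟨μ, ν, hP, h⟩

theorem corners_subset_finiteVertices (b : Bool) : corners b ⊆ finiteVertices b := by
  cases b
  · exact Subset.rfl
  · exact subset_insert _ _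

theorem mem_idealVertices_sim {μ : ℂˣ} {ν : ℂ} {b : Bool} {w : ℂ} (hw : w ∈ simCorners μ ν b) :
    (w : OnePoint ℂ) ∈ idealVertices (sim μ ν '' std b) := by
  obtain ⟨v, hv, rfl⟩ := hw
  exact mem_idealVertices_image (mapsIdeal_sim μ ν v)
    (mem_idealVertices_std (corners_subset_finiteVertices b hv))

theorem exists_of_mem_idealVertices_sim {μ : ℂˣ} {ν : ℂ} {b : Bool} {w : ℂ}
    (hw : (w : OnePoint ℂ) ∈ idealVertices (sim μ ν '' std b)) :
    ∃ v ∈ finiteVertices b, w = μ * v + ν := by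
  have e : (w : ℂ) = μ * ((μ : ℂ)⁻¹ * (w - ν)) + ν := by
    rw [mul_inv_cancel_left₀ μ.ne_zero]
    ring
  refine ⟨_, mem_finiteVertices ?_, e⟩
  have h := mapsIdeal_sim μ ν ((μ : ℂ)⁻¹ * (w - ν))
  rw [← e] at h
  exact mem_idealVertices_of_image (sim_mem_isom μ ν) h hw

/-- Some tetrahedron (`false`) or octahedron (`true`) of `𝒟` has all points of `A` among its ideal
vertices. -/
def Spans (b : Bool) (𝒟 : Set (Set HypSpace)) (A : Set (OnePoint ℂ)) : Prop :=
  ∃ φ ∈ isom, φ '' std b ∈ 𝒟 ∧ A ⊆ idealVertices (φ '' std b)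

theorem Spans.mono {b : Bool} {𝒟 : Set (Set HypSpace)} {A B : Set (OnePoint ℂ)}
    (h : Spans b 𝒟 B) (hAB : A ⊆ B) : Spans b 𝒟 A := by
  obtain ⟨φ, h1, h2, h3⟩ := h
  exact ⟨φ, h1, h2, hAB.trans h3⟩

theorem spans_of_cell {𝒟 : Set (Set HypSpace)} {g : ℂ ≃ᵢ ℂ} {b b' : Bool} (h𝒟 : IsTiling 𝒟)
    (hb : std b ∈ 𝒟) (hg : horosphericalSection 𝒟 = (fun X => g '' X) '' aceTiling) {W : Set ℂ}
    (hW : IsAceCell b' W) :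
    Spans b' 𝒟 (insert OnePoint.infty ((fun w => (g w : OnePoint ℂ)) '' W)) := by
  obtain ⟨μ, ν, hP, e⟩ := exists_tile h𝒟 hb hg hW
  refine ⟨_, sim_mem_isom μ ν, hP, insert_subset ?_ ?_⟩
  · exact mem_idealVertices_image (mapsIdeal_sim_infty μ ν) (infty_mem_idealVertices_std b')
  · rintro _ ⟨w, hw, rfl⟩
    exact mem_idealVertices_sim (e ▸ mem_image_of_mem g hw)

theorem triangle_of_spans {𝒟 : Set (Set HypSpace)} {g : ℂ ≃ᵢ ℂ} {b : Bool} (h𝒟 : IsTiling 𝒟)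
    (hb : std b ∈ 𝒟) (hg : horosphericalSection 𝒟 = (fun X => g '' X) '' aceTiling) {A : Set ℂ}
    (h : Spans false 𝒟 (insert OnePoint.infty ((fun w => (g w : OnePoint ℂ)) '' A))) :
    ∃ W, IsAceCell false W ∧ A ⊆ W := by
  obtain ⟨φ, hφ, hP, hA⟩ := h
  obtain ⟨μ, ν, e⟩ := eq_sim_image hφ (hA (mem_insert _ _))
  rw [e] at hP hA
  obtain ⟨W, hW, hc⟩ := exists_cell h𝒟 hb hg hP
  refine ⟨W, hW, fun a ha => ?_⟩
  obtain ⟨v, hv, e⟩ := exists_of_mem_idealVertices_sim (hA (.inr (mem_image_of_mem _ ha)))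
  have h1 : g a ∈ simCorners μ ν false := ⟨v, hv, e.symm⟩
  rwa [hc, g.injective.mem_set_image] at h1

/-- The point `c` corresponds to the ideal vertex of the octahedron opposite to `∞`, which lies over
the centre of the square and is not visible as a vertex of the link. -/
theorem square_of_spans {𝒟 : Set (Set HypSpace)} {g : ℂ ≃ᵢ ℂ} {b : Bool} (h𝒟 : IsTiling 𝒟)
    (hb : std b ∈ 𝒟) (hg : horosphericalSection 𝒟 = (fun X => g '' X) '' aceTiling) {A : Set ℂ}
    (h : Spans true 𝒟 (insert OnePoint.infty ((fun w => (g w : OnePoint ℂ)) '' A))) :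
    ∃ W c, IsAceCell true W ∧ A ⊆ insert c W ∧ ∀ w ∈ W, ‖w - c‖ = circumradius true := by
  obtain ⟨φ, hφ, hP, hA⟩ := h
  obtain ⟨μ, ν, e⟩ := eq_sim_image hφ (hA (mem_insert _ _))
  rw [e] at hP hA
  obtain ⟨W, hW, hc⟩ := exists_cell h𝒟 hb hg hP
  refine ⟨W, g.symm (μ * centre true + ν), hW, fun a ha => ?_, fun w hw => ?_⟩
  · obtain ⟨v, hv, e⟩ := exists_of_mem_idealVertices_sim (hA (.inr (mem_image_of_mem _ ha)))
    rcases hv with rfl | hv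
    · exact .inl (by rw [← e, g.symm_apply_apply])
    · have h1 : g a ∈ simCorners μ ν true := ⟨v, hv, e.symm⟩
      rw [hc, g.injective.mem_set_image] at h1
      exact .inr h1
  · have h1 := simCorners_subset_sphere μ ν true (hc ▸ mem_image_of_mem g hw)
    rw [Metric.mem_sphere, h𝒟.norm_eq_one hb hP, one_mul] at h1
    rw [← dist_eq_norm, ← g.dist_eq, g.apply_symm_apply, h1]

theorem circumradius_true_sq : circumradius true ^ 2 = 1 / 2 := by
  rw [circumradius, sq_norm_eq]
  simp [centre]
  norm_num

theorem not_spans_origin {𝒟 : Set (Set HypSpace)} {g : ℂ ≃ᵢ ℂ} {b : Bool} (h𝒟 : IsTiling 𝒟)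
    (hb : std b ∈ 𝒟) (hg : horosphericalSection 𝒟 = (fun X => g '' X) '' aceTiling) :
    ¬ Spans true 𝒟 {OnePoint.infty, (g 0 : OnePoint ℂ)} := by
  intro h
  obtain ⟨W, c, hW, hA, hr⟩ := square_of_spans (A := {0}) h𝒟 hb hg (by simpa using h)
  rcases hA rfl with rfl | h0
  · exact not_centre hW (fun w hw => by simpa using hr w hw)
  · refine shadow_ne_zero hW h0 ?_
    have := shadow_add_I_mul eisenstein.zero_mem eisenstein.zero_mem
    simpa using this

/-- The centre of a unit square is at distance `1 / √2` from the corners, so two points at distance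
one are both corners. -/
theorem square_of_spans_pair {𝒟 : Set (Set HypSpace)} {g : ℂ ≃ᵢ ℂ} {b : Bool} (h𝒟 : IsTiling 𝒟)
    (hb : std b ∈ 𝒟) (hg : horosphericalSection 𝒟 = (fun X => g '' X) '' aceTiling) {x y : ℂ}
    (hxy : ‖x - y‖ = 1)
    (h : Spans true 𝒟 {OnePoint.infty, (g x : OnePoint ℂ), (g y : OnePoint ℂ)}) :
    ∃ W, IsAceCell true W ∧ x ∈ W ∧ y ∈ W := by
  obtain ⟨W, c, hW, hA, hr⟩ := square_of_spans (A := {x, y}) h𝒟 hb hg (by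
    simpa only [image_insert_eq, image_singleton] using h)
  have h1 := circumradius_true_sq
  rcases hA (by simp : x ∈ ({x, y} : Set ℂ)) with rfl | hx <;>
    rcases hA (by simp : y ∈ ({x, y} : Set ℂ)) with hc | hy
  · simp [hc] at hxy
  · rw [← hr y hy, norm_sub_rev, hxy] at h1
    norm_num at h1
  · rw [← hr x hx, ← hc, hxy] at h1
    norm_num at h1
  · exact ⟨W, hW, hx, hy⟩

theorem IsAceCell.norm_sub {W : Set ℂ} (h : IsAceCell false W) {x y : ℂ} (hx : x ∈ W)
    (hy : y ∈ W) (hxy : x ≠ y) : ‖x - y‖ = 1 := by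
  obtain ⟨μ, ν, hμ, rfl⟩ := h.exists_pose
  obtain ⟨v, hv, rfl⟩ := hx
  obtain ⟨w, hw, rfl⟩ := hy
  have e : (μ : ℂ) * v + ν - (μ * w + ν) = μ * (v - w) := by ring
  have hvw : v ≠ w := fun h => hxy (by rw [h])
  simp only [e, norm_mul, hμ, one_mul]
  simp only [corners, mem_insert_iff, mem_singleton_iff] at hv hw
  rcases hv with rfl | rfl | rfl <;> rcases hw with rfl | rfl | rfl <;>
    simp [norm_omega, norm_omega_sub_one, norm_sub_rev 1 omega] at hvw ⊢

/-! ### The links of the ideal vertices -/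

/-- The vertex figures at all ideal vertices of `𝒟` are ace tilings. -/
def IsAceEverywhere (𝒟 : Set (Set HypSpace)) : Prop :=
  ∀ ψ ∈ isom, ∀ b, std b ∈ push ψ 𝒟 →
    ∃ g : ℂ ≃ᵢ ℂ, horosphericalSection (push ψ 𝒟) = (fun X => g '' X) '' aceTiling

theorem exists_coe_eq (g : ℂ ≃ᵢ ℂ) {x : OnePoint ℂ} (hx : OnePoint.infty ≠ x) :
    ∃ a : ℂ, x = (g a : OnePoint ℂ) := by
  obtain ⟨w, rfl⟩ := OnePoint.ne_infty_iff_exists.1 hx.symm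
  exact ⟨g.symm w, by rw [g.apply_symm_apply]⟩

theorem spans_push {b : Bool} {𝒟 : Set (Set HypSpace)} {ψ : Equiv.Perm HypSpace} (hψ : ψ ∈ isom)
    {f : OnePoint ℂ → OnePoint ℂ} (hf : ∀ ξ, MapsIdeal ψ ξ (f ξ)) {A : Set (OnePoint ℂ)} :
    Spans b (push ψ 𝒟) (f '' A) ↔ Spans b 𝒟 A := by
  constructor
  · rintro ⟨φ, hφ, hP, hA⟩
    have e : φ '' std b = ψ '' ((ψ⁻¹ * φ : Equiv.Perm HypSpace) '' std b) := by
      rw [← image_mul, mul_inv_cancel_left]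
    rw [e] at hP hA
    exact ⟨_, isom.mul_mem (isom.inv_mem hψ) hφ, image_mem_push.1 hP, fun a ha =>
      mem_idealVertices_of_image hψ (hf a) (hA (mem_image_of_mem f ha))⟩
  · rintro ⟨φ, hφ, hP, hA⟩
    refine ⟨ψ * φ, isom.mul_mem hψ hφ, ?_, ?_⟩
    · rw [image_mul]
      exact image_mem_push.2 hP
    · rintro _ ⟨a, ha, rfl⟩
      rw [image_mul]
      exact mem_idealVertices_image (hf a) (hA ha)

/-- Any vertex of a tile can be moved to infinity, and the tile to a standard one. -/
theorem exists_move {b : Bool} {𝒟 : Set (Set HypSpace)} {A : Set (OnePoint ℂ)} {v : OnePoint ℂ}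
    (h : Spans b 𝒟 A) (hv : v ∈ A) :
    ∃ ψ ∈ isom, std b ∈ push ψ 𝒟 ∧ MapsIdeal ψ v OnePoint.infty := by
  obtain ⟨φ, hφ, hP, hA⟩ := h
  obtain ⟨ξ, hξ⟩ := exists_mapsIdeal (isom.inv_mem hφ) v
  have h1 := hξ.inv (isom.inv_mem hφ)
  rw [inv_inv] at h1
  obtain ⟨χ, hχ, h2, h3⟩ := exists_symmetry (mem_idealVertices_of_image hφ h1 (hA hv))
  refine ⟨χ * φ⁻¹, isom.mul_mem hχ (isom.inv_mem hφ), ?_, h3.comp hξ⟩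
  have := (image_mem_push (φ := χ * φ⁻¹)).2 hP
  rwa [image_mul, inv_image_image, h2] at this

/-- In the link of `v`, the vertex `x` lies in no square, since such a square would come from an
octahedron containing `v` and `x`. So `x` is a hexagon centre, and the opposite side `y z` of the
triangle belongs to a square by `IsAceCell.exists_square`. -/
theorem IsAceEverywhere.spans {𝒟 : Set (Set HypSpace)} (h𝒟 : IsTiling 𝒟) (h : IsAceEverywhere 𝒟)
    {v x y z : OnePoint ℂ} (hvx : v ≠ x) (hvy : v ≠ y) (hvz : v ≠ z) (hxy : x ≠ y) (hxz : x ≠ z)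
    (h₁ : Spans false 𝒟 {v, x, y, z}) (h₂ : ¬ Spans true 𝒟 {v, x}) :
    Spans true 𝒟 {v, y, z} := by
  obtain ⟨ψ, hψ, hb, hv⟩ := exists_move h₁ (mem_insert _ _)
  obtain ⟨g, hg⟩ := h ψ hψ _ hb
  obtain ⟨f, hf⟩ := Classical.axiomOfChoice (exists_mapsIdeal hψ)
  have hfv : f v = OnePoint.infty := (hf v).unique hv
  have hinj : ∀ {ξ η}, ξ ≠ η → f ξ ≠ f η := fun {ξ η} hne e =>
    hne ((hf ξ).injective hψ (e ▸ hf η))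
  rw [← spans_push hψ hf] at h₁ h₂ ⊢
  simp only [image_insert_eq, image_singleton, hfv] at h₁ h₂ ⊢
  replace hvx := hfv ▸ hinj hvx
  replace hvy := hfv ▸ hinj hvy
  replace hvz := hfv ▸ hinj hvz
  replace hxy := hinj hxy
  replace hxz := hinj hxz
  obtain ⟨x', ex⟩ := exists_coe_eq g hvx
  obtain ⟨y', ey⟩ := exists_coe_eq g hvy
  obtain ⟨z', ez⟩ := exists_coe_eq g hvz
  rw [ex, ey] at hxy
  rw [ex, ez] at hxz
  rw [ex, ey, ez] at h₁
  rw [ex] at h₂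
  rw [ey, ez]
  have hT := isTiling_push hψ h𝒟
  obtain ⟨W, hW, hA⟩ := triangle_of_spans (A := {x', y', z'}) hT hb hg (by
    simpa only [image_insert_eq, image_singleton] using h₁)
  obtain ⟨Q, hQ, hy, hz⟩ := hW.exists_square (x := x') (hA (by simp)) (hA (by simp : y' ∈ _))
    (hA (by simp : z' ∈ _)) (fun e => hxy (by rw [e])) (fun e => hxz (by rw [e]))
    fun Q hQ hx => h₂ ((spans_of_cell hT hb hg hQ).mono (insert_subset_insert
      (singleton_subset_iff.2 (mem_image_of_mem _ hx))))
  exact (spans_of_cell hT hb hg hQ).mono (insert_subset_insert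
    (insert_subset (mem_image_of_mem _ hy) (singleton_subset_iff.2 (mem_image_of_mem _ hz))))

/-- `IsAceCell.not_exists_square` in the link of `v`. Sides of triangles have length one, so
octahedra containing `v` and the two ends of such a side do show up as squares on these ends, by
`square_of_spans_pair`. -/
theorem IsAceEverywhere.not_spans {𝒟 : Set (Set HypSpace)} (h𝒟 : IsTiling 𝒟)
    (h : IsAceEverywhere 𝒟) {v x y z t : OnePoint ℂ} (hvx : v ≠ x) (hvy : v ≠ y) (hvz : v ≠ z)
    (hvt : v ≠ t) (hxy : x ≠ y) (hxz : x ≠ z) (hyz : y ≠ z) (hxt : x ≠ t) (hyt : y ≠ t)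
    (hzt : z ≠ t) (h₁ : Spans false 𝒟 {v, x, y, z}) (h₂ : Spans false 𝒟 {v, x, y, t})
    (h₃ : Spans true 𝒟 {v, x, z}) (h₄ : Spans true 𝒟 {v, x, t}) : ¬ Spans true 𝒟 {v, y, z} := by
  obtain ⟨ψ, hψ, hb, hv⟩ := exists_move h₁ (mem_insert _ _)
  obtain ⟨g, hg⟩ := h ψ hψ _ hb
  obtain ⟨f, hf⟩ := Classical.axiomOfChoice (exists_mapsIdeal hψ)
  have hfv : f v = OnePoint.infty := (hf v).unique hv
  have hinj : ∀ {ξ η}, ξ ≠ η → f ξ ≠ f η := fun {ξ η} hne e =>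
    hne ((hf ξ).injective hψ (e ▸ hf η))
  rw [← spans_push hψ hf] at h₁ h₂ h₃ h₄ ⊢
  simp only [image_insert_eq, image_singleton, hfv] at h₁ h₂ h₃ h₄ ⊢
  obtain ⟨x', ex⟩ := exists_coe_eq g (hfv ▸ hinj hvx)
  obtain ⟨y', ey⟩ := exists_coe_eq g (hfv ▸ hinj hvy)
  obtain ⟨z', ez⟩ := exists_coe_eq g (hfv ▸ hinj hvz)
  obtain ⟨t', et⟩ := exists_coe_eq g (hfv ▸ hinj hvt)
  have hne : ∀ {ξ η a b}, ξ ≠ η → f ξ = (g a : OnePoint ℂ) → f η = (g b : OnePoint ℂ) → a ≠ b := by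
    rintro ξ η a b h1 h2 h3 rfl
    exact hinj h1 (h2.trans h3.symm)
  replace hxy := hne hxy ex ey
  replace hxz := hne hxz ex ez
  replace hyz := hne hyz ey ez
  replace hxt := hne hxt ex et
  replace hyt := hne hyt ey et
  replace hzt := hne hzt ez et
  rw [ex, ey, ez] at h₁
  rw [ex, ey, et] at h₂
  rw [ex, ez] at h₃
  rw [ex, et] at h₄
  rw [ey, ez]
  have hT := isTiling_push hψ h𝒟
  obtain ⟨W, hW, hA⟩ := triangle_of_spans (A := {x', y', z'}) hT hb hg (by
    simpa only [image_insert_eq, image_singleton] using h₁)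
  obtain ⟨W', hW', hA'⟩ := triangle_of_spans (A := {x', y', t'}) hT hb hg (by
    simpa only [image_insert_eq, image_singleton] using h₂)
  have hx : x' ∈ W := hA (by simp)
  have hy : y' ∈ W := hA (by simp)
  have hz : z' ∈ W := hA (by simp)
  have hx' : x' ∈ W' := hA' (by simp)
  have ht : t' ∈ W' := hA' (by simp)
  intro h₅
  exact hW.not_exists_square hW' hx hy hz hx' (hA' (by simp)) ht hxy hxz hyz hxt hyt hzt
    (square_of_spans_pair hT hb hg (hW.norm_sub hx hz hxz) h₃)
    (square_of_spans_pair hT hb hg (hW'.norm_sub hx' ht hxt) h₄)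
    (square_of_spans_pair hT hb hg (hW.norm_sub hy hz hyz) h₅)

/-! ### Conclusion -/

/-- The links of two vertices of the tetrahedron `∞, 0, 1, ω` disagree: the one of `0` requires an
octahedron through `0, 1, ω`, and the one of `1` forbids it. -/
theorem not_isAceEverywhere {𝒟 : Set (Set HypSpace)} {g : ℂ ≃ᵢ ℂ} {b : Bool} (h𝒟 : IsTiling 𝒟)
    (hb : std b ∈ 𝒟) (hg : horosphericalSection 𝒟 = (fun X => g '' X) '' aceTiling) :
    ¬ IsAceEverywhere 𝒟 := by
  intro h
  have hw := omega_sq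
  have h0 := eisenstein.zero_mem
  have p0 : acePeriod 0 = 0 := by simp [acePeriod]
  have e3 : omega ^ 3 = -1 := by linear_combination (omega + 1) * hw
  have e4 : omega ^ 4 = -omega := by linear_combination omega * e3
  have e5 : omega ^ 5 = 1 - omega := by linear_combination omega ^ 2 * e3 - hw
  have d1 : omega ≠ 0 := omega_ne_zero
  have d2 : 1 - omega ≠ 0 := e5 ▸ pow_ne_zero 5 d1
  have d3 : (1 : ℂ) ≠ omega := sub_ne_zero.1 d2
  have d4 : omega ≠ 1 - omega := by
    intro e
    have := congrArg Complex.im e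
    simp [omega] at this
    linarith [sqrt_three_pos]
  have cell : ∀ {b' W} (A : Set ℂ), IsAceCell b' W → A ⊆ W →
      Spans b' 𝒟 (insert OnePoint.infty ((fun w => (g w : OnePoint ℂ)) '' A)) := fun A hW hA =>
    (spans_of_cell h𝒟 hb hg hW).mono (insert_subset_insert (image_mono hA))
  have t₁ := cell {0, 1, omega} ⟨0, h0, 0, _, _, .inner, rfl⟩ (by
    rintro z hz
    refine ⟨z, hz, ?_⟩
    rw [p0, pow_zero]
    ring)
  have t₂ := cell {0, 1, 1 - omega} ⟨0, h0, 5, _, _, .inner, rfl⟩ (by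
    rw [p0, e5]
    rintro z (rfl | rfl | rfl)
    · exact ⟨0, by simp [corners], by ring⟩
    · exact ⟨omega, by simp [corners], by linear_combination -hw⟩
    · exact ⟨1, by simp [corners], by ring⟩)
  -- The squares on the hexagon sides `1, ω` and `ω⁵, 1` have directions `5` and `4`.
  have s₁ := cell {1, omega} ⟨0, h0, 5, _, _, .square, rfl⟩ (by
    rw [p0, e5]
    rintro z (rfl | rfl)
    · exact ⟨1, by simp [corners], by linear_combination -hw⟩
    · exact ⟨0, by simp [corners], by linear_combination -hw⟩)
  have s₂ := cell {1, 1 - omega} ⟨0, h0, 4, _, _, .square, rfl⟩ (by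
    rw [p0, e4]
    rintro z (rfl | rfl)
    · exact ⟨0, by simp [corners], by linear_combination -hw⟩
    · exact ⟨1, by simp [corners], by linear_combination -hw⟩)
  simp only [image_insert_eq, image_singleton] at t₁ t₂ s₁ s₂
  have ne : ∀ {a c : ℂ}, a ≠ c → (g a : OnePoint ℂ) ≠ g c := fun hac e =>
    hac (g.injective (OnePoint.coe_injective e))
  have ni : ∀ a : ℂ, (g a : OnePoint ℂ) ≠ OnePoint.infty := fun a => OnePoint.coe_ne_infty _
  -- In the link of `1`, the triangles `∞ 0 ω` and `∞ 0 ω⁵` share the side `∞ 0`, and `s₁`, `s₂` put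
  -- `∞ ω` and `∞ ω⁵` in squares.
  have k₁ : ¬ Spans true 𝒟 {(g 1 : OnePoint ℂ), (g 0 : OnePoint ℂ), (g omega : OnePoint ℂ)} :=
    h.not_spans h𝒟 (t := (g (1 - omega) : OnePoint ℂ)) (ni 1) (ne one_ne_zero) (ne d3)
      (ne fun e => d1 (by linear_combination e)) (ni 0).symm (ni _).symm (ne d1.symm) (ni _).symm
      (ne d2.symm) (ne d4) (t₁.mono (by grind)) (t₂.mono (by grind)) (s₁.mono (by grind))
      (s₂.mono (by grind))
  -- In the link of `0`, the vertex `∞` lies in no square, so the side `1 ω` opposite to it belongs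
  -- to one.
  refine k₁ ((h.spans h𝒟 (v := (g 0 : OnePoint ℂ)) (ni 0) (ne zero_ne_one) (ne d1.symm)
    (ni 1).symm (ni omega).symm (t₁.mono (by grind)) ?_).mono (by grind))
  rw [pair_comm]
  exact not_spans_origin h𝒟 hb hg

end

end MixedPlatonic

theorem mainTheorem6 (Γ : Subgroup (Equiv.Perm MixedPlatonic.HypSpace))
    (hΓ : MixedPlatonic.IsMixedPlatonicManifold Γ) (hcusp : MixedPlatonic.IsOneCusped Γ)
    (g : ℂ ≃ᵢ ℂ) :
    ¬ MixedPlatonic.IsPeripheralTiling Γ ((fun X => g '' X) '' MixedPlatonic.aceTiling) := by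
  open MixedPlatonic in
  rintro ⟨φ, hφ, 𝒟, h𝒟, hpos, hsec⟩
  obtain ⟨b, hb⟩ : ∃ b, std b ∈ 𝒟 := hpos.elim (fun h => ⟨false, h⟩) fun h => ⟨true, h⟩
  -- Every link is congruent to the one at `∞`, because the conjugate of `Γ` that preserves `𝒟` is
  -- again one-cusped and acts freely.
  refine not_isAceEverywhere h𝒟.isTiling hb hsec.symm fun ψ hψ b' hb' => ?_
  obtain ⟨g', hg'⟩ := section_push_congruent (conjGroup_le_isom hφ hΓ.1.le_isom)
    (ActsFreely.conj hΓ.1.free φ) (hcusp.conj hφ) h𝒟.isTiling h𝒟.isCofinite hb hψ hb'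
  refine ⟨g.trans g', ?_⟩
  rw [hg', ← hsec, image_image]
  simp only [image_image]
  rfl
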